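/- For $d\in\mathbb C$ let $\mathcal K_d$ be the Temperley–Lieb category: its objects are $X^{\otimes n}$, $n\ge 0$ (with $I=X^{\otimes 0}$); $\mathrm{Hom}(X^{\otimes m},X^{\otimes n})$ is the complex vector space spanned by the planar (crossingless) pairings of $m$ lower and $n$ upper boundary points of a box; composition is vertical stacking, where each closed loop is replaced by the factor $d$; the tensor product is horizontal juxtaposition. The Markov trace $\mathrm{tr}$ on $\mathrm{End}(X^{\otimes n})$ is obtained by closing diagrams completely, each loop counting $d$. Put $$\mathrm{Ker}(X^{\otimes m},X^{\otimes n})=\{f\in\mathrm{Hom}(X^{\otimes m},X^{\otimes n}) : \mathrm{tr}(fg)=0\text{ for all } g\in \mathrm{Hom}(X^{\otimes n},X^{\otimes m})\},\qquad \mathrm{Ker}(X^{\otimes k})=\mathrm{Ker}(X^{\otimes k},X^{\otimes k}).$$ The reduced Temperley–Lieb category $\overline{\mathcal K}_d$ has the same objects as $\mathcal K_d$, its hom-spaces are the quotients of those of $\mathcal K_d$ by $\mathrm{Ker}$, and its composition and tensor product are inherited from $\mathcal K_d$. Let $l\ge 2$, let $q\in\mathbb C^\times$ be such that $q^2$ is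 a primitive $l$-th root of unity, and let $d=q+q^{-1}$. With $[k]_q=(q^k-q^{-k})/(q-q^{-1})$, let $f_k\in\mathrm{End}(X^{\otimes k})$, $0\le k\le l-1$, be the Jones–Wenzl elements $$f_0=1_I,\quad f_1=1_X,\quad f_{k+1}=f_k\otimes 1_X-\frac{[k]_q}{[k+1]_q}(f_k\otimes 1_X)h_k(f_k\otimes 1_X)\quad(1\le k<l-1),$$ where $h_k=1_{X^{\otimes (k-1)}}\otimes(\cup\circ\cap)\in\mathrm{End}(X^{\otimes(k+1)})$. Then: 1. The $f_k$ ($0\le k\le l-1$) are idempotents and $f_{l-1}\neq0$. One has $\mathrm{Ker}(X^{\otimes k})=\{0\}$ for $k<l-1$ and $\mathrm{Ker}(X^{\otimes (l-1)})=\mathbb C f_{l-1}$. 2. $\mathrm{Ker}$ is the monoidal ideal generated by $f_{l-1}$, i.e. the smallest family of subspaces of the hom-spaces of $\mathcal K_d$ which contains $f_{l-1}$ and is stable under composition and tensor product, on both sides, with arbitrary morphisms. 3. $\overline{\mathcal K}_d$ is semisimple: its hom-spaces are finite-dimensional, and the endomorphism algebra of every finite formal direct sum of its objects is semisimple. Let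 $\overline X_k$ be the object of the idempotent completion of $\overline{\mathcal K}_d$ defined by the class of $f_k$. Then $\overline X_0,\dots,\overline X_{l-2}$ are simple with $\mathrm{Hom}(\overline X_j,\overline X_k)=\delta_{jk}\,\mathbb C\,1_{\overline X_k}$; every simple object of the idempotent completion is isomorphic to one of them, and every object of it is a finite direct sum of copies of them. 4. In the idempotent completion, with the convention $\overline X_{-1}=0$ and $\overline X=\overline X_1$ the image of $X$, $$\overline X_k\otimes\overline X\cong\begin{cases}\overline X_{k-1}\oplus\overline X_{k+1}&\text{if }0\le k<l-2,\\ \overline X_{l-3}&\text{if }k=l-2.\end{cases}$$ -/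

import Mathlib

namespace TemperleyLieb

/-- Gluing data: strings joining the points of `T` in pairs, some of the end points
being identified in pairs by `glue`; the end points fixed by `glue` remain free and are
labelled by `U`. -/
structure Gluing (U T : Type) where
  arc : T → T
  arc_arc : ∀ t, arc (arc t) = t
  arc_ne : ∀ t, arc t ≠ t
  glue : T → T
  glue_glue : ∀ t, glue (glue t) = t
  outer : U → T
  outer_injective : Function.Injective outer
  glue_eq_iff : ∀ t, glue t = t ↔ ∃ u, outer u = t

namespace Gluing

/-- Two end points are adjacent if they are joined by a string or glued together. -/
inductive Adj {U T : Type} (G : Gluing U T) : T → T → Prop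
  | arc (t : T) : Adj G t (G.arc t)
  | glue (t : T) : Adj G t (G.glue t)

/-- The connected curves obtained after the gluing. -/
abbrev Curve {U T : Type} (G : Gluing U T) : Type := Quot G.Adj

/-- The curve through a given point. -/
abbrev curve {U T : Type} (G : Gluing U T) (t : T) : G.Curve := Quot.mk _ t

/-- The number of closed loops, i.e. of the curves without a free end point. -/
noncomputable def loops {U T : Type} (G : Gluing U T) : ℕ :=
  Nat.card {c : G.Curve // ∀ u, G.curve (G.outer u) ≠ c}

theorem curve_arc {U T : Type} (G : Gluing U T) (t : T) : G.curve (G.arc t) = G.curve t :=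
  (Quot.sound (Adj.arc t)).symm

theorem curve_glue {U T : Type} (G : Gluing U T) (t : T) : G.curve (G.glue t) = G.curve t :=
  (Quot.sound (Adj.glue t)).symm

/-- One step along a curve. -/
def step {U T : Type} (G : Gluing U T) : Equiv.Perm T where
  toFun t := G.glue (G.arc t)
  invFun t := G.arc (G.glue t)
  left_inv t := by simp [G.glue_glue, G.arc_arc]
  right_inv t := by simp [G.glue_glue, G.arc_arc]

theorem curve_step_zpow {U T : Type} (G : Gluing U T) (k : ℤ) (t : T) :
    G.curve ((G.step ^ k) t) = G.curve t := by
  have h1 : ∀ s, G.curve (G.step s) = G.curve s := fun s =>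
    (G.curve_glue _).trans (G.curve_arc _)
  induction k generalizing t with
  | zero => rfl
  | succ n ih =>
    rw [zpow_add_one, Equiv.Perm.mul_apply, ih, h1]
  | pred n ih =>
    rw [zpow_sub_one, Equiv.Perm.mul_apply, ih]
    conv_rhs => rw [← G.step.apply_symm_apply t, h1]
    rfl

theorem glue_step_zpow {U T : Type} (G : Gluing U T) (k : ℤ) (t : T) :
    G.glue ((G.step ^ k) t) = (G.step ^ (-k)) (G.glue t) := by
  have h1 : ∀ s, G.glue (G.step s) = G.step⁻¹ (G.glue s) := fun s => by
    change G.glue (G.glue (G.arc s)) = G.arc (G.glue (G.glue s))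
    simp [G.glue_glue]
  have h2 : ∀ s, G.glue (G.step⁻¹ s) = G.step (G.glue s) := fun s => by
    change G.glue (G.arc (G.glue s)) = G.glue (G.arc (G.glue s))
    rfl
  induction k generalizing t with
  | zero => rfl
  | succ n ih =>
    rw [zpow_add_one, Equiv.Perm.mul_apply, ih, h1, ← Equiv.Perm.mul_apply, neg_add,
      zpow_add, zpow_neg_one]
  | pred n ih =>
    rw [zpow_sub_one, Equiv.Perm.mul_apply, ih, h2, ← Equiv.Perm.mul_apply, neg_sub,
      sub_neg_eq_add, add_comm (1 : ℤ), zpow_add_one, neg_neg]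

theorem exists_step_zpow {U T : Type} (G : Gluing U T) (x : T) (hx : G.glue x = x) (y : T)
    (h : G.curve x = G.curve y) :
    ∃ k : ℤ, y = (G.step ^ k) x := by
  have h' := Quot.eqvGen_exact h
  let r : Setoid T :=
    { r := fun s t => (∃ k : ℤ, t = (G.step ^ k) s) ∨ ∃ k : ℤ, t = (G.step ^ k) (G.glue s)
      iseqv :=
        { refl := fun s => Or.inl ⟨0, rfl⟩
          symm := by
            rintro s t (⟨k, rfl⟩ | ⟨k, rfl⟩)
            · exact Or.inl ⟨-k, by rw [← Equiv.Perm.mul_apply, ← zpow_add]; simp⟩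
            · refine Or.inr ⟨k, ?_⟩
              rw [glue_step_zpow, G.glue_glue, ← Equiv.Perm.mul_apply, ← zpow_add]; simp
          trans := by
            rintro s t u (⟨k, rfl⟩ | ⟨k, rfl⟩) (⟨l, rfl⟩ | ⟨l, rfl⟩)
            · exact Or.inl ⟨l + k, by rw [zpow_add]; rfl⟩
            · exact Or.inr ⟨l - k, by rw [glue_step_zpow, sub_eq_add_neg, zpow_add]; rfl⟩
            · exact Or.inr ⟨l + k, by rw [zpow_add]; rfl⟩
            · exact Or.inl ⟨l - k, by
                rw [glue_step_zpow, G.glue_glue, sub_eq_add_neg, zpow_add]; rfl⟩ } }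
  have key : ∀ s t, Relation.EqvGen G.Adj s t → r.r s t := by
    intro s t hst
    induction hst with
    | rel a b hab =>
      cases hab with
      | arc =>
        refine Or.inr ⟨-1, ?_⟩
        change G.arc a = G.arc (G.glue (G.glue a))
        rw [G.glue_glue]
      | glue => exact Or.inr ⟨0, rfl⟩
    | refl a => exact r.iseqv.refl a
    | symm a b _ ih => exact r.iseqv.symm ih
    | trans a b c _ _ ih1 ih2 => exact r.iseqv.trans ih1 ih2
  rcases key _ _ h' with hk | hk
  · exact hk
  · rwa [hx] at hk

/-- Every curve with a free end point has exactly two of them. -/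
theorem existsUnique_partner {U T : Type} [Finite T] (G : Gluing U T) (u : U) :
    ∃! v : U, v ≠ u ∧ G.curve (G.outer v) = G.curve (G.outer u) := by
  set x := G.outer u with hxdef
  have hx : G.glue x = x := (G.glue_eq_iff x).2 ⟨u, rfl⟩
  set N : ℕ := Function.minimalPeriod G.step x with hN
  have hNpos : 0 < N := Function.minimalPeriod_pos_of_mem_periodicPts
    (Function.Injective.mem_periodicPts G.step.injective x)
  have hper : ∀ k : ℤ, (G.step ^ k) x = x ↔ (N : ℤ) ∣ k := by
    intro k
    have := MulAction.zpow_smul_eq_iff_period_dvd (j := k) (g := G.step) (a := x)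
    simpa [Equiv.Perm.smul_def, MulAction.period_eq_minimalPeriod] using this
  have hper2 : ∀ k l : ℤ, (G.step ^ k) x = (G.step ^ l) x ↔ (N : ℤ) ∣ k - l := by
    intro k l
    rw [← hper, sub_eq_neg_add, zpow_add, Equiv.Perm.mul_apply, zpow_neg, Equiv.Perm.inv_eq_iff_eq]
  have hfix : ∀ k : ℤ, G.glue ((G.step ^ k) x) = (G.step ^ k) x ↔ (N : ℤ) ∣ 2 * k := by
    intro k
    rw [glue_step_zpow, hx, hper2]
    rw [show -k - k = -(2 * k) by ring, dvd_neg]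
  have heven : Even N := by
    by_contra ho
    obtain ⟨m, hm⟩ := Nat.not_even_iff_odd.1 ho
    have h1 : G.arc ((G.step ^ (m : ℤ)) x) = (G.step ^ (m : ℤ)) x := by
      have h2 : G.arc ((G.step ^ (m : ℤ)) x) = G.glue ((G.step ^ ((m : ℤ) + 1)) x) := by
        rw [add_comm, zpow_add, zpow_one]
        change _ = G.glue (G.glue (G.arc _))
        rw [G.glue_glue]
      rw [h2, glue_step_zpow, hx, hper2]
      refine ⟨-1, ?_⟩
      rw [hm]; push_cast; ring
    exact G.arc_ne _ h1
  obtain ⟨m, hm⟩ := heven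
  have hyfix : G.glue ((G.step ^ (m : ℤ)) x) = (G.step ^ (m : ℤ)) x := by
    rw [hfix, hm]; refine ⟨1, ?_⟩; push_cast; ring
  obtain ⟨v, hv⟩ := (G.glue_eq_iff _).1 hyfix
  refine ⟨v, ⟨?_, ?_⟩, ?_⟩
  · rintro rfl
    rw [← hxdef] at hv
    have := (hper m).1 hv.symm
    have h3 := Int.le_of_dvd (by omega) this
    omega
  · rw [hv, curve_step_zpow]
  · rintro w ⟨hw1, hw2⟩
    apply G.outer_injective
    obtain ⟨k, hk⟩ := G.exists_step_zpow x hx _ hw2.symm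
    rw [hv, hk, hper2]
    have h1 : (N : ℤ) ∣ 2 * k := by
      rw [← hfix, ← hk]; exact (G.glue_eq_iff _).2 ⟨w, rfl⟩
    have h2 : ¬ (N : ℤ) ∣ k := by
      rw [← hper, ← hk]
      intro h; exact hw1 (G.outer_injective h)
    obtain ⟨a, ha⟩ := h1
    have hk' : k = m * a := by
      rw [hm] at ha; push_cast at ha; linarith
    rcases Int.even_or_odd' a with ⟨b, rfl | rfl⟩
    · exact absurd ⟨b, by rw [hk', hm]; push_cast; ring⟩ h2
    · exact ⟨b, by rw [hk', hm]; push_cast; ring⟩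

/-- The other free end point of the curve starting at a given free end point. -/
noncomputable def partner {U T : Type} [Finite T] (G : Gluing U T) (u : U) : U :=
  (G.existsUnique_partner u).choose

theorem partner_ne {U T : Type} [Finite T] (G : Gluing U T) (u : U) : G.partner u ≠ u :=
  (G.existsUnique_partner u).choose_spec.1.1

theorem curve_partner {U T : Type} [Finite T] (G : Gluing U T) (u : U) :
    G.curve (G.outer (G.partner u)) = G.curve (G.outer u) :=
  (G.existsUnique_partner u).choose_spec.1.2

theorem eq_partner {U T : Type} [Finite T] (G : Gluing U T) (u v : U) (h : v ≠ u)
    (h' : G.curve (G.outer v) = G.curve (G.outer u)) : v = G.partner u :=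
  (G.existsUnique_partner u).choose_spec.2 v ⟨h, h'⟩

theorem partner_partner {U T : Type} [Finite T] (G : Gluing U T) (u : U) :
    G.partner (G.partner u) = u :=
  (G.eq_partner _ _ (G.partner_ne u).symm (G.curve_partner u).symm).symm

/-- Counting the two-colourings of the points which are constant along the curves and are
prescribed at the free end points. -/
theorem card_colorings {U T : Type} [Finite T] (G : Gluing U T) (c : U → Bool)
    [Decidable (∀ u, c (G.partner u) = c u)] :
    Nat.card {φ : T → Bool // (∀ t, φ (G.arc t) = φ t) ∧ (∀ t, φ (G.glue t) = φ t) ∧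
      ∀ u, φ (G.outer u) = c u} = if ∀ u, c (G.partner u) = c u then 2 ^ G.loops else 0 := by
  classical
  split_ifs with hc
  · have hcol : ∀ u v, G.curve (G.outer v) = G.curve (G.outer u) → c v = c u := by
      intro u v h
      by_cases huv : v = u
      · rw [huv]
      · rw [G.eq_partner u v huv h, hc]
    have e : {φ : T → Bool // (∀ t, φ (G.arc t) = φ t) ∧ (∀ t, φ (G.glue t) = φ t) ∧
        ∀ u, φ (G.outer u) = c u} ≃ ({x : G.Curve // ∀ u, G.curve (G.outer u) ≠ x} → Bool) :=
      { toFun := fun φ x => Quot.lift φ.1 (by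
          rintro a b (_ | _)
          · exact (φ.2.1 _).symm
          · exact (φ.2.2.1 _).symm) x.1
        invFun := fun ψ => ⟨fun t =>
            if h : ∃ u, G.curve (G.outer u) = G.curve t then c h.choose
            else ψ ⟨G.curve t, by push Not at h; exact h⟩, by
          refine ⟨fun t => ?_, fun t => ?_, fun u => ?_⟩
          · simp only [G.curve_arc]
          · simp only [G.curve_glue]
          · have h : ∃ v, G.curve (G.outer v) = G.curve (G.outer u) := ⟨u, rfl⟩
            simp only [dif_pos h]
            exact hcol _ _ h.choose_spec⟩
        left_inv := by
          rintro ⟨φ, h1, h2, h3⟩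
          ext t
          have hlift : ∀ s t, G.curve s = G.curve t → φ s = φ t := fun s t hst =>
            congrArg (Quot.lift φ (by
              rintro a b (_ | _)
              · exact (h1 _).symm
              · exact (h2 _).symm)) hst
          dsimp only
          split_ifs with h
          · rw [← h3, hlift _ _ h.choose_spec]
          · rfl
        right_inv := by
          intro ψ
          ext ⟨x, hx⟩
          induction x using Quot.ind with
          | mk t =>
            have h : ¬ ∃ u, G.curve (G.outer u) = G.curve t := by push Not; exact hx
            simp only [dif_neg h] }
    rw [Nat.card_congr e, Nat.card_fun, loops]
    simp
  · rw [Nat.card_eq_zero]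
    left
    refine ⟨fun ⟨φ, h1, h2, h3⟩ => hc fun u => ?_⟩
    have := congrArg (Quot.lift φ (by
      rintro a b (_ | _)
      · exact (h1 _).symm
      · exact (h2 _).symm)) (G.curve_partner u)
    simpa [h3] using this

theorem ite_parity (p p' q q' : ℕ) (h1 : p ≠ q) (h2 : p ≠ q') (h3 : p' ≠ q) (h4 : p' ≠ q')
    (c1 : ¬ (p < q ∧ q < p' ∧ p' < q')) (c2 : ¬ (p < q' ∧ q' < p' ∧ p' < q))
    (c3 : ¬ (p' < q ∧ q < p ∧ p < q')) (c4 : ¬ (p' < q' ∧ q' < p ∧ p < q))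
    (c5 : ¬ (q < p ∧ p < q' ∧ q' < p')) (c6 : ¬ (q < p' ∧ p' < q' ∧ q' < p))
    (c7 : ¬ (q' < p ∧ p < q ∧ q < p')) (c8 : ¬ (q' < p' ∧ p' < q ∧ q < p)) :
    ((if p < q then (1 : ZMod 2) else 0) + (if p' < q then (1 : ZMod 2) else 0)) +
      ((if p < q' then (1 : ZMod 2) else 0) + (if p' < q' then (1 : ZMod 2) else 0)) = 0 := by
  split_ifs
  all_goals first
    | decide
    | exact (c1 (by clear c1 c2 c3 c4 c5 c6 c7 c8; omega)).elim
    | exact (c2 (by clear c1 c2 c3 c4 c5 c6 c7 c8; omega)).elim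
    | exact (c3 (by clear c1 c2 c3 c4 c5 c6 c7 c8; omega)).elim
    | exact (c4 (by clear c1 c2 c3 c4 c5 c6 c7 c8; omega)).elim
    | exact (c5 (by clear c1 c2 c3 c4 c5 c6 c7 c8; omega)).elim
    | exact (c6 (by clear c1 c2 c3 c4 c5 c6 c7 c8; omega)).elim
    | exact (c7 (by clear c1 c2 c3 c4 c5 c6 c7 c8; omega)).elim
    | exact (c8 (by clear c1 c2 c3 c4 c5 c6 c7 c8; omega)).elim

/-- Pairing of a sum over two sets stable under pairwise non-crossing arcs. -/
theorem sum_lt_eq_zero {T : Type} (a : T → T) (haa : ∀ t, a (a t) = t) (pos : T → ℕ)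
    (hpos : Function.Injective pos)
    (hnc : ∀ s t, ¬ (pos s < pos t ∧ pos t < pos (a s) ∧ pos (a s) < pos (a t)))
    (P Q : Finset T) (hP : ∀ t ∈ P, a t ∈ P ∧ a t ≠ t) (hQ : ∀ t ∈ Q, a t ∈ Q ∧ a t ≠ t)
    (hPQ : Disjoint P Q) :
    ∑ s ∈ P, ∑ t ∈ Q, (if pos s < pos t then (1 : ZMod 2) else 0) = 0 := by
  have hdouble : ∀ z : ZMod 2, z + z = 0 := by decide
  have key : ∀ s ∈ P, ∑ t ∈ Q, (if pos s < pos t then (1 : ZMod 2) else 0) +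
      ∑ t ∈ Q, (if pos (a s) < pos t then (1 : ZMod 2) else 0) = 0 := by
    intro s hs
    rw [← Finset.sum_add_distrib]
    refine Finset.sum_involution (fun t _ => a t) ?_ ?_ ?_ ?_
    · intro t ht
      have hne : ∀ x ∈ P, ∀ y ∈ Q, pos x ≠ pos y := fun x hx y hy h =>
        Finset.disjoint_left.1 hPQ hx (hpos h ▸ hy)
      have h1 := hne s hs t ht
      have h2 := hne s hs (a t) (hQ t ht).1
      have h3 := hne (a s) (hP s hs).1 t ht
      have h4 := hne (a s) (hP s hs).1 (a t) (hQ t ht).1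
      have c1 := hnc s t
      have c2 := hnc s (a t)
      have c3 := hnc (a s) t
      have c4 := hnc (a s) (a t)
      have c5 := hnc t s
      have c6 := hnc t (a s)
      have c7 := hnc (a t) s
      have c8 := hnc (a t) (a s)
      simp only [haa] at c1 c2 c3 c4 c5 c6 c7 c8
      exact ite_parity _ _ _ _ h1 h2 h3 h4 c1 c2 c3 c4 c5 c6 c7 c8
    · intro t ht _; exact (hQ t ht).2
    · intro t ht; exact (hQ t ht).1
    · intro t _; exact haa t
  refine Finset.sum_involution (fun s _ => a s) ?_ ?_ ?_ ?_
  · intro s hs; exact key s hs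
  · intro s hs _; exact (hP s hs).2
  · intro s hs; exact (hP s hs).1
  · intro s _; exact haa s

theorem partner_noncrossing {U T : Type} [Finite T] (G : Gluing U T) (pos : T → ℕ)
    (hpos : Function.Injective pos)
    (harc : ∀ s t, ¬ (pos s < pos t ∧ pos t < pos (G.arc s) ∧ pos (G.arc s) < pos (G.arc t)))
    (hglue : ∀ s t, ¬ (pos s < pos t ∧ pos t < pos (G.glue s) ∧ pos (G.glue s) < pos (G.glue t)))
    (hsep : ∀ u v s, G.glue s ≠ s →
      ((pos (G.outer u) < pos s ↔ pos (G.outer u) < pos (G.glue s)) ↔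
        (pos (G.outer v) < pos s ↔ pos (G.outer v) < pos (G.glue s)))) (u v : U) :
    ¬ (pos (G.outer u) < pos (G.outer v) ∧ pos (G.outer v) < pos (G.outer (G.partner u)) ∧
      pos (G.outer (G.partner u)) < pos (G.outer (G.partner v))) := by
  classical
  have := Fintype.ofFinite T
  rintro ⟨l1, l2, l3⟩
  let P : U → Finset T := fun u => Finset.univ.filter fun t => G.curve t = G.curve (G.outer u)
  let F : U → Finset T := fun u => (P u).filter fun t => G.glue t = t
  let B : U → Finset T := fun u => (P u).filter fun t => ¬ G.glue t = t
  have hF : ∀ u, F u = {G.outer u, G.outer (G.partner u)} := by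
    intro u
    ext t
    simp only [F, P, Finset.mem_filter, Finset.mem_univ, true_and, Finset.mem_insert,
      Finset.mem_singleton]
    constructor
    · rintro ⟨h1, h2⟩
      obtain ⟨w, rfl⟩ := (G.glue_eq_iff t).1 h2
      by_cases hw : w = u
      · left; rw [hw]
      · right; rw [G.eq_partner u w hw h1]
    · rintro (rfl | rfl)
      · exact ⟨rfl, (G.glue_eq_iff _).2 ⟨u, rfl⟩⟩
      · exact ⟨G.curve_partner u, (G.glue_eq_iff _).2 ⟨_, rfl⟩⟩
  have hne : ∀ u, G.outer u ≠ G.outer (G.partner u) := fun u h =>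
    G.partner_ne u (G.outer_injective h).symm
  have hP : ∀ u, ∀ t ∈ P u, G.arc t ∈ P u ∧ G.arc t ≠ t := by
    intro u t ht
    simp only [P, Finset.mem_filter, Finset.mem_univ, true_and] at ht ⊢
    exact ⟨(G.curve_arc t).trans ht, G.arc_ne t⟩
  have hB : ∀ u, ∀ t ∈ B u, G.glue t ∈ B u ∧ G.glue t ≠ t := by
    intro u t ht
    simp only [B, P, Finset.mem_filter, Finset.mem_univ, true_and] at ht ⊢
    refine ⟨⟨(G.curve_glue t).trans ht.1, ?_⟩, ht.2⟩
    rw [G.glue_glue]; exact fun h => ht.2 h.symm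
  have hdis : Disjoint (P u) (P v) := by
    rw [Finset.disjoint_left]
    intro t h1 h2
    simp only [P, Finset.mem_filter, Finset.mem_univ, true_and] at h1 h2
    have huv : v ≠ u := by rintro rfl; omega
    have := G.eq_partner u v huv (h2.symm.trans h1)
    rw [← this] at l2
    omega
  have hdisB : Disjoint (B u) (B v) :=
    Finset.disjoint_of_subset_left (Finset.filter_subset _ _)
      (Finset.disjoint_of_subset_right (Finset.filter_subset _ _) hdis)
  let f : T → T → ZMod 2 := fun s t => if pos s < pos t then 1 else 0
  have tot : ∑ s ∈ P u, ∑ t ∈ P v, f s t = 0 :=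
    sum_lt_eq_zero G.arc G.arc_arc pos hpos harc _ _ (hP u) (hP v) hdis
  have bb : ∑ s ∈ B u, ∑ t ∈ B v, f s t = 0 :=
    sum_lt_eq_zero G.glue G.glue_glue pos hpos hglue _ _ (hB u) (hB v) hdisB
  have fb : ∑ s ∈ F u, ∑ t ∈ B v, f s t = 0 := by
    rw [hF, Finset.sum_pair (hne u), ← Finset.sum_add_distrib]
    refine Finset.sum_involution (fun t _ => G.glue t) ?_ ?_ ?_ ?_
    · intro t ht
      have e := hsep u (G.partner u) t (hB v t ht).2
      simp only [f]
      by_cases k1 : pos (G.outer u) < pos t <;>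
      by_cases k2 : pos (G.outer u) < pos (G.glue t) <;>
      by_cases k3 : pos (G.outer (G.partner u)) < pos t <;>
      by_cases k4 : pos (G.outer (G.partner u)) < pos (G.glue t) <;>
      simp only [k1, k2, k3, k4, iff_true, iff_false, not_true, if_true,
        if_false] at e ⊢ <;> decide
    · intro t ht _; exact (hB v t ht).2
    · intro t ht; exact (hB v t ht).1
    · intro t _; exact G.glue_glue t
  have bf : ∑ s ∈ B u, ∑ t ∈ F v, f s t = 0 := by
    refine Finset.sum_involution (fun t _ => G.glue t) ?_ ?_ ?_ ?_
    · intro t ht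
      have e := hsep v (G.partner v) t (hB u t ht).2
      rw [hF, Finset.sum_pair (hne v), Finset.sum_pair (hne v)]
      have hn : ∀ w s, G.glue s ≠ s → (f s (G.outer w) =
          if pos (G.outer w) < pos s then 0 else 1) := by
        intro w s hs
        have : pos (G.outer w) ≠ pos s := fun h =>
          hs ((hpos h) ▸ (G.glue_eq_iff _).2 ⟨w, rfl⟩)
        simp only [f]
        split_ifs <;> first | rfl | omega
      rw [hn _ _ (hB u t ht).2, hn _ _ (hB u t ht).2,
        hn _ _ (hB u _ (hB u t ht).1).2, hn _ _ (hB u _ (hB u t ht).1).2]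
      by_cases k1 : pos (G.outer v) < pos t <;>
      by_cases k2 : pos (G.outer v) < pos (G.glue t) <;>
      by_cases k3 : pos (G.outer (G.partner v)) < pos t <;>
      by_cases k4 : pos (G.outer (G.partner v)) < pos (G.glue t) <;>
      simp only [k1, k2, k3, k4, iff_true, iff_false, not_true, if_true,
        if_false] at e ⊢ <;> decide
    · intro t ht _; exact (hB u t ht).2
    · intro t ht; exact (hB u t ht).1
    · intro t _; exact G.glue_glue t
  have ff : ∑ s ∈ F u, ∑ t ∈ F v, f s t = 0 := by
    have hsplit : ∀ w (g : T → ZMod 2), ∑ s ∈ P w, g s = ∑ s ∈ F w, g s + ∑ s ∈ B w, g s :=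
      fun w g => (Finset.sum_filter_add_sum_filter_not _ _ _).symm
    rw [hsplit] at tot
    simp only [hsplit v, Finset.sum_add_distrib, fb, bf, bb, add_zero] at tot
    exact tot
  rw [hF, hF, Finset.sum_pair (hne u), Finset.sum_pair (hne v), Finset.sum_pair (hne v)] at ff
  simp only [f] at ff
  rw [if_pos l1, if_pos (by omega), if_neg (by omega), if_pos l3] at ff
  exact absurd ff (by decide)

end Gluing
/-- The position of an end point on the boundary of the box, read clockwise starting from the
upper left corner: the `m` upper points from left to right, then the `n` lower points from
right to left. -/
def boundaryPos (m n : ℕ) : Fin m ⊕ Fin n → ℕ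
  | .inl i => i
  | .inr j => m + Fin.rev j

theorem boundaryPos_injective (m n : ℕ) : Function.Injective (boundaryPos m n) := by
  rintro (i | i) (j | j) h <;> simp only [boundaryPos, Fin.val_rev] at h <;>
    first | (congr 1; ext; omega) | omega

/-- Kauffman diagrams with `m` upper and `n` lower points: perfect matchings of the `m + n`
boundary points, without crossings. -/
@[ext]
structure Diagram (m n : ℕ) where
  arc : Fin m ⊕ Fin n → Fin m ⊕ Fin n
  arc_arc : ∀ x, arc (arc x) = x
  arc_ne : ∀ x, arc x ≠ x
  noncrossing : ∀ x y, ¬ (boundaryPos m n x < boundaryPos m n y ∧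
    boundaryPos m n y < boundaryPos m n (arc x) ∧
    boundaryPos m n (arc x) < boundaryPos m n (arc y))

namespace Diagram

/-- The diagram of `n` vertical strings. -/
def id (n : ℕ) : Diagram n n where
  arc := Sum.swap
  arc_arc := Sum.swap_swap
  arc_ne := by rintro (i | i) <;> simp
  noncrossing := by
    rintro (i | i) (j | j) <;> simp only [boundaryPos, Sum.swap_inl, Sum.swap_inr, Fin.val_rev] <;> omega

/-- The cup `∪`, joining the two upper points. -/
def cup : Diagram 2 0 where
  arc := Sum.map Fin.rev (fun j => j)
  arc_arc := by rintro (i | i) <;> simp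
  arc_ne := by
    rintro (i | i)
    · simp only [Sum.map_inl, ne_eq, Sum.inl.injEq, Fin.ext_iff, Fin.val_rev]; omega
    · exact i.elim0
  noncrossing := by
    rintro (i | i) (j | j)
    · simp only [boundaryPos, Sum.map_inl, Fin.val_rev]; omega
    all_goals exact Fin.elim0 ‹_›

/-- The cap `∩`, joining the two lower points. -/
def cap : Diagram 0 2 where
  arc := Sum.map (fun j => j) Fin.rev
  arc_arc := by rintro (i | i) <;> simp
  arc_ne := by
    rintro (i | i)
    · exact i.elim0
    · simp only [Sum.map_inr, ne_eq, Sum.inr.injEq, Fin.ext_iff, Fin.val_rev]; omega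
  noncrossing := by
    rintro (i | i) (j | j)
    · exact Fin.elim0 i
    · exact Fin.elim0 i
    · exact Fin.elim0 j
    · simp only [boundaryPos, Sum.map_inr, Fin.val_rev]; omega

/-- Stacking `D` on top of `E`: the lower points of `D` are glued to the upper points
of `E`. -/
def stack {m n p : ℕ} (D : Diagram m n) (E : Diagram n p) :
    Gluing (Fin m ⊕ Fin p) ((Fin m ⊕ Fin n) ⊕ (Fin n ⊕ Fin p)) where
  arc := Sum.map D.arc E.arc
  arc_arc := by rintro (x | x) <;> simp [D.arc_arc, E.arc_arc]
  arc_ne := by rintro (x | x) <;> simp [D.arc_ne, E.arc_ne]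
  glue
    | .inl (.inl i) => .inl (.inl i)
    | .inl (.inr j) => .inr (.inl j)
    | .inr (.inl j) => .inl (.inr j)
    | .inr (.inr k) => .inr (.inr k)
  glue_glue := by rintro ((x | x) | (x | x)) <;> rfl
  outer := Sum.map Sum.inl Sum.inr
  outer_injective := Sum.map_injective.2 ⟨Sum.inl_injective, Sum.inr_injective⟩
  glue_eq_iff := by rintro ((x | x) | (x | x)) <;> simp

/-- The diagram obtained by stacking `D` on top of `E` and removing the loops. -/
noncomputable def comp {m n p : ℕ} (D : Diagram m n) (E : Diagram n p) : Diagram m p where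
  arc := (stack D E).partner
  arc_arc := (stack D E).partner_partner
  arc_ne := (stack D E).partner_ne
  noncrossing := by
    let pos : (Fin m ⊕ Fin n) ⊕ (Fin n ⊕ Fin p) → ℕ :=
      Sum.elim (boundaryPos m n) (fun t => m + n + boundaryPos n p t)
    have hb : ∀ m n x, boundaryPos m n x < m + n := by
      rintro m n (i | i) <;> simp only [boundaryPos, Fin.val_rev] <;> omega
    have hpos : Function.Injective pos := by
      rintro (x | x) (y | y) h <;> simp only [pos, Sum.elim_inl, Sum.elim_inr] at h
      · rw [boundaryPos_injective _ _ h]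
      · have := hb _ _ x; omega
      · have := hb _ _ y; omega
      · rw [boundaryPos_injective _ _ (Nat.add_left_cancel h)]
    have key := (stack D E).partner_noncrossing pos hpos
      (by
        rintro (x | x) (y | y) <;> simp only [pos, stack, Sum.map_inl, Sum.map_inr,
          Sum.elim_inl, Sum.elim_inr]
        · exact D.noncrossing x y
        · have := hb _ _ (D.arc x); omega
        · have := hb _ _ y; omega
        · have := E.noncrossing x y; omega)
      (by
        rintro ((x | x) | (x | x)) ((y | y) | (y | y)) <;> simp only [pos, stack,
          Sum.elim_inl, Sum.elim_inr, boundaryPos, Fin.val_rev] <;> omega)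
      (by
        rintro (x | x) (y | y) ((s | s) | (s | s)) hs <;>
          first
          | exact absurd rfl hs
          | (clear hs
             simp only [pos, stack, Sum.map_inl, Sum.map_inr, Sum.elim_inl, Sum.elim_inr,
               boundaryPos, Fin.val_rev]
             omega))
    have hmono : ∀ x y, boundaryPos m p x < boundaryPos m p y →
        pos ((stack D E).outer x) < pos ((stack D E).outer y) := by
      rintro (x | x) (y | y) <;> simp only [pos, stack, Sum.map_inl, Sum.map_inr,
        Sum.elim_inl, Sum.elim_inr, boundaryPos, Fin.val_rev] <;> omega
    rintro x y ⟨h1, h2, h3⟩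
    exact key x y ⟨hmono _ _ h1, hmono _ _ h2, hmono _ _ h3⟩

/-- The number of loops removed when `D` is stacked on top of `E`. -/
noncomputable def compLoops {m n p : ℕ} (D : Diagram m n) (E : Diagram n p) : ℕ :=
  (stack D E).loops

/-- Relabelling of the end points of two boxes placed side by side. -/
def juxtapose (m n m' n' : ℕ) :
    (Fin m ⊕ Fin n) ⊕ (Fin m' ⊕ Fin n') ≃ Fin (m + m') ⊕ Fin (n + n') :=
  (Equiv.sumSumSumComm _ _ _ _).trans (Equiv.sumCongr finSumFinEquiv finSumFinEquiv)

theorem boundaryPos_juxtapose (m n m' n' : ℕ) :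
    (∀ i, boundaryPos (m + m') (n + n') (juxtapose m n m' n' (.inl (.inl i))) = i) ∧
    (∀ i, boundaryPos (m + m') (n + n') (juxtapose m n m' n' (.inl (.inr i))) =
      m + m' + (n + n' - (i + 1))) ∧
    (∀ i, boundaryPos (m + m') (n + n') (juxtapose m n m' n' (.inr (.inl i))) = m + i) ∧
    (∀ i, boundaryPos (m + m') (n + n') (juxtapose m n m' n' (.inr (.inr i))) =
      m + m' + (n + n' - (n + i + 1))) := by
  refine ⟨?_, ?_, ?_, ?_⟩ <;> intro i <;> simp [juxtapose, boundaryPos, Fin.val_rev]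

/-- Juxtaposition of diagrams, `D` to the left of `E`. -/
def tensor {m n m' n' : ℕ} (D : Diagram m n) (E : Diagram m' n') :
    Diagram (m + m') (n + n') where
  arc x := juxtapose m n m' n' (Sum.map D.arc E.arc ((juxtapose m n m' n').symm x))
  arc_arc x := by
    rw [Equiv.symm_apply_apply, Sum.map_map]
    have : Sum.map (D.arc ∘ D.arc) (E.arc ∘ E.arc) = _root_.id := by
      ext (x | x) <;> simp [D.arc_arc, E.arc_arc]
    simp [this]
  arc_ne x := by
    rw [ne_eq, ← Equiv.eq_symm_apply]
    rcases (juxtapose m n m' n').symm x with y | y <;> simp [D.arc_ne, E.arc_ne]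
  noncrossing := by
    have hD : ∀ x y, boundaryPos (m + m') (n + n') (juxtapose m n m' n' (.inl x)) <
        boundaryPos (m + m') (n + n') (juxtapose m n m' n' (.inl y)) →
        boundaryPos m n x < boundaryPos m n y := by
      rintro (x | x) (y | y) <;> simp [juxtapose, boundaryPos, Fin.val_rev] <;> omega
    have hE : ∀ x y, boundaryPos (m + m') (n + n') (juxtapose m n m' n' (.inr x)) <
        boundaryPos (m + m') (n + n') (juxtapose m n m' n' (.inr y)) →
        boundaryPos m' n' x < boundaryPos m' n' y := by
      rintro (x | x) (y | y) <;> simp [juxtapose, boundaryPos, Fin.val_rev] <;> omega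
    have hDE : ∀ x y, boundaryPos (m + m') (n + n') (juxtapose m n m' n' (.inl x)) <
        boundaryPos (m + m') (n + n') (juxtapose m n m' n' (.inr y)) → x.isLeft := by
      rintro (x | x) (y | y) <;> simp [juxtapose, boundaryPos, Fin.val_rev] <;> omega
    have hED : ∀ x y, boundaryPos (m + m') (n + n') (juxtapose m n m' n' (.inr x)) <
        boundaryPos (m + m') (n + n') (juxtapose m n m' n' (.inl y)) → y.isRight := by
      rintro (x | x) (y | y) <;> simp [juxtapose, boundaryPos, Fin.val_rev] <;> omega
    have hlr : ∀ z : Fin m ⊕ Fin n, z.isLeft → z.isRight → False := by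
      rintro (z | z) <;> simp
    intro x y
    obtain ⟨x, rfl⟩ := (juxtapose m n m' n').surjective x
    obtain ⟨y, rfl⟩ := (juxtapose m n m' n').surjective y
    rintro ⟨h1, h2, h3⟩
    rw [Equiv.symm_apply_apply] at h2 h3
    rw [Equiv.symm_apply_apply] at h3
    rcases x with x | x <;> rcases y with y | y <;>
      simp only [Sum.map_inl, Sum.map_inr] at h1 h2 h3
    · exact D.noncrossing x y ⟨hD _ _ h1, hD _ _ h2, hD _ _ h3⟩
    · exact hlr _ (hDE _ _ h3) (hED _ _ h2)
    · exact hlr _ (hDE _ _ h2) (hED _ _ h1)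
    · exact E.noncrossing x y ⟨hE _ _ h1, hE _ _ h2, hE _ _ h3⟩

/-- Closing a diagram completely: every upper point is joined to the lower point below it. -/
def closure {n : ℕ} (D : Diagram n n) : Gluing Empty (Fin n ⊕ Fin n) where
  arc := D.arc
  arc_arc := D.arc_arc
  arc_ne := D.arc_ne
  glue := Sum.swap
  glue_glue := Sum.swap_swap
  outer := Empty.elim
  outer_injective := fun x => x.elim
  glue_eq_iff := by rintro (i | i) <;> simp

/-- The number of loops of the closure of a diagram. -/
noncomputable def closureLoops {n : ℕ} (D : Diagram n n) : ℕ := D.closure.loops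

/-- The matrix recording which two-colourings of the end points are constant along the strings;
an auxiliary tool for proving the associativity of the composition. -/
noncomputable def mat {m n : ℕ} (D : Diagram m n) : Matrix (Fin m → Bool) (Fin n → Bool) ℕ :=
  fun x y => if ∀ s, Sum.elim x y (D.arc s) = Sum.elim x y s then 1 else 0

theorem mat_inj {m n : ℕ} {D E : Diagram m n} {a b : ℕ} (h : 2 ^ a • D.mat = 2 ^ b • E.mat) :
    a = b ∧ D = E := by
  have hab : a = b := by
    have := congrFun (congrFun h fun _ => true) fun _ => true
    have h1 : ∀ s : Fin m ⊕ Fin n,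
        Sum.elim (fun _ => true) (fun _ => true) s = true := by rintro (s | s) <;> rfl
    simp [mat, h1] at this
    exact this
  refine ⟨hab, ?_⟩
  subst hab
  ext1
  funext s
  by_contra hs
  let c : Fin m ⊕ Fin n → Bool := fun t => decide (t = s ∨ t = D.arc s)
  have hc : Sum.elim (c ∘ Sum.inl) (c ∘ Sum.inr) = c := by ext (t | t) <;> rfl
  have := congrFun (congrFun h (c ∘ Sum.inl)) (c ∘ Sum.inr)
  simp only [mat, Matrix.smul_apply, hc] at this
  rw [if_pos, if_neg] at this
  · simp at this
  · intro h2
    have h3 := h2 s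
    simp only [c, true_or, decide_true, decide_eq_true_eq] at h3
    rcases h3 with h3 | h3
    · exact E.arc_ne s h3
    · exact hs h3.symm
  · intro t
    simp only [c, decide_eq_decide]
    constructor
    · rintro (h1 | h1)
      · right; rw [← h1, D.arc_arc]
      · left; rw [← D.arc_arc t, h1, D.arc_arc]
    · rintro (h1 | h1)
      · right; rw [h1]
      · left; rw [h1, D.arc_arc]

theorem mat_mul {m n p : ℕ} (D : Diagram m n) (E : Diagram n p) :
    D.mat * E.mat = 2 ^ D.compLoops E • (D.comp E).mat := by
  classical
  ext x z
  have key := (stack D E).card_colorings (Sum.elim x z)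
  have e : {y : Fin n → Bool // (∀ s, Sum.elim x y (D.arc s) = Sum.elim x y s) ∧
      ∀ s, Sum.elim y z (E.arc s) = Sum.elim y z s} ≃
      {φ : (Fin m ⊕ Fin n) ⊕ (Fin n ⊕ Fin p) → Bool // (∀ t, φ ((stack D E).arc t) = φ t) ∧
        (∀ t, φ ((stack D E).glue t) = φ t) ∧
        ∀ u, φ ((stack D E).outer u) = Sum.elim x z u} :=
    { toFun := fun y => ⟨Sum.elim (Sum.elim x y.1) (Sum.elim y.1 z), by
        refine ⟨?_, ?_, ?_⟩
        · rintro (t | t)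
          · exact y.2.1 t
          · exact y.2.2 t
        · rintro ((t | t) | (t | t)) <;> rfl
        · rintro (t | t) <;> rfl⟩
      invFun := fun φ => ⟨fun j => φ.1 (.inl (.inr j)), by
        obtain ⟨φ, h1, h2, h3⟩ := φ
        have e1 : Sum.elim x (fun j => φ (.inl (.inr j))) = fun s => φ (.inl s) := by
          ext (t | t)
          · exact (h3 (.inl t)).symm
          · rfl
        have e2 : Sum.elim (fun j => φ (.inl (.inr j))) z = fun s => φ (.inr s) := by
          ext (t | t)
          · exact (h2 (.inr (.inl t)))
          · exact (h3 (.inr t)).symm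
        simp only [e1, e2]
        exact ⟨fun s => h1 (.inl s), fun s => h1 (.inr s)⟩⟩
      left_inv := fun y => rfl
      right_inv := by
        rintro ⟨φ, h1, h2, h3⟩
        ext ((t | t) | (t | t))
        · exact (h3 (.inl t)).symm
        · rfl
        · exact (h2 (.inr (.inl t)))
        · exact (h3 (.inr t)).symm }
  rw [← Nat.card_congr e] at key
  simp only [Matrix.mul_apply, mat, Matrix.smul_apply, ← ite_and, mul_ite, mul_one, mul_zero,
    smul_eq_mul, compLoops]
  rw [Finset.sum_boole, Nat.cast_id, ← Fintype.card_subtype, ← Nat.card_eq_fintype_card]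
  convert key using 2
  · simp only [and_comm]
  · rfl

theorem trace_mat {n : ℕ} (D : Diagram n n) : D.mat.trace = 2 ^ D.closureLoops := by
  classical
  have key := D.closure.card_colorings Empty.elim
  rw [if_pos (fun u => u.elim)] at key
  have e : {x : Fin n → Bool // ∀ s, Sum.elim x x (D.arc s) = Sum.elim x x s} ≃
      {φ : Fin n ⊕ Fin n → Bool // (∀ t, φ (D.closure.arc t) = φ t) ∧
        (∀ t, φ (D.closure.glue t) = φ t) ∧
        ∀ u, φ (D.closure.outer u) = Empty.elim u} :=
    { toFun := fun x => ⟨Sum.elim x.1 x.1, x.2, by rintro (t | t) <;> rfl, fun u => u.elim⟩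
      invFun := fun φ => ⟨fun j => φ.1 (.inl j), by
        obtain ⟨φ, h1, h2, h3⟩ := φ
        have e1 : Sum.elim (fun j => φ (.inl j)) (fun j => φ (.inl j)) = φ := by
          ext (t | t)
          · rfl
          · exact (h2 (.inr t))
        simp only [e1]
        exact h1⟩
      left_inv := fun y => rfl
      right_inv := by
        rintro ⟨φ, h1, h2, h3⟩
        ext (t | t)
        · rfl
        · exact (h2 (.inr t)) }
  rw [← Nat.card_congr e] at key
  simp only [Matrix.trace, mat, Matrix.diag_apply]
  rw [Finset.sum_boole, Nat.cast_id, ← Fintype.card_subtype, ← Nat.card_eq_fintype_card]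
  exact key

theorem mat_id (n : ℕ) : (id n).mat = 1 := by
  ext x y
  simp only [mat, Matrix.one_apply]
  congr 1
  rw [eq_iff_iff]
  constructor
  · intro h; ext i; exact (h (.inl i)).symm
  · rintro rfl (s | s) <;> rfl

theorem mat_tensor {m n m' n' : ℕ} (D : Diagram m n) (E : Diagram m' n')
    (x : Fin m → Bool) (x' : Fin m' → Bool) (y : Fin n → Bool) (y' : Fin n' → Bool) :
    (D.tensor E).mat (Fin.append x x') (Fin.append y y') = D.mat x y * E.mat x' y' := by
  have h : ∀ s, Sum.elim (Fin.append x x') (Fin.append y y') (juxtapose m n m' n' s) =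
      Sum.elim (Sum.elim x y) (Sum.elim x' y') s := by
    rintro ((s | s) | (s | s)) <;> simp [juxtapose]
  simp only [mat, ← ite_and, mul_ite, mul_one, mul_zero]
  congr 1
  rw [eq_iff_iff, ← (juxtapose m n m' n').forall_congr_right]
  simp only [tensor, h, Equiv.symm_apply_apply, Sum.forall, Sum.map_inl, Sum.map_inr,
    Sum.elim_inl, Sum.elim_inr]
  tauto

theorem id_comp {m n : ℕ} (D : Diagram m n) : (id m).compLoops D = 0 ∧ (id m).comp D = D := by
  apply mat_inj
  rw [← mat_mul, mat_id, Matrix.one_mul, pow_zero, one_smul]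

theorem comp_id {m n : ℕ} (D : Diagram m n) : D.compLoops (id n) = 0 ∧ D.comp (id n) = D := by
  apply mat_inj
  rw [← mat_mul, mat_id, Matrix.mul_one, pow_zero, one_smul]

theorem comp_assoc {m n p r : ℕ} (D : Diagram m n) (E : Diagram n p) (F : Diagram p r) :
    D.compLoops E + (D.comp E).compLoops F = E.compLoops F + D.compLoops (E.comp F) ∧
      (D.comp E).comp F = D.comp (E.comp F) := by
  apply mat_inj
  rw [pow_add, pow_add, mul_smul, mul_smul, ← mat_mul, ← mat_mul, ← Matrix.smul_mul,
    ← mat_mul, ← Matrix.mul_smul, ← mat_mul, Matrix.mul_assoc]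

theorem trace_comp_comm {m n : ℕ} (D : Diagram m n) (E : Diagram n m) :
    D.compLoops E + (D.comp E).closureLoops = E.compLoops D + (E.comp D).closureLoops := by
  apply Nat.pow_right_injective le_rfl
  simp only [pow_add, ← trace_mat, ← smul_eq_mul, ← Matrix.trace_smul, ← mat_mul]
  exact Matrix.trace_mul_comm _ _

theorem id_tensor_id (m n : ℕ) : (id m).tensor (id n) = id (m + n) := by
  ext1
  funext x
  obtain ⟨x, rfl⟩ := (juxtapose m m n n).surjective x
  simp only [tensor, Equiv.symm_apply_apply]
  rcases x with (x | x) | (x | x) <;> simp [juxtapose, id]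

theorem exists_append {m n : ℕ} (f : Fin (m + n) → Bool) :
    ∃ x y, f = Fin.append (m := m) (n := n) x y :=
  ⟨_, _, ((Fin.appendEquiv m n).apply_symm_apply f).symm⟩

theorem sum_append {m n : ℕ} (g : (Fin (m + n) → Bool) → ℕ) :
    ∑ z, g z = ∑ x : Fin m → Bool, ∑ y : Fin n → Bool, g (Fin.append x y) := by
  rw [← (Fin.appendEquiv m n).sum_comp, Fintype.sum_prod_type]
  rfl

theorem tensor_comp {m n p m' n' p' : ℕ} (D : Diagram m n) (E : Diagram n p)
    (D' : Diagram m' n') (E' : Diagram n' p') :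
    (D.tensor D').compLoops (E.tensor E') = D.compLoops E + D'.compLoops E' ∧
      (D.tensor D').comp (E.tensor E') = (D.comp E).tensor (D'.comp E') := by
  apply mat_inj
  rw [← mat_mul]
  ext x y
  obtain ⟨x, x', rfl⟩ := exists_append x
  obtain ⟨y, y', rfl⟩ := exists_append y
  have h1 := congrFun (congrFun (mat_mul D E) x) y
  have h2 := congrFun (congrFun (mat_mul D' E') x') y'
  rw [Matrix.smul_apply, smul_eq_mul] at h1 h2 ⊢
  rw [mat_tensor, pow_add, mul_mul_mul_comm, ← h1, ← h2, Matrix.mul_apply, Matrix.mul_apply,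
    Matrix.mul_apply, sum_append, Finset.sum_mul_sum]
  simp only [mat_tensor, mul_mul_mul_comm]

/-- Joining the last `c` upper points to the last `c` lower points, around the right side. -/
def closeRight {a b c : ℕ} (D : Diagram (a + c) (b + c)) :
    Gluing (Fin a ⊕ Fin b) ((Fin a ⊕ Fin b) ⊕ (Fin c ⊕ Fin c)) where
  arc x := (juxtapose a b c c).symm (D.arc (juxtapose a b c c x))
  arc_arc x := by simp [D.arc_arc]
  arc_ne x := by rw [ne_eq, Equiv.symm_apply_eq]; exact D.arc_ne _
  glue := Sum.map (fun x => x) Sum.swap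
  glue_glue := by rintro (x | x) <;> simp
  outer := Sum.inl
  outer_injective := Sum.inl_injective
  glue_eq_iff := by rintro (x | (x | x)) <;> simp

/-- Joining the first `c` upper points to the first `c` lower points, around the left side. -/
def closeLeft {a b c : ℕ} (D : Diagram (c + a) (c + b)) :
    Gluing (Fin a ⊕ Fin b) ((Fin c ⊕ Fin c) ⊕ (Fin a ⊕ Fin b)) where
  arc x := (juxtapose c c a b).symm (D.arc (juxtapose c c a b x))
  arc_arc x := by simp [D.arc_arc]
  arc_ne x := by rw [ne_eq, Equiv.symm_apply_eq]; exact D.arc_ne _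
  glue := Sum.map Sum.swap (fun x => x)
  glue_glue := by rintro (x | x) <;> simp
  outer := Sum.inr
  outer_injective := Sum.inr_injective
  glue_eq_iff := by rintro ((x | x) | x) <;> simp

/-- The diagram resulting from `closeRight` after removing the loops. -/
noncomputable def traceRight {a b c : ℕ} (D : Diagram (a + c) (b + c)) : Diagram a b where
  arc := (closeRight D).partner
  arc_arc := (closeRight D).partner_partner
  arc_ne := (closeRight D).partner_ne
  noncrossing := by
    let pos : (Fin a ⊕ Fin b) ⊕ (Fin c ⊕ Fin c) → ℕ :=
      fun x => boundaryPos (a + c) (b + c) (juxtapose a b c c x)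
    obtain ⟨p1, p2, p3, p4⟩ := boundaryPos_juxtapose a b c c
    have key := (closeRight D).partner_noncrossing pos
      ((boundaryPos_injective _ _).comp (juxtapose a b c c).injective)
      (by
        intro s t
        simp only [pos, closeRight, Equiv.apply_symm_apply]
        exact D.noncrossing _ _)
      (by
        rintro ((x | x) | (x | x)) ((y | y) | (y | y)) <;>
          simp [pos, closeRight, juxtapose, boundaryPos, Fin.val_rev] <;> omega)
      (by
        rintro (x | x) (y | y) ((s | s) | (s | s)) hs <;>
          first
          | exact absurd rfl hs
          | (clear hs
             simp only [pos, closeRight, Sum.map_inr, Sum.swap_inl, Sum.swap_inr,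
               p1, p2, p3, p4]
             omega))
    have hmono : ∀ x y, boundaryPos a b x < boundaryPos a b y →
        pos ((closeRight D).outer x) < pos ((closeRight D).outer y) := by
      rintro (x | x) (y | y) <;>
        simp [pos, closeRight, juxtapose, boundaryPos, Fin.val_rev] <;> omega
    rintro x y ⟨h1, h2, h3⟩
    exact key x y ⟨hmono _ _ h1, hmono _ _ h2, hmono _ _ h3⟩

/-- The diagram resulting from `closeLeft` after removing the loops. -/
noncomputable def traceLeft {a b c : ℕ} (D : Diagram (c + a) (c + b)) : Diagram a b where
  arc := (closeLeft D).partner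
  arc_arc := (closeLeft D).partner_partner
  arc_ne := (closeLeft D).partner_ne
  noncrossing := by
    let pos : (Fin c ⊕ Fin c) ⊕ (Fin a ⊕ Fin b) → ℕ :=
      fun x => boundaryPos (c + a) (c + b) (juxtapose c c a b x)
    obtain ⟨p1, p2, p3, p4⟩ := boundaryPos_juxtapose c c a b
    have key := (closeLeft D).partner_noncrossing pos
      ((boundaryPos_injective _ _).comp (juxtapose c c a b).injective)
      (by
        intro s t
        simp only [pos, closeLeft, Equiv.apply_symm_apply]
        exact D.noncrossing _ _)
      (by
        rintro ((x | x) | (x | x)) ((y | y) | (y | y)) <;>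
          simp [pos, closeLeft, juxtapose, boundaryPos, Fin.val_rev] <;> omega)
      (by
        rintro (x | x) (y | y) ((s | s) | (s | s)) hs <;>
          first
          | exact absurd rfl hs
          | (clear hs
             simp only [pos, closeLeft, Sum.map_inl, Sum.swap_inl, Sum.swap_inr,
               p1, p2, p3, p4]
             omega))
    have hmono : ∀ x y, boundaryPos a b x < boundaryPos a b y →
        pos ((closeLeft D).outer x) < pos ((closeLeft D).outer y) := by
      rintro (x | x) (y | y) <;>
        simp [pos, closeLeft, juxtapose, boundaryPos, Fin.val_rev] <;> omega
    rintro x y ⟨h1, h2, h3⟩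
    exact key x y ⟨hmono _ _ h1, hmono _ _ h2, hmono _ _ h3⟩

theorem elim_append_juxtapose {a b c e : ℕ} (x : Fin a → Bool) (y : Fin b → Bool)
    (z : Fin c → Bool) (w : Fin e → Bool) (s : (Fin a ⊕ Fin b) ⊕ (Fin c ⊕ Fin e)) :
    Sum.elim (Fin.append x z) (Fin.append y w) (juxtapose a b c e s) =
      Sum.elim (Sum.elim x y) (Sum.elim z w) s := by
  rcases s with (s | s) | (s | s) <;> simp [juxtapose]

theorem mat_traceRight {a b c : ℕ} (D : Diagram (a + c) (b + c)) (x : Fin a → Bool)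
    (y : Fin b → Bool) :
    ∑ z, D.mat (Fin.append x z) (Fin.append y z) =
      2 ^ (closeRight D).loops * D.traceRight.mat x y := by
  classical
  have key := (closeRight D).card_colorings (Sum.elim x y)
  have h0 : ∀ z : Fin c → Bool, (∀ s, Sum.elim (Fin.append x z) (Fin.append y z) (D.arc s) =
      Sum.elim (Fin.append x z) (Fin.append y z) s) ↔
      ∀ t, Sum.elim (Sum.elim x y) (Sum.elim z z) ((closeRight D).arc t) =
        Sum.elim (Sum.elim x y) (Sum.elim z z) t := by
    intro z
    rw [← (juxtapose a b c c).forall_congr_right]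
    simp only [closeRight, ← elim_append_juxtapose, Equiv.apply_symm_apply]
  have e : {z : Fin c → Bool // ∀ t,
      Sum.elim (Sum.elim x y) (Sum.elim z z) ((closeRight D).arc t) =
        Sum.elim (Sum.elim x y) (Sum.elim z z) t} ≃
      {φ : (Fin a ⊕ Fin b) ⊕ (Fin c ⊕ Fin c) → Bool //
        (∀ t, φ ((closeRight D).arc t) = φ t) ∧
        (∀ t, φ ((closeRight D).glue t) = φ t) ∧
        ∀ u, φ ((closeRight D).outer u) = Sum.elim x y u} :=
    { toFun := fun z => ⟨Sum.elim (Sum.elim x y) (Sum.elim z.1 z.1), z.2,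
        by rintro ((t | t) | (t | t)) <;> rfl, fun u => rfl⟩
      invFun := fun φ => ⟨fun j => φ.1 (.inr (.inl j)), by
        obtain ⟨φ, h1, h2, h3⟩ := φ
        have e1 : Sum.elim (Sum.elim x y)
            (Sum.elim (fun j => φ (.inr (.inl j))) (fun j => φ (.inr (.inl j)))) = φ := by
          ext ((t | t) | (t | t))
          · exact (h3 (.inl t)).symm
          · exact (h3 (.inr t)).symm
          · rfl
          · exact (h2 (.inr (.inr t)))
        simp only [e1]
        exact h1⟩
      left_inv := fun y => rfl
      right_inv := by
        rintro ⟨φ, h1, h2, h3⟩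
        ext ((t | t) | (t | t))
        · exact (h3 (.inl t)).symm
        · exact (h3 (.inr t)).symm
        · rfl
        · exact (h2 (.inr (.inr t))) }
  rw [← Nat.card_congr e] at key
  simp only [mat, h0, mul_ite, mul_one, mul_zero]
  rw [Finset.sum_boole, Nat.cast_id, ← Fintype.card_subtype, ← Nat.card_eq_fintype_card]
  exact key

theorem mat_traceLeft {a b c : ℕ} (D : Diagram (c + a) (c + b)) (x : Fin a → Bool)
    (y : Fin b → Bool) :
    ∑ z, D.mat (Fin.append z x) (Fin.append z y) =
      2 ^ (closeLeft D).loops * D.traceLeft.mat x y := by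
  classical
  have key := (closeLeft D).card_colorings (Sum.elim x y)
  have h0 : ∀ z : Fin c → Bool, (∀ s, Sum.elim (Fin.append z x) (Fin.append z y) (D.arc s) =
      Sum.elim (Fin.append z x) (Fin.append z y) s) ↔
      ∀ t, Sum.elim (Sum.elim z z) (Sum.elim x y) ((closeLeft D).arc t) =
        Sum.elim (Sum.elim z z) (Sum.elim x y) t := by
    intro z
    rw [← (juxtapose c c a b).forall_congr_right]
    simp only [closeLeft, ← elim_append_juxtapose, Equiv.apply_symm_apply]
  have e : {z : Fin c → Bool // ∀ t,
      Sum.elim (Sum.elim z z) (Sum.elim x y) ((closeLeft D).arc t) =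
        Sum.elim (Sum.elim z z) (Sum.elim x y) t} ≃
      {φ : (Fin c ⊕ Fin c) ⊕ (Fin a ⊕ Fin b) → Bool //
        (∀ t, φ ((closeLeft D).arc t) = φ t) ∧
        (∀ t, φ ((closeLeft D).glue t) = φ t) ∧
        ∀ u, φ ((closeLeft D).outer u) = Sum.elim x y u} :=
    { toFun := fun z => ⟨Sum.elim (Sum.elim z.1 z.1) (Sum.elim x y), z.2,
        by rintro ((t | t) | (t | t)) <;> rfl, fun u => rfl⟩
      invFun := fun φ => ⟨fun j => φ.1 (.inl (.inl j)), by
        obtain ⟨φ, h1, h2, h3⟩ := φ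
        have e1 : Sum.elim (Sum.elim (fun j => φ (.inl (.inl j))) (fun j => φ (.inl (.inl j))))
            (Sum.elim x y) = φ := by
          ext ((t | t) | (t | t))
          · rfl
          · exact (h2 (.inl (.inr t)))
          · exact (h3 (.inl t)).symm
          · exact (h3 (.inr t)).symm
        simp only [e1]
        exact h1⟩
      left_inv := fun y => rfl
      right_inv := by
        rintro ⟨φ, h1, h2, h3⟩
        ext ((t | t) | (t | t))
        · rfl
        · exact (h2 (.inl (.inr t)))
        · exact (h3 (.inl t)).symm
        · exact (h3 (.inr t)).symm }
  rw [← Nat.card_congr e] at key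
  simp only [mat, h0, mul_ite, mul_one, mul_zero]
  rw [Finset.sum_boole, Nat.cast_id, ← Fintype.card_subtype, ← Nat.card_eq_fintype_card]
  exact key

theorem trace_tensor_id {a b c : ℕ} (D : Diagram a b) (H : Diagram (b + c) (a + c)) :
    (D.tensor (id c)).compLoops H + ((D.tensor (id c)).comp H).closureLoops =
      (closeRight H).loops + (D.compLoops H.traceRight +
        (D.comp H.traceRight).closureLoops) := by
  apply Nat.pow_right_injective le_rfl
  simp only [pow_add, ← trace_mat, ← smul_eq_mul (2 ^ compLoops _ _), ← Matrix.trace_smul,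
    ← mat_mul]
  simp only [Matrix.trace, Matrix.diag_apply, Matrix.mul_apply, sum_append, mat_tensor, mat_id,
    Matrix.one_apply, mul_ite, mul_one, mul_zero, ite_mul, zero_mul, Finset.sum_ite_eq,
    Finset.mem_univ, if_true, Finset.mul_sum]
  refine Finset.sum_congr rfl fun x _ => ?_
  rw [Finset.sum_comm]
  refine Finset.sum_congr rfl fun y _ => ?_
  rw [← Finset.mul_sum, mat_traceRight]
  ring

theorem trace_id_tensor {a b c : ℕ} (D : Diagram a b) (H : Diagram (c + b) (c + a)) :
    ((id c).tensor D).compLoops H + (((id c).tensor D).comp H).closureLoops =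
      (closeLeft H).loops + (D.compLoops H.traceLeft +
        (D.comp H.traceLeft).closureLoops) := by
  apply Nat.pow_right_injective le_rfl
  simp only [pow_add, ← trace_mat, ← smul_eq_mul (2 ^ compLoops _ _), ← Matrix.trace_smul,
    ← mat_mul]
  simp only [Matrix.trace, Matrix.diag_apply, Matrix.mul_apply, sum_append, mat_tensor, mat_id,
    Matrix.one_apply, ite_mul, one_mul, zero_mul, Finset.mul_sum]
  rw [Finset.sum_comm]
  refine Finset.sum_congr rfl fun x _ => ?_
  have h : ∀ z : Fin c → Bool, (∑ w, ∑ y, if z = w then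
      D.mat x y * H.mat (Fin.append w y) (Fin.append z x) else 0) =
      ∑ y, D.mat x y * H.mat (Fin.append z y) (Fin.append z x) := by
    intro z
    rw [Finset.sum_comm]
    simp
  simp only [h]
  rw [Finset.sum_comm]
  refine Finset.sum_congr rfl fun y _ => ?_
  rw [← Finset.mul_sum, mat_traceLeft]
  ring

end Diagram
open CategoryTheory

/-- The objects `X^{⊗ n}` of the Temperley–Lieb category with loop parameter `d`. -/
structure TL (d : ℂ) where
  strands : ℕ

/-- The object `X^{⊗ n}`. -/
abbrev X (d : ℂ) (n : ℕ) : TL d := ⟨n⟩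

/-- Bilinear extension of the composition of diagrams; a removed loop contributes `d`. -/
noncomputable def compL (d : ℂ) (m n p : ℕ) :
    (Diagram n m →₀ ℂ) →ₗ[ℂ] (Diagram p n →₀ ℂ) →ₗ[ℂ] (Diagram p m →₀ ℂ) :=
  Finsupp.linearCombination ℂ fun D => Finsupp.linearCombination ℂ fun E =>
    Finsupp.single (E.comp D) (d ^ E.compLoops D)

theorem compL_single (d : ℂ) {m n p : ℕ} (D : Diagram n m) (E : Diagram p n) (a b : ℂ) :
    compL d m n p (Finsupp.single D a) (Finsupp.single E b) =
      Finsupp.single (E.comp D) (a * b * d ^ E.compLoops D) := by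
  simp only [compL, Finsupp.linearCombination_single, LinearMap.smul_apply, Finsupp.smul_single,
    smul_eq_mul, mul_assoc]

/-- Bilinear extension of the juxtaposition of diagrams. -/
noncomputable def tensorL (m n m' n' : ℕ) :
    (Diagram n m →₀ ℂ) →ₗ[ℂ] (Diagram n' m' →₀ ℂ) →ₗ[ℂ] (Diagram (n + n') (m + m') →₀ ℂ) :=
  Finsupp.linearCombination ℂ fun D => Finsupp.linearCombination ℂ fun E =>
    Finsupp.single (D.tensor E) 1

theorem tensorL_single {m n m' n' : ℕ} (D : Diagram n m) (E : Diagram n' m') (a b : ℂ) :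
    tensorL m n m' n' (Finsupp.single D a) (Finsupp.single E b) =
      Finsupp.single (D.tensor E) (a * b) := by
  simp only [tensorL, Finsupp.linearCombination_single, LinearMap.smul_apply,
    Finsupp.smul_single, smul_eq_mul, mul_one]

/-- The Temperley–Lieb category: morphisms `X^{⊗ m} ⟶ X^{⊗ n}` are the formal linear
combinations of diagrams with `m` lower and `n` upper points. -/
noncomputable instance (d : ℂ) : Category (TL d) where
  Hom Y Z := Diagram Z.strands Y.strands →₀ ℂ
  id Y := Finsupp.single (Diagram.id Y.strands) 1
  comp f g := compL d _ _ _ f g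
  id_comp {Y Z} f := by
    induction f using Finsupp.induction_linear with
    | zero => exact map_zero _
    | add f g hf hg => rw [map_add, hf, hg]
    | single D a => rw [compL_single, (D.comp_id).1, (D.comp_id).2]; simp
  comp_id {Y Z} f := by
    induction f using Finsupp.induction_linear with
    | zero => rw [map_zero]; rfl
    | add f g hf hg => rw [map_add, LinearMap.add_apply, hf, hg]
    | single D a => rw [compL_single, (D.id_comp).1, (D.id_comp).2]; simp
  assoc {W Y Z V} f g h := by
    induction f using Finsupp.induction_linear with
    | zero => simp only [map_zero, LinearMap.zero_apply]
    | add f f' hf hf' => simp only [map_add, LinearMap.add_apply, hf, hf']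
    | single D a =>
      induction g using Finsupp.induction_linear with
      | zero => simp only [map_zero, LinearMap.zero_apply]
      | add f f' hf hf' => simp only [map_add, LinearMap.add_apply, hf, hf']
      | single E b =>
        induction h using Finsupp.induction_linear with
        | zero => simp only [map_zero]
        | add f f' hf hf' => simp only [map_add, hf, hf']
        | single F c =>
          have h := Diagram.comp_assoc F E D
          rw [compL_single, compL_single, compL_single, compL_single, h.2]
          congr 1
          have h1 := congrArg (fun k => d ^ k) h.1
          simp only [pow_add] at h1
          linear_combination (-(a * b * c)) * h1

noncomputable instance (d : ℂ) : Preadditive (TL d) where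
  homGroup Y Z := inferInstanceAs (AddCommGroup (Diagram Z.strands Y.strands →₀ ℂ))
  add_comp Y Z W f f' g := LinearMap.map_add₂ (compL d Y.strands Z.strands W.strands) f f' g
  comp_add Y Z W f g g' := (compL d Y.strands Z.strands W.strands f).map_add g g'

noncomputable instance (d : ℂ) : Linear ℂ (TL d) where
  homModule Y Z := inferInstanceAs (Module ℂ (Diagram Z.strands Y.strands →₀ ℂ))
  smul_comp Y Z W r f g := LinearMap.map_smul₂ (compL d Y.strands Z.strands W.strands) r f g
  comp_smul Y Z W f r g := (compL d Y.strands Z.strands W.strands f).map_smul r g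

namespace TL

/-- A diagram, as a morphism. -/
noncomputable def ofDiagram (d : ℂ) {m n : ℕ} (D : Diagram n m) : X d m ⟶ X d n :=
  Finsupp.single D (1 : ℂ)

/-- The tensor product of objects, `X^{⊗ m} ⊗ X^{⊗ n} = X^{⊗ (m + n)}`. -/
abbrev tensorObj {d : ℂ} (Y Z : TL d) : TL d := ⟨Y.strands + Z.strands⟩

/-- The tensor product of morphisms. -/
noncomputable def tensorHom {d : ℂ} {Y Z Y' Z' : TL d} (f : Y ⟶ Z) (g : Y' ⟶ Z') :
    tensorObj Y Y' ⟶ tensorObj Z Z' :=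
  tensorL _ _ _ _ f g

theorem diagram_induction {d : ℂ} {Y Z : TL d} (p : (Y ⟶ Z) → Prop) (h0 : p 0)
    (hadd : ∀ f g, p f → p g → p (f + g))
    (hD : ∀ (a : ℂ) (D : Diagram Z.strands Y.strands), p (a • ofDiagram d D)) (f : Y ⟶ Z) :
    p f :=
  Finsupp.induction_linear (motive := p) f h0 hadd fun D a => by
    have : a • ofDiagram d D = Finsupp.single D a := by
      change a • Finsupp.single D (1 : ℂ) = _
      simp
    rw [← this]; exact hD a D

theorem ofDiagram_comp (d : ℂ) {m n p : ℕ} (D : Diagram n m) (E : Diagram p n) :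
    ofDiagram d D ≫ ofDiagram d E = d ^ E.compLoops D • ofDiagram d (E.comp D) := by
  change compL d m n p (Finsupp.single D 1) (Finsupp.single E 1) =
    d ^ E.compLoops D • Finsupp.single (E.comp D) (1 : ℂ)
  rw [compL_single]; simp

theorem ofDiagram_tensor (d : ℂ) {m n m' n' : ℕ} (D : Diagram n m) (E : Diagram n' m') :
    tensorHom (ofDiagram d D) (ofDiagram d E) = ofDiagram d (D.tensor E) := by
  change tensorL m n m' n' (Finsupp.single D 1) (Finsupp.single E 1) = _
  rw [tensorL_single, one_mul]; rfl

theorem id_eq {d : ℂ} (Y : TL d) : 𝟙 Y = ofDiagram d (Diagram.id Y.strands) := rfl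

section
variable {d : ℂ} {Y Z Y' Z' : TL d}

theorem add_tensorHom (f f' : Y ⟶ Z) (g : Y' ⟶ Z') :
    tensorHom (f + f') g = tensorHom f g + tensorHom f' g :=
  LinearMap.map_add₂ (tensorL Y.strands Z.strands Y'.strands Z'.strands) f f' g

theorem tensorHom_add (f : Y ⟶ Z) (g g' : Y' ⟶ Z') :
    tensorHom f (g + g') = tensorHom f g + tensorHom f g' :=
  map_add (tensorL Y.strands Z.strands Y'.strands Z'.strands f) g g'

theorem smul_tensorHom (a : ℂ) (f : Y ⟶ Z) (g : Y' ⟶ Z') :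
    tensorHom (a • f) g = a • tensorHom f g :=
  LinearMap.map_smul₂ (tensorL Y.strands Z.strands Y'.strands Z'.strands) a f g

theorem tensorHom_smul (a : ℂ) (f : Y ⟶ Z) (g : Y' ⟶ Z') :
    tensorHom f (a • g) = a • tensorHom f g :=
  map_smul (tensorL Y.strands Z.strands Y'.strands Z'.strands f) a g

theorem zero_tensorHom (g : Y' ⟶ Z') : tensorHom (0 : Y ⟶ Z) g = 0 :=
  LinearMap.map_zero₂ (tensorL Y.strands Z.strands Y'.strands Z'.strands) g

theorem tensorHom_zero (f : Y ⟶ Z) : tensorHom f (0 : Y' ⟶ Z') = 0 :=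
  map_zero (tensorL Y.strands Z.strands Y'.strands Z'.strands f)

end

theorem id_tensorHom_id {d : ℂ} (Y Z : TL d) : tensorHom (𝟙 Y) (𝟙 Z) = 𝟙 (tensorObj Y Z) := by
  rw [id_eq, id_eq, ofDiagram_tensor, Diagram.id_tensor_id]; rfl

theorem tensorHom_comp {d : ℂ} {Y Z W Y' Z' W' : TL d} (f : Y ⟶ Z) (g : Z ⟶ W)
    (f' : Y' ⟶ Z') (g' : Z' ⟶ W') :
    tensorHom f f' ≫ tensorHom g g' = tensorHom (f ≫ g) (f' ≫ g') := by
  induction f using diagram_induction with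
  | h0 => simp only [zero_tensorHom, Limits.zero_comp]
  | hadd f₁ f₂ h₁ h₂ => simp only [add_tensorHom, Preadditive.add_comp, h₁, h₂]
  | hD a D =>
  induction g using diagram_induction with
  | h0 => simp only [zero_tensorHom, Limits.comp_zero]
  | hadd f₁ f₂ h₁ h₂ => simp only [add_tensorHom, Preadditive.comp_add, h₁, h₂]
  | hD b E =>
  induction f' using diagram_induction with
  | h0 => simp only [tensorHom_zero, Limits.zero_comp]
  | hadd f₁ f₂ h₁ h₂ => simp only [tensorHom_add, Preadditive.add_comp, h₁, h₂]
  | hD a' D' =>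
  induction g' using diagram_induction with
  | h0 => simp only [tensorHom_zero, Limits.comp_zero]
  | hadd f₁ f₂ h₁ h₂ => simp only [tensorHom_add, Preadditive.comp_add, h₁, h₂]
  | hD b' E' =>
  have h := Diagram.tensor_comp E D E' D'
  simp only [smul_tensorHom, tensorHom_smul, Linear.smul_comp, Linear.comp_smul,
    ofDiagram_tensor, ofDiagram_comp, h.1, h.2, smul_smul]
  congr 1
  ring

/-- The Markov trace on `End (X^{⊗ n})`. -/
noncomputable def tr {d : ℂ} {Y : TL d} : (Y ⟶ Y) →ₗ[ℂ] ℂ :=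
  Finsupp.linearCombination ℂ fun D : Diagram Y.strands Y.strands => d ^ D.closureLoops

theorem tr_ofDiagram (d : ℂ) {n : ℕ} (D : Diagram n n) :
    tr (ofDiagram d D) = d ^ D.closureLoops := by
  change Finsupp.linearCombination ℂ _ (Finsupp.single D 1) = _
  simp

theorem tr_comp_comm {d : ℂ} {Y Z : TL d} (f : Y ⟶ Z) (g : Z ⟶ Y) :
    tr (f ≫ g) = tr (g ≫ f) := by
  obtain ⟨m⟩ := Y
  obtain ⟨n⟩ := Z
  induction f using diagram_induction with
  | h0 => simp
  | hadd f₁ f₂ h₁ h₂ => simp [h₁, h₂]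
  | hD a D =>
  induction g using diagram_induction with
  | h0 => simp
  | hadd f₁ f₂ h₁ h₂ => simp only [Preadditive.comp_add, Preadditive.add_comp, map_add, h₁, h₂]
  | hD b E =>
  have h := Diagram.trace_comp_comm D E
  have h1 := congrArg (fun k => d ^ k) h
  simp only [pow_add] at h1
  simp only [Linear.smul_comp, Linear.comp_smul, map_smul, ofDiagram_comp, tr_ofDiagram,
    smul_eq_mul]
  linear_combination (-(a * b)) * h1

/-- The trace kernel. -/
noncomputable def ker {d : ℂ} (Y Z : TL d) : Submodule ℂ (Y ⟶ Z) where
  carrier := {f | ∀ g : Z ⟶ Y, tr (f ≫ g) = 0}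
  zero_mem' := fun g => by simp
  add_mem' := fun hf hf' g => by simp [hf g, hf' g]
  smul_mem' := fun a f hf g => by simp [hf g]

theorem mem_ker {d : ℂ} {Y Z : TL d} {f : Y ⟶ Z} :
    f ∈ ker Y Z ↔ ∀ g : Z ⟶ Y, tr (f ≫ g) = 0 := Iff.rfl

theorem ker_comp {d : ℂ} {Y Z W : TL d} {f : Y ⟶ Z} (hf : f ∈ ker Y Z) (g : Z ⟶ W) :
    f ≫ g ∈ ker Y W := fun h => by rw [Category.assoc]; exact hf _

theorem comp_ker {d : ℂ} {Y Z W : TL d} (f : Y ⟶ Z) {g : Z ⟶ W} (hg : g ∈ ker Z W) :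
    f ≫ g ∈ ker Y W := fun h => by
  rw [tr_comp_comm, ← Category.assoc, tr_comp_comm]; exact hg _

theorem exists_tr_tensor_id {d : ℂ} {Y Z : TL d} (W : TL d)
    (h : tensorObj Z W ⟶ tensorObj Y W) :
    ∃ k : Z ⟶ Y, ∀ f : Y ⟶ Z, tr (tensorHom f (𝟙 W) ≫ h) = tr (f ≫ k) := by
  induction h using diagram_induction with
  | h0 => exact ⟨0, by simp⟩
  | hadd h₁ h₂ i₁ i₂ =>
    obtain ⟨k₁, i₁⟩ := i₁
    obtain ⟨k₂, i₂⟩ := i₂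
    exact ⟨k₁ + k₂, fun f => by simp only [Preadditive.comp_add, map_add, i₁, i₂]⟩
  | hD a H =>
    refine ⟨(a * d ^ (Diagram.closeRight H).loops) • ofDiagram d H.traceRight, fun f => ?_⟩
    induction f using diagram_induction with
    | h0 => simp [zero_tensorHom]
    | hadd f₁ f₂ h₁ h₂ => simp only [add_tensorHom, Preadditive.add_comp, map_add, h₁, h₂]
    | hD b D =>
      have e := congrArg (fun k => d ^ k) (Diagram.trace_tensor_id D H)
      simp only [pow_add] at e
      rw [tr_comp_comm, tr_comp_comm (b • ofDiagram d D)]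
      simp only [id_eq, smul_tensorHom, ofDiagram_tensor, Linear.smul_comp, Linear.comp_smul,
        map_smul, ofDiagram_comp, tr_ofDiagram, smul_eq_mul]
      linear_combination (a * b) * e

theorem exists_tr_id_tensor {d : ℂ} {Y Z : TL d} (W : TL d)
    (h : tensorObj W Z ⟶ tensorObj W Y) :
    ∃ k : Z ⟶ Y, ∀ f : Y ⟶ Z, tr (tensorHom (𝟙 W) f ≫ h) = tr (f ≫ k) := by
  induction h using diagram_induction with
  | h0 => exact ⟨0, by simp⟩
  | hadd h₁ h₂ i₁ i₂ =>
    obtain ⟨k₁, i₁⟩ := i₁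
    obtain ⟨k₂, i₂⟩ := i₂
    exact ⟨k₁ + k₂, fun f => by simp only [Preadditive.comp_add, map_add, i₁, i₂]⟩
  | hD a H =>
    refine ⟨(a * d ^ (Diagram.closeLeft H).loops) • ofDiagram d H.traceLeft, fun f => ?_⟩
    induction f using diagram_induction with
    | h0 => simp [tensorHom_zero]
    | hadd f₁ f₂ h₁ h₂ => simp only [tensorHom_add, Preadditive.add_comp, map_add, h₁, h₂]
    | hD b D =>
      have e := congrArg (fun k => d ^ k) (Diagram.trace_id_tensor D H)
      simp only [pow_add] at e
      rw [tr_comp_comm, tr_comp_comm (b • ofDiagram d D)]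
      simp only [id_eq, tensorHom_smul, ofDiagram_tensor, Linear.smul_comp, Linear.comp_smul,
        map_smul, ofDiagram_comp, tr_ofDiagram, smul_eq_mul]
      linear_combination (a * b) * e

theorem ker_tensor {d : ℂ} {Y Z Y' Z' : TL d} {f : Y ⟶ Z} (hf : f ∈ ker Y Z) (g : Y' ⟶ Z') :
    tensorHom f g ∈ ker (tensorObj Y Y') (tensorObj Z Z') := by
  have h1 : tensorHom f g = tensorHom f (𝟙 Y') ≫ tensorHom (𝟙 Z) g := by
    rw [tensorHom_comp, Category.comp_id, Category.id_comp]
  rw [h1]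
  refine ker_comp (fun h => ?_) _
  obtain ⟨k, hk⟩ := exists_tr_tensor_id Y' h
  rw [hk]; exact hf k

theorem tensor_ker {d : ℂ} {Y Z Y' Z' : TL d} (f : Y ⟶ Z) {g : Y' ⟶ Z'} (hg : g ∈ ker Y' Z') :
    tensorHom f g ∈ ker (tensorObj Y Y') (tensorObj Z Z') := by
  have h1 : tensorHom f g = tensorHom (𝟙 Y) g ≫ tensorHom f (𝟙 Z') := by
    rw [tensorHom_comp, Category.comp_id, Category.id_comp]
  rw [h1]
  refine ker_comp (fun h => ?_) _
  obtain ⟨k, hk⟩ := exists_tr_id_tensor Y h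
  rw [hk]; exact hg k

/-- A family of subspaces of the hom-spaces is a (two-sided) monoidal ideal if it is stable under
composition and tensor products with arbitrary morphisms. -/
structure IsMonoidalIdeal {d : ℂ} (J : ∀ Y Z : TL d, Submodule ℂ (Y ⟶ Z)) : Prop where
  comp_mem : ∀ {Y Y' Z' Z : TL d} (g : Y ⟶ Y') (f : Y' ⟶ Z') (h : Z' ⟶ Z),
    f ∈ J Y' Z' → g ≫ f ≫ h ∈ J Y Z
  tensor_mem : ∀ {Y Z Y₁ Z₁ Y₂ Z₂ : TL d} (g : Y₁ ⟶ Z₁) (f : Y ⟶ Z) (h : Y₂ ⟶ Z₂), f ∈ J Y Z →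
    tensorHom (tensorHom g f) h ∈
      J (tensorObj (tensorObj Y₁ Y) Y₂) (tensorObj (tensorObj Z₁ Z) Z₂)

/-- The monoidal ideal generated by a morphism: the intersection of all monoidal ideals
containing it. -/
noncomputable def generatedIdeal {d : ℂ} {A B : TL d} (f : A ⟶ B) (Y Z : TL d) : Submodule ℂ (Y ⟶ Z) :=
  sInf {S | ∃ J : ∀ Y Z : TL d, Submodule ℂ (Y ⟶ Z), IsMonoidalIdeal J ∧ f ∈ J A B ∧ S = J Y Z}

/-- The elementary diagram `h_{k+1} = 1_{X^{⊗ k}} ⊗ (cup ∘ cap)` in `End (X^{⊗ (k+2)})`. -/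
noncomputable def hLast (d : ℂ) (k : ℕ) : X d (k + 2) ⟶ X d (k + 2) :=
  tensorHom (Z := X d k) (Z' := X d 2) (𝟙 (X d k)) (ofDiagram d Diagram.cap ≫ ofDiagram d Diagram.cup)

end TL

/-- The `q`-integer `[k]_q`. -/
noncomputable def qInt (q : ℂ) (k : ℕ) : ℂ := (q ^ k - q⁻¹ ^ k) / (q - q⁻¹)

/-- The Jones–Wenzl elements `f_k` of `End (X^{⊗ k})`, defined by Wenzl's recursion. -/
noncomputable def jonesWenzl (d q : ℂ) : (k : ℕ) → (X d k ⟶ X d k)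
  | 0 => 𝟙 _
  | 1 => 𝟙 _
  | k + 2 =>
    let g : X d (k + 2) ⟶ X d (k + 2) :=
      TL.tensorHom (Y := X d (k + 1)) (Z := X d (k + 1)) (jonesWenzl d q (k + 1)) (𝟙 (X d 1))
    g - (qInt q (k + 1) / qInt q (k + 2)) • (g ≫ TL.hLast d k ≫ g)

/-- The objects of the reduced Temperley–Lieb category, which are those of `TL d`. -/
structure ReducedTL (d : ℂ) where
  obj : TL d

/-- The reduced Temperley–Lieb category, the quotient of `TL d` by the trace kernel. -/
noncomputable instance (d : ℂ) : Category (ReducedTL d) where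
  Hom Y Z := (Y.obj ⟶ Z.obj) ⧸ TL.ker Y.obj Z.obj
  id Y := Submodule.Quotient.mk (𝟙 Y.obj)
  comp {Y Z W} f g := Quotient.map₂ (· ≫ ·) (by
    intro f f' hf g g' hg
    refine (Submodule.quotientRel_def _).2 ?_
    have h1 : f ≫ g - f' ≫ g' = (f - f') ≫ g + f' ≫ (g - g') := by
      rw [Preadditive.sub_comp, Preadditive.comp_sub]; abel
    rw [h1]
    exact add_mem (TL.ker_comp ((Submodule.quotientRel_def _).1 hf) g)
      (TL.comp_ker f' ((Submodule.quotientRel_def _).1 hg))) f g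
  id_comp {Y Z} f := by
    induction f using Submodule.Quotient.induction_on with
    | H f => exact congrArg Submodule.Quotient.mk (Category.id_comp f)
  comp_id {Y Z} f := by
    induction f using Submodule.Quotient.induction_on with
    | H f => exact congrArg Submodule.Quotient.mk (Category.comp_id f)
  assoc {Y Z W V} f g h := by
    induction f using Submodule.Quotient.induction_on with
    | H f =>
    induction g using Submodule.Quotient.induction_on with
    | H g =>
    induction h using Submodule.Quotient.induction_on with
    | H h => exact congrArg Submodule.Quotient.mk (Category.assoc f g h)


noncomputable instance (d : ℂ) : Preadditive (ReducedTL d) where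
  homGroup Y Z := inferInstanceAs (AddCommGroup ((Y.obj ⟶ Z.obj) ⧸ TL.ker Y.obj Z.obj))
  add_comp Y Z W f f' g := by
    induction f using Submodule.Quotient.induction_on with
    | H f =>
    induction f' using Submodule.Quotient.induction_on with
    | H f' =>
    induction g using Submodule.Quotient.induction_on with
    | H g => exact congrArg Submodule.Quotient.mk (Preadditive.add_comp _ _ _ f f' g)
  comp_add Y Z W f g g' := by
    induction f using Submodule.Quotient.induction_on with
    | H f =>
    induction g' using Submodule.Quotient.induction_on with
    | H g' =>
    induction g using Submodule.Quotient.induction_on with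
    | H g => exact congrArg Submodule.Quotient.mk (Preadditive.comp_add _ _ _ f g g')

noncomputable instance (d : ℂ) : Linear ℂ (ReducedTL d) where
  homModule Y Z := inferInstanceAs (Module ℂ ((Y.obj ⟶ Z.obj) ⧸ TL.ker Y.obj Z.obj))
  smul_comp Y Z W r f g := by
    induction f using Submodule.Quotient.induction_on with
    | H f =>
    induction g using Submodule.Quotient.induction_on with
    | H g => exact congrArg Submodule.Quotient.mk (Linear.smul_comp _ _ _ r f g)
  comp_smul Y Z W f r g := by
    induction f using Submodule.Quotient.induction_on with
    | H f =>
    induction g using Submodule.Quotient.induction_on with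
    | H g => exact congrArg Submodule.Quotient.mk (Linear.comp_smul _ _ _ f r g)

namespace ReducedTL

/-- The class of a morphism in the reduced category. -/
noncomputable def ofTL {d : ℂ} {Y Z : TL d} (f : Y ⟶ Z) : (⟨Y⟩ : ReducedTL d) ⟶ ⟨Z⟩ :=
  (Submodule.Quotient.mk f : (Y ⟶ Z) ⧸ TL.ker Y Z)

theorem ofTL_comp {d : ℂ} {Y Z W : TL d} (f : Y ⟶ Z) (g : Z ⟶ W) : ofTL (f ≫ g) = ofTL f ≫ ofTL g := rfl

/-- The tensor product of objects of the reduced category. -/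
abbrev tensorObj {d : ℂ} (Y Z : ReducedTL d) : ReducedTL d := ⟨TL.tensorObj Y.obj Z.obj⟩

/-- The tensor product of morphisms of the reduced category. -/
noncomputable def tensorHom {d : ℂ} {Y Z Y' Z' : ReducedTL d} (f : Y ⟶ Z) (g : Y' ⟶ Z') :
    tensorObj Y Y' ⟶ tensorObj Z Z' :=
  Quotient.map₂ (TL.tensorHom (Y := Y.obj) (Z := Z.obj) (Y' := Y'.obj) (Z' := Z'.obj)) (by
    intro f f' hf g g' hg
    refine (Submodule.quotientRel_def _).2 ?_
    have h1 : TL.tensorHom f g - TL.tensorHom f' g' =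
        TL.tensorHom (f - f') g + TL.tensorHom f' (g - g') := by
      rw [sub_eq_add_neg f, sub_eq_add_neg g, ← neg_one_smul ℂ f', ← neg_one_smul ℂ g',
        TL.add_tensorHom, TL.tensorHom_add, TL.smul_tensorHom, TL.tensorHom_smul]
      module
    rw [h1]
    exact add_mem (TL.ker_tensor ((Submodule.quotientRel_def _).1 hf) g)
      (TL.tensor_ker f' ((Submodule.quotientRel_def _).1 hg))) f g

theorem ofTL_tensorHom {d : ℂ} {Y Z Y' Z' : TL d} (f : Y ⟶ Z) (g : Y' ⟶ Z') :
    tensorHom (ofTL f) (ofTL g) = ofTL (TL.tensorHom f g) := rfl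

theorem tensorHom_comp {d : ℂ} {Y Z W Y' Z' W' : ReducedTL d} (f : Y ⟶ Z) (g : Z ⟶ W)
    (f' : Y' ⟶ Z') (g' : Z' ⟶ W') :
    tensorHom f f' ≫ tensorHom g g' = tensorHom (f ≫ g) (f' ≫ g') := by
  induction f using Submodule.Quotient.induction_on with
  | H f =>
  induction g using Submodule.Quotient.induction_on with
  | H g =>
  induction f' using Submodule.Quotient.induction_on with
  | H f' =>
  induction g' using Submodule.Quotient.induction_on with
  | H g' => exact congrArg Submodule.Quotient.mk (TL.tensorHom_comp f g f' g')

open Idempotents in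
/-- The tensor product of objects in the idempotent completion of the reduced category. -/
noncomputable def karoubiTensorObj {d : ℂ} (P Q : Karoubi (ReducedTL d)) : Karoubi (ReducedTL d) where
  X := tensorObj P.X Q.X
  p := tensorHom P.p Q.p
  idem := by rw [tensorHom_comp, P.idem, Q.idem]

open Idempotents Classical in
/-- The object of the idempotent completion of the reduced category given by the image of the
Jones–Wenzl idempotent `f_k`; the zero object for `k < 0` (and when `f_k` is not idempotent,
which does not occur for the `k` considered). -/
noncomputable def jonesWenzlObj (d q : ℂ) : ℤ → Karoubi (ReducedTL d)
  | .ofNat k =>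
    if h : jonesWenzl d q k ≫ jonesWenzl d q k = jonesWenzl d q k then
      { X := ⟨X d k⟩, p := ofTL (jonesWenzl d q k), idem := by rw [← ofTL_comp, h] }
    else { X := ⟨X d k⟩, p := 0, idem := by simp }
  | .negSucc _ => { X := ⟨X d 0⟩, p := 0, idem := by simp }

/-- The generating object `X` as an object of the idempotent completion. -/
noncomputable def generator (d : ℂ) : Idempotents.Karoubi (ReducedTL d) :=
  (Idempotents.toKaroubi (ReducedTL d)).obj ⟨X d 1⟩

end ReducedTL

/-- `Y` is a direct sum of the finite family `F`, through suitable injections and projections. -/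
def IsDirectSum {C : Type*} [Category C] [Preadditive C] {n : ℕ} (Y : C) (F : Fin n → C) : Prop :=
  ∃ (α : ∀ j, F j ⟶ Y) (β : ∀ j, Y ⟶ F j), (∀ j, α j ≫ β j = 𝟙 (F j)) ∧
    (∀ i j, i ≠ j → α i ≫ β j = 0) ∧ ∑ j, β j ≫ α j = 𝟙 Y

/-- A finite-dimensional linear category is essentially semisimple if the endomorphism algebra of
every finite formal direct sum of objects is semisimple. -/
def EssentiallySemisimple (C : Type*) [Category C] [Preadditive C] [Linear ℂ C] : Prop :=
  (∀ Y Z : C, FiniteDimensional ℂ (Y ⟶ Z)) ∧ ∀ M : Mat_ C, IsSemisimpleRing (End M)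

end TemperleyLieb

open CategoryTheory TemperleyLieb

namespace TemperleyLieb

/-! ### Diagram identities via colouring matrices -/

namespace Diagram

/-! Diagrams are manipulated through the representation with loop value 2. `mat` records the
two-colourings constant along the strings, stacking becomes a matrix product up to a power of 2
counting loops, and `mat_inj` recovers both the diagram and the exponent. An identity of diagrams
and loop numbers proved there is valid for every `d`.

One induction (`jonesWenzl_properties`) shows that the Jones–Wenzl elements are idempotent, absorb
their predecessors, and that the partial trace of `f_{k+1}` is `[k+2]/[k+1]` times `f_k`. The
coefficient in the recursion is exactly the one that makes `f_{k+2}` kill the cap on the last two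
strings, and absorption extends this to all adjacent pairs. A noncrossing diagram joining two points
on one side joins two neighbours there (`exists_adjacent`), so the idempotents kill every diagram
that turns back, and only the identity diagram survives. This is Schur's lemma (`sandwich_ne`,
`exists_sandwich_eq`): `f_j ≫ g ≫ f_k` is zero for `j ≠ k` and a multiple of `f_k` for `j = k`. The
traces telescope to `tr f_k = [k+1]`, nonzero for `k < l - 1` and zero for `k = l - 1`. Hence
`f_{l-1}` lies in the kernel, and sandwiching a kernel element between `f_j` and `f_k` with `j, k <
l - 1` gives zero.

The second ingredient is that `1 - f_n` factors through `n - 2` strings, so every identity is a sum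
of morphisms through `f_k`, `k ≤ n`. This computes the kernel for `n ≤ l - 1`. For larger `n`, if
`J` is a monoidal ideal containing `f_{l-1}`, then `1_n` is a sum of morphisms through `f_k`, `k < l
- 1`, plus an element of `J` (`id_mem_sup`). Sandwiching a kernel element between two such
decompositions leaves only terms in `J`, so the kernel is the smallest such ideal.

With `J` the kernel itself, `id_mem_sup` says that identities of the reduced category are sums of
morphisms through `f_0, …, f_{l-2}`. Together with Schur's lemma this is a `SemisimpleSystem`, a
structure which passes to formal direct sums and to the idempotent completion and formally implies
semisimplicity. For the fusion rules, Wenzl's recursion writes `f_{k+1} ⊗ 1` as the sum of `f_{k+2}`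
and an orthogonal idempotent equivalent to `f_k`; at the last level the class of `f_{l-1}` is zero.
-/

theorem eq_of_mat_eq {m n : ℕ} {D E : Diagram m n} (h : D.mat = E.mat) : D = E :=
  (mat_inj (a := 0) (b := 0) (by rw [h])).2

theorem comp_eq_of_mat_mul_eq {m n p : ℕ} {D : Diagram m n} {E : Diagram n p} {F : Diagram m p}
    {a : ℕ} (h : D.mat * E.mat = 2 ^ a • F.mat) : D.compLoops E = a ∧ D.comp E = F :=
  mat_inj (by rw [← mat_mul, h])

/-- Reassociated juxtapositions live in different types, so the comparison is heterogeneous and the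
colourings are transported along `Fin.cast`. -/
theorem heq_of_mat_eq {m n m' n' : ℕ} (hm : m' = m) (hn : n' = n) {D : Diagram m n}
    {E : Diagram m' n'}
    (h : ∀ x y, D.mat x y = E.mat (x ∘ Fin.cast hm) (y ∘ Fin.cast hn)) : HEq D E := by
  subst hm hn
  exact heq_of_eq (eq_of_mat_eq (by ext x y; exact h x y))

/-- Juxtaposition of diagrams is associative. -/
theorem tensor_assoc_heq {m n m' n' m'' n'' : ℕ} (D : Diagram m n) (E : Diagram m' n')
    (F : Diagram m'' n'') : HEq ((D.tensor E).tensor F) (D.tensor (E.tensor F)) := by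
  symm
  refine heq_of_mat_eq (Nat.add_assoc _ _ _) (Nat.add_assoc _ _ _) fun x y => ?_
  obtain ⟨x₁, x, rfl⟩ := exists_append x
  obtain ⟨x₂, x₃, rfl⟩ := exists_append x
  obtain ⟨y₁, y, rfl⟩ := exists_append y
  obtain ⟨y₂, y₃, rfl⟩ := exists_append y
  rw [← Fin.append_assoc, ← Fin.append_assoc]
  simp only [mat_tensor, mul_assoc]

theorem tensor_id_zero {m n : ℕ} (D : Diagram m n) : D.tensor (id 0) = D := by
  refine eq_of_mat_eq ?_
  ext x y
  have h := mat_tensor D (id 0) x Fin.elim0 y Fin.elim0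
  rw [Fin.append_elim0, Fin.append_elim0, mat_id, Matrix.one_apply_eq, mul_one] at h
  exact h

theorem id_zero_tensor_heq {m n : ℕ} (D : Diagram m n) : HEq D ((id 0).tensor D) := by
  refine heq_of_mat_eq (Nat.zero_add _) (Nat.zero_add _) fun x y => ?_
  rw [← Fin.elim0_append, ← Fin.elim0_append, mat_tensor, mat_id, Matrix.one_apply_eq, one_mul]

/-! ### Reflection of diagrams and the elementary relations -/

/-- The upside-down diagram. -/
def flip {m n : ℕ} (D : Diagram m n) : Diagram n m where
  arc x := (D.arc x.swap).swap
  arc_arc x := by simp [D.arc_arc]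
  arc_ne x h := D.arc_ne x.swap (by simpa using congrArg Sum.swap h)
  noncrossing := by
    have hb : ∀ x, boundaryPos m n x.swap + boundaryPos n m x + 1 = m + n := by
      rintro (i | i) <;> simp only [Sum.swap_inl, Sum.swap_inr, boundaryPos, Fin.val_rev] <;> omega
    intro x y h
    have h1 := hb x
    have h2 := hb y
    have h3 := hb (D.arc x.swap).swap
    have h4 := hb (D.arc y.swap).swap
    rw [Sum.swap_swap] at h3 h4
    -- Reflection reverses the boundary order (`hb`), so a crossing of the reflected arcs is a
    -- crossing of the original ones, read from their other ends.
    have := D.noncrossing (D.arc y.swap) (D.arc x.swap)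
    rw [D.arc_arc, D.arc_arc] at this
    omega

theorem flip_flip {m n : ℕ} (D : Diagram m n) : D.flip.flip = D := by
  ext1
  funext x
  simp [flip]

theorem mat_flip {m n : ℕ} (D : Diagram m n) : D.flip.mat = D.mat.transpose := by
  have h : ∀ (x : Fin m → Bool) (y : Fin n → Bool) s,
      Sum.elim y x s = Sum.elim x y s.swap := by rintro x y (s | s) <;> rfl
  ext y x
  simp only [mat, flip, Matrix.transpose_apply, h, Sum.swap_swap]
  congr 1
  rw [eq_iff_iff]
  exact (Equiv.sumComm _ _).forall_congr_left.trans (by simp)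

theorem flip_comp {m n p : ℕ} (D : Diagram m n) (E : Diagram n p) :
    E.flip.compLoops D.flip = D.compLoops E ∧ E.flip.comp D.flip = (D.comp E).flip := by
  apply comp_eq_of_mat_mul_eq
  rw [mat_flip, mat_flip, mat_flip, ← Matrix.transpose_mul, mat_mul, Matrix.transpose_smul]

theorem flip_tensor {m n m' n' : ℕ} (D : Diagram m n) (E : Diagram m' n') :
    (D.tensor E).flip = D.flip.tensor E.flip := by
  refine eq_of_mat_eq ?_
  ext x y
  obtain ⟨x, x', rfl⟩ := exists_append x
  obtain ⟨y, y', rfl⟩ := exists_append y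
  simp only [mat_flip, mat_tensor, Matrix.transpose_apply]

theorem flip_id (n : ℕ) : (id n).flip = id n :=
  eq_of_mat_eq (by rw [mat_flip, mat_id, Matrix.transpose_one])

theorem flip_cap : cap.flip = cup := by
  ext1
  funext x
  rcases x with x | x
  · rfl
  · exact x.elim0

theorem mat_cap (x : Fin 0 → Bool) (y : Fin 2 → Bool) :
    cap.mat x y = if y 0 = y 1 then 1 else 0 := by
  simp [mat, cap, Fin.forall_fin_two, eq_comm]

theorem mat_cup (x : Fin 2 → Bool) (y : Fin 0 → Bool) :
    cup.mat x y = if x 0 = x 1 then 1 else 0 := by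
  rw [← flip_cap, mat_flip, Matrix.transpose_apply, mat_cap]

theorem sum_fin_two (g : (Fin 2 → Bool) → ℕ) :
    ∑ z, g z = (g ![true, true] + g ![true, false]) + (g ![false, true] + g ![false, false]) := by
  rw [← (finTwoArrowEquiv Bool).symm.sum_comp, Fintype.sum_prod_type]
  simp [finTwoArrowEquiv]

theorem cap_comp_cup : cap.compLoops cup = 1 ∧ cap.comp cup = id 0 := by
  apply comp_eq_of_mat_mul_eq
  ext x y
  rw [Matrix.mul_apply, sum_fin_two, mat_id]
  simp [mat_cap, mat_cup, Subsingleton.elim x y]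

theorem zigzag_one : ((id 1).tensor cap).compLoops (cup.tensor (id 1)) = 0 ∧
    ((id 1).tensor cap).comp (cup.tensor (id 1)) = id 1 := by
  apply comp_eq_of_mat_mul_eq
  rw [pow_zero, one_smul, mat_id]
  ext x y
  rw [Matrix.mul_apply]
  simp only [mat]
  change _ = if x = y then 1 else 0
  revert x y
  -- Only colourings of one and of three points occur, so this is a finite check.
  decide +kernel

/-- Both factors start with `k` vertical strings, so the interchange law reduces the relation to
`zigzag_one`. -/
theorem zigzag (k : ℕ) :
    ((id (k + 1)).tensor cap).compLoops (((id k).tensor cup).tensor (id 1)) = 0 ∧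
    ((id (k + 1)).tensor cap).comp (((id k).tensor cup).tensor (id 1)) = id (k + 1) := by
  have h1 : ((id k).tensor cup).tensor (id 1) = (id k).tensor (cup.tensor (id 1)) :=
    eq_of_heq (tensor_assoc_heq _ _ _)
  have h2 : (id (k + 1)).tensor cap = (id k).tensor ((id 1).tensor cap) := by
    rw [← id_tensor_id]
    exact eq_of_heq (tensor_assoc_heq _ _ _)
  have h := tensor_comp (id k) (id k) ((id 1).tensor cap) (cup.tensor (id 1))
  rw [zigzag_one.1, zigzag_one.2, (id_comp _).1, (id_comp _).2, id_tensor_id] at h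
  rw [h1, h2]
  exact h

/-! ### Splitting off a cap between neighbours -/

theorem tensor_id_tensor_id {m n : ℕ} (D : Diagram m n) (j : ℕ) :
    (D.tensor (id j)).tensor (id 1) = D.tensor (id (j + 1)) := by
  rw [← id_tensor_id j 1]
  exact eq_of_heq (tensor_assoc_heq _ _ _)

/-- The elementary diagram joining the adjacent lower points `i` and `i + 1`. -/
def capAt (i j : ℕ) : Diagram (i + j) (i + 2 + j) :=
  ((id i).tensor cap).tensor (id j)

theorem mat_capAt (i j : ℕ) (x₁ y₁ : Fin i → Bool) (x₂ y₂ : Fin j → Bool) (z : Fin 2 → Bool) :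
    (capAt i j).mat (Fin.append x₁ x₂) (Fin.append (Fin.append y₁ z) y₂) =
      (if x₁ = y₁ then 1 else 0) * (if z 0 = z 1 then 1 else 0) * (if x₂ = y₂ then 1 else 0) := by
  have h : x₁ = Fin.append x₁ (Fin.elim0 : Fin 0 → Bool) := (Fin.append_elim0 _).symm
  conv_lhs => rw [h]
  rw [capAt]
  erw [mat_tensor, mat_tensor]
  rw [mat_id, mat_id, mat_cap, Matrix.one_apply, Matrix.one_apply]

theorem exists_append_append {i j : ℕ} (x : Fin (i + 2 + j) → Bool) :
    ∃ x₁ z x₂, x = Fin.append (Fin.append (m := i) (n := 2) x₁ z) x₂ := by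
  obtain ⟨x, x₂, rfl⟩ := exists_append x
  obtain ⟨x₁, z, rfl⟩ := exists_append x
  exact ⟨x₁, z, x₂, rfl⟩

theorem mul_mat_capAt {n i j : ℕ} (D : Diagram n (i + j)) (x : Fin n → Bool)
    (y₁ : Fin i → Bool) (z : Fin 2 → Bool) (y₂ : Fin j → Bool) :
    (D.mat * (capAt i j).mat) x (Fin.append (Fin.append y₁ z) y₂) =
      D.mat x (Fin.append y₁ y₂) * if z 0 = z 1 then 1 else 0 := by
  rw [Matrix.mul_apply, sum_append]
  simp [mat_capAt]

theorem mul_mat_capAt_flip {n i j : ℕ} (D : Diagram n (i + 2 + j)) (x : Fin n → Bool)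
    (y₁ : Fin i → Bool) (y₂ : Fin j → Bool) :
    (D.mat * (capAt i j).flip.mat) x (Fin.append y₁ y₂) =
      D.mat x (Fin.append (Fin.append y₁ ![true, true]) y₂) +
        D.mat x (Fin.append (Fin.append y₁ ![false, false]) y₂) := by
  rw [Matrix.mul_apply, sum_append]
  simp only [sum_append, mat_flip, Matrix.transpose_apply, mat_capAt, sum_fin_two]
  simp [Finset.sum_add_distrib]

/-- `E` is `D` with its small cap closed off by the reflected elementary diagram. The entries of
`D.mat` vanish if the two joined points have different colours (`h0`) and do not depend on their
common colour (`h1`). Closing and reopening the cap therefore doubles `D.mat`, and `mat_inj`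
recovers `D`. -/
theorem eq_comp_capAt {n i j : ℕ} (D : Diagram n (i + 2 + j))
    (h : D.arc (.inr (Fin.castAdd j (Fin.natAdd i 0))) =
      .inr (Fin.castAdd j (Fin.natAdd i 1))) :
    ∃ E : Diagram n (i + j), E.compLoops (capAt i j) = 0 ∧ E.comp (capAt i j) = D := by
  have h' : D.arc (.inr (Fin.castAdd j (Fin.natAdd i 1))) =
      .inr (Fin.castAdd j (Fin.natAdd i 0)) := by rw [← h, D.arc_arc]
  have h0 : ∀ x y₁ z y₂, z 0 ≠ z 1 →
      D.mat x (Fin.append (Fin.append (m := i) (n := 2) y₁ z) y₂) = 0 := by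
    intro x y₁ z y₂ hz
    rw [mat, if_neg]
    intro hs
    have := hs (.inr (Fin.castAdd j (Fin.natAdd i 0)))
    rw [h] at this
    simp only [Sum.elim_inr, Fin.append_left, Fin.append_right] at this
    exact hz this.symm
  have h1 : ∀ x y₁ y₂ a b,
      D.mat x (Fin.append (Fin.append (m := i) (n := 2) y₁ ![a, a]) y₂) =
        D.mat x (Fin.append (Fin.append (m := i) (n := 2) y₁ ![b, b]) y₂) := by
    suffices H : ∀ x y₁ y₂ a b, (∀ s, Sum.elim x
        (Fin.append (Fin.append (m := i) (n := 2) y₁ ![a, a]) y₂) (D.arc s) = Sum.elim x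
        (Fin.append (Fin.append (m := i) (n := 2) y₁ ![a, a]) y₂) s) → ∀ s, Sum.elim x
        (Fin.append (Fin.append (m := i) (n := 2) y₁ ![b, b]) y₂) (D.arc s) = Sum.elim x
        (Fin.append (Fin.append (m := i) (n := 2) y₁ ![b, b]) y₂) s by
      intro x y₁ y₂ a b
      simp only [mat]
      congr 1
      exact propext ⟨H x y₁ y₂ a b, H x y₁ y₂ b a⟩
    intro x y₁ y₂ a b H s
    by_cases hs0 : s = .inr (Fin.castAdd j (Fin.natAdd i 0))
    · subst hs0
      rw [h]
      simp
    by_cases hs1 : s = .inr (Fin.castAdd j (Fin.natAdd i 1))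
    · subst hs1
      rw [h']
      simp
    have ht0 : D.arc s ≠ .inr (Fin.castAdd j (Fin.natAdd i 0)) := fun e => hs1 (by
      rw [← D.arc_arc s, e, h])
    have ht1 : D.arc s ≠ .inr (Fin.castAdd j (Fin.natAdd i 1)) := fun e => hs0 (by
      rw [← D.arc_arc s, e, h'])
    have key : ∀ t, t ≠ .inr (Fin.castAdd j (Fin.natAdd i 0)) →
        t ≠ .inr (Fin.castAdd j (Fin.natAdd i 1)) →
        Sum.elim x (Fin.append (Fin.append (m := i) (n := 2) y₁ ![a, a]) y₂) t =
          Sum.elim x (Fin.append (Fin.append (m := i) (n := 2) y₁ ![b, b]) y₂) t := by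
      rintro (t | t) k0 k1
      · rfl
      · induction t using Fin.addCases with
        | right t => simp
        | left t =>
          induction t using Fin.addCases with
          | left t => simp
          | right t =>
            fin_cases t
            · exact absurd rfl k0
            · exact absurd rfl k1
    rw [← key _ ht0 ht1, ← key _ hs0 hs1]
    exact H s
  let E := D.comp (capAt i j).flip
  have hmul : 2 ^ D.compLoops (capAt i j).flip • (E.mat * (capAt i j).mat) = 2 ^ 1 • D.mat := by
    rw [← Matrix.smul_mul, ← mat_mul]
    ext x y
    obtain ⟨y₁, z, y₂, rfl⟩ := exists_append_append y
    have : (D.mat * (capAt i j).flip.mat * (capAt i j).mat) x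
        (Fin.append (Fin.append y₁ z) y₂) = (D.mat * (capAt i j).flip.mat) x (Fin.append y₁ y₂) *
          if z 0 = z 1 then 1 else 0 := by
      rw [mat_mul, Matrix.smul_mul, Matrix.smul_apply, mul_mat_capAt, Matrix.smul_apply,
        smul_mul_assoc]
    rw [this, mul_mat_capAt_flip, Matrix.smul_apply]
    split_ifs with hz
    · have hz' : z = ![z 0, z 0] := by
        ext t
        fin_cases t
        · rfl
        · exact hz.symm
      rw [hz', h1 x y₁ y₂ true (z 0), h1 x y₁ y₂ false (z 0)]
      simp
      ring
    · rw [h0 x y₁ z y₂ hz]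
      simp
  -- At the constant colouring every diagram has matrix entry 1, so the product formula there reads
  -- `1 = 2 ^ loops`.
  have hE : E.compLoops (capAt i j) = 0 := by
    have h2 := congrFun (congrFun (mat_mul E (capAt i j)) fun _ => true)
      (Fin.append (Fin.append (fun _ => true) (fun _ => true)) (fun _ => true))
    have htrue : ∀ {a b : ℕ} (F : Diagram a b) (x y), (∀ i, x i = true) → (∀ i, y i = true) →
        F.mat x y = 1 := by
      intro a b F x y hx hy
      rw [mat, if_pos]
      have : ∀ s, Sum.elim x y s = true := by rintro (s | s) <;> simp [hx, hy]
      intro s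
      rw [this, this]
    have happ : ∀ {a b : ℕ} (x : Fin a → Bool) (y : Fin b → Bool), (∀ i, x i = true) →
        (∀ i, y i = true) → ∀ i, Fin.append x y i = true := by
      intro a b x y hx hy t
      induction t using Fin.addCases <;> simp [hx, hy]
    rw [mul_mat_capAt, Matrix.smul_apply,
      htrue _ _ _ (fun _ => rfl) (happ _ _ (fun _ => rfl) fun _ => rfl),
      htrue _ _ _ (fun _ => rfl)
        (happ _ _ (happ _ _ (fun _ => rfl) fun _ => rfl) fun _ => rfl)] at h2
    simpa using h2.symm
  refine ⟨E, hE, ?_⟩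
  rw [mat_mul, hE, pow_zero, one_smul] at hmul
  exact (mat_inj hmul).2

/-- Innermost arc argument: a point strictly between the ends of an arc of minimal width would be
joined to another such point, giving a narrower arc. The width is written `k + 1`, so `k = 0` means
adjacency. -/
theorem exists_adjacent {m n : ℕ} (D : Diagram m n) (h : ∃ i j, D.arc (.inr i) = .inr j) :
    ∃ i j : Fin n, (j : ℕ) = i + 1 ∧ D.arc (.inr i) = .inr j := by
  have h1 : ∃ k, ∃ i j : Fin n, (j : ℕ) = i + (k + 1) ∧ D.arc (.inr i) = .inr j := by
    obtain ⟨i, j, hij⟩ := h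
    rcases lt_trichotomy i j with hlt | rfl | hlt
    · exact ⟨j - i - 1, i, j, by have := Fin.lt_def.1 hlt; omega, hij⟩
    · exact absurd hij (D.arc_ne _)
    · exact ⟨i - j - 1, j, i, by have := Fin.lt_def.1 hlt; omega, by rw [← hij, D.arc_arc]⟩
  classical
  obtain ⟨i, j, hk, hij⟩ := Nat.find_spec h1
  have hmin := fun k hk => Nat.find_min (m := k) h1 hk
  set k := Nat.find h1
  rcases Nat.eq_zero_or_pos k with h0 | hpos
  · exact ⟨i, j, by omega, hij⟩
  exfalso
  have hj := j.2
  have hji : D.arc (.inr j) = .inr i := by rw [← hij, D.arc_arc]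
  let s : Fin n := ⟨i + 1, by omega⟩
  have hs : (s : ℕ) = i + 1 := rfl
  -- Lower points are read from right to left, so the order is `j`, `s`, `i`. Here `n1` excludes a
  -- partner of `s` after `i`, and `n2` one before `j`, in particular an upper point.
  have n1 := D.noncrossing (.inr j) (.inr s)
  have n2 := D.noncrossing (D.arc (.inr s)) (.inr j)
  rw [D.arc_arc] at n2
  rw [hji] at n1 n2
  rcases hsa : D.arc (.inr s) with t | t
  · rw [hsa] at n2
    simp only [boundaryPos, Fin.val_rev] at n2
    omega
  · rw [hsa] at n1 n2
    simp only [boundaryPos, Fin.val_rev] at n1 n2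
    have ht : t ≠ s := by
      rintro rfl
      exact D.arc_ne _ hsa
    have hti : t ≠ i := by
      rintro rfl
      have : D.arc (.inr t) = .inr s := by rw [← hsa, D.arc_arc]
      rw [hij] at this
      have := congrArg Fin.val (Sum.inr_injective this)
      omega
    have htj : t ≠ j := by
      rintro rfl
      have : D.arc (.inr t) = .inr s := by rw [← hsa, D.arc_arc]
      rw [hji] at this
      have := congrArg Fin.val (Sum.inr_injective this)
      omega
    rw [ne_eq, Fin.ext_iff] at ht hti htj
    have := t.2
    exact hmin (t - s - 1) (by omega) ⟨s, t, by omega, hsa⟩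

theorem eq_comp_capAt_of_arc {m n : ℕ} (D : Diagram m n) (h : ∃ i j, D.arc (.inr i) = .inr j) :
    ∃ (i j : ℕ) (hn : i + 2 + j = n) (E : Diagram m (i + j)),
      E.compLoops (capAt i j) = 0 ∧ E.comp (capAt i j) = hn ▸ D := by
  obtain ⟨i, j, hij, harc⟩ := D.exists_adjacent h
  obtain ⟨a, ha⟩ : ∃ a : ℕ, a = i := ⟨_, rfl⟩
  obtain ⟨k, rfl⟩ : ∃ k, n = a + 2 + k := ⟨n - (a + 2), by have := j.2; omega⟩
  refine ⟨a, k, rfl, D.eq_comp_capAt ?_⟩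
  convert harc using 3
  · exact Fin.ext (by simpa using ha)
  · exact Fin.ext (by simp [hij, ha])

/-! ### Diagrams that do not turn back -/

/-- All strings run from top to bottom. Noncrossing makes the resulting map `f` strictly increasing,
and `Fin n` has no order automorphism but the identity. -/
theorem eq_id {n : ℕ} (D : Diagram n n) (h : ∀ i j, D.arc (.inr i) ≠ .inr j)
    (h' : ∀ i j, D.arc (.inl i) ≠ .inl j) : D = id n := by
  have h1 : ∀ i, ∃ j, D.arc (.inl i) = .inr j := fun i => by
    rcases hi : D.arc (.inl i) with j | j
    · exact absurd hi (h' i j)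
    · exact ⟨j, rfl⟩
  have h2 : ∀ i, ∃ j, D.arc (.inr i) = .inl j := fun i => by
    rcases hi : D.arc (.inr i) with j | j
    · exact ⟨j, rfl⟩
    · exact absurd hi (h i j)
  choose f hf using h1
  have hmono : StrictMono f := by
    intro i j hij
    have hn := D.noncrossing (.inl i) (.inl j)
    rw [hf, hf] at hn
    simp only [boundaryPos, Fin.val_rev] at hn
    have hne : f i ≠ f j := fun e => hij.ne (Sum.inl_injective (by
      rw [← D.arc_arc (.inl i), hf, e, ← hf, D.arc_arc]))
    rw [ne_eq, Fin.ext_iff] at hne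
    rw [Fin.lt_def] at hij ⊢
    omega
  have hfid : ∀ i, f i = i := fun i => by
    have := hmono.id_le
    have hbij : Function.Bijective f := Finite.injective_iff_bijective.1 hmono.injective
    let e : Fin n ≃o Fin n := StrictMono.orderIsoOfSurjective f hmono hbij.2
    have he : e = OrderIso.refl _ := Subsingleton.elim _ _
    exact congrArg (fun e : Fin n ≃o Fin n => e i) he
  ext1
  funext x
  rcases x with x | x
  · rw [hf, hfid]
    rfl
  · change _ = Sum.inl x
    rw [← D.arc_arc (.inl x), hf, hfid]

theorem card_le {m n : ℕ} (D : Diagram m n) (h : ∀ i j, D.arc (.inl i) ≠ .inl j) : m ≤ n := by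
  have h1 : ∀ i, ∃ j, D.arc (.inl i) = .inr j := fun i => by
    rcases hi : D.arc (.inl i) with j | j
    · exact absurd hi (h i j)
    · exact ⟨j, rfl⟩
  choose f hf using h1
  have hinj : Function.Injective f := fun i j e => Sum.inl_injective (by
      rw [← D.arc_arc (.inl i), hf, e, ← hf, D.arc_arc])
  simpa using Fintype.card_le_of_injective f hinj

/-- By counting, `D` joins two upper points. Colouring just one of them differently from all other
points gives a zero row of `D.mat`, hence of the product, whereas the identity matrix has no zero
row. -/
theorem comp_ne_id {n r : ℕ} (hr : r < n) (D : Diagram n r)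
    (E : Diagram r n) : D.comp E ≠ id n := by
  intro hDE
  have h : ∃ i j, D.arc (.inl i) = .inl j := by
    by_contra h
    push Not at h
    exact absurd (D.card_le h) (by omega)
  obtain ⟨i, j, hij⟩ := h
  have hne : i ≠ j := by
    rintro rfl
    exact D.arc_ne _ hij
  have h1 := mat_mul D E
  rw [hDE, mat_id] at h1
  have h2 := congrFun (congrFun h1 fun t => decide (t = i)) fun t => decide (t = i)
  have h3 : ∀ y, D.mat (fun t => decide (t = i)) y = 0 := by
    intro y
    rw [mat, if_neg]
    intro hs
    have := hs (.inl i)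
    rw [hij] at this
    simp [hne.symm] at this
  simp only [Matrix.mul_apply, h3, zero_mul, Finset.sum_const_zero, Matrix.smul_apply,
    Matrix.one_apply_eq, smul_eq_mul, mul_one] at h2
  exact pow_ne_zero _ two_ne_zero h2.symm

theorem flip_arc_inl {m n : ℕ} (D : Diagram m n) (i j) (h : D.arc (.inl i) = .inl j) :
    D.flip.arc (.inr i) = .inr j := by
  simp [flip, h]

theorem eq_of_flip_arc {m n : ℕ} (D : Diagram m n) (h : ∀ i j, D.arc (.inr i) ≠ .inr j)
    (h' : ∀ i j, D.flip.arc (.inr i) ≠ .inr j) : m = n ∧ HEq D (id n) := by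
  have h1 : ∀ i j, D.arc (.inl i) ≠ .inl j := fun i j e => h' i j (D.flip_arc_inl i j e)
  have h2 : m = n := le_antisymm (D.card_le h1) (D.flip.card_le fun i j e => h i j (by
    rw [← D.flip_flip]; exact D.flip.flip_arc_inl i j e))
  subst h2
  exact ⟨rfl, heq_of_eq (D.eq_id h h1)⟩

instance finite {m n : ℕ} : Finite (Diagram m n) :=
  Finite.of_injective Diagram.arc fun _ _ h => Diagram.ext h

/-! ### Operations on the last string and the Markov property -/

/-- The elementary diagram joining the last two lower points. -/
def capLast (k : ℕ) : Diagram k (k + 2) := (id k).tensor cap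

/-- The elementary diagram joining the last two upper points. -/
def cupLast (k : ℕ) : Diagram (k + 2) k := (id k).tensor cup

/-- Addition of a vertical string on the right. -/
def addString {m n : ℕ} (D : Diagram m n) : Diagram (m + 1) (n + 1) := D.tensor (id 1)

theorem mat_addString {m n : ℕ} (H : Diagram (m + 1) (n + 1)) (x : Fin m → Bool)
    (y : Fin n → Bool) (a a' b b' : Bool) :
    H.addString.mat (Fin.append (m := m) (n := 2) x ![a, a'])
      (Fin.append (m := n) (n := 2) y ![b, b']) =
      H.mat (Fin.append x ![a]) (Fin.append y ![b]) * if a' = b' then 1 else 0 := by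
  have h : ∀ {m : ℕ} (x : Fin m → Bool) (a a' : Bool), Fin.append (m := m) (n := 2) x ![a, a'] =
      Fin.append (Fin.append x ![a]) ![a'] := by
    intro m x a a'
    rw [Fin.append_assoc]
    have : (![a, a'] : Fin 2 → Bool) = Fin.append ![a] ![a'] := by ext t; fin_cases t <;> rfl
    rw [this]
    rfl
  rw [h, h, addString, mat_tensor, mat_id, Matrix.one_apply]
  simp

theorem mat_capLast (k : ℕ) (x y : Fin k → Bool) (z : Fin 2 → Bool) :
    (capLast k).mat x (Fin.append y z) =
      if x = y then (if z 0 = z 1 then 1 else 0) else 0 := by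
  have h : x = Fin.append x (Fin.elim0 : Fin 0 → Bool) := (Fin.append_elim0 _).symm
  conv_lhs => rw [h]
  refine (mat_tensor _ _ _ _ _ _).trans ?_
  rw [mat_id, mat_cap, Matrix.one_apply, ite_mul, one_mul, zero_mul]

theorem flip_capLast (k : ℕ) : (capLast k).flip = cupLast k := by
  rw [capLast, flip_tensor, flip_id, flip_cap]
  rfl

theorem mat_cupLast (k : ℕ) (x y : Fin k → Bool) (z : Fin 2 → Bool) :
    (cupLast k).mat (Fin.append y z) x =
      if x = y then (if z 0 = z 1 then 1 else 0) else 0 := by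
  rw [← flip_capLast, mat_flip, Matrix.transpose_apply, mat_capLast]

theorem sum_fin_one (g : (Fin 1 → Bool) → ℕ) : ∑ z, g z = g ![true] + g ![false] := by
  rw [← (Equiv.funUnique (Fin 1) Bool).symm.sum_comp, Fintype.sum_bool]
  congr 2 <;> ext t <;> fin_cases t <;> rfl

/-- The cap and the cup force the last two colours to agree below and above, and the added string
identifies the two common colours. What remains is the sum of the diagonal entries of `H.mat`. -/
theorem trace_mat_markov {k : ℕ} (H : Diagram (k + 1) (k + 1)) :
    ((capLast k).mat * (H.addString.mat * (cupLast k).mat)).trace = H.mat.trace := by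
  simp only [Matrix.trace, Matrix.diag_apply]
  rw [sum_append]
  simp only [sum_fin_one]
  refine Finset.sum_congr rfl fun x _ => ?_
  have h1 : ∀ w, (H.addString.mat * (cupLast k).mat) w x =
      H.addString.mat w (Fin.append (m := k) (n := 2) x ![true, true]) +
      H.addString.mat w (Fin.append (m := k) (n := 2) x ![false, false]) := by
    intro w
    rw [Matrix.mul_apply]
    refine (sum_append (m := k) (n := 2) _).trans ?_
    simp only [mat_cupLast, sum_fin_two]
    simp [Finset.sum_add_distrib]
  rw [Matrix.mul_apply]
  refine (sum_append (m := k) (n := 2) _).trans ?_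
  simp only [mat_capLast, h1, sum_fin_two, mat_addString]
  simp [Finset.sum_add_distrib]

/-- The trace of a diagram is the trace of its partial closure. -/
theorem markov {k : ℕ} (H : Diagram (k + 1) (k + 1)) :
    H.addString.compLoops (cupLast k) + ((capLast k).compLoops (H.addString.comp (cupLast k)) +
        ((capLast k).comp (H.addString.comp (cupLast k))).closureLoops) = H.closureLoops := by
  apply Nat.pow_right_injective le_rfl
  simp only [pow_add, ← trace_mat]
  rw [← trace_mat_markov, mat_mul, Matrix.mul_smul, Matrix.trace_smul, mat_mul, Matrix.trace_smul]
  simp only [smul_eq_mul]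

end Diagram

/-! ### Calculus of morphisms: strings, cups, caps, reflection, trace -/

namespace TL

variable {d : ℂ}

/-- Addition of a vertical string on the right. -/
noncomputable def addString {m n : ℕ} (f : X d m ⟶ X d n) : X d (m + 1) ⟶ X d (n + 1) :=
  tensorHom f (𝟙 (X d 1))

/-- The morphism `1 ⊗ ∩`. -/
noncomputable def capLast (d : ℂ) (k : ℕ) : X d (k + 2) ⟶ X d k := ofDiagram d (Diagram.capLast k)

/-- The morphism `1 ⊗ ∪`. -/
noncomputable def cupLast (d : ℂ) (k : ℕ) : X d k ⟶ X d (k + 2) := ofDiagram d (Diagram.cupLast k)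

theorem addString_ofDiagram {m n : ℕ} (D : Diagram n m) :
    addString (ofDiagram d D) = ofDiagram d D.addString :=
  ofDiagram_tensor d D (Diagram.id 1)

theorem addString_comp {m n p : ℕ} (f : X d m ⟶ X d n) (g : X d n ⟶ X d p) :
    addString (f ≫ g) = addString f ≫ addString g := by
  rw [addString, addString, addString, tensorHom_comp, Category.comp_id]

theorem addString_id (n : ℕ) : addString (𝟙 (X d n)) = 𝟙 (X d (n + 1)) := id_tensorHom_id _ _

theorem addString_add {m n : ℕ} (f g : X d m ⟶ X d n) :
    addString (f + g) = addString f + addString g := add_tensorHom f g _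

theorem addString_smul {m n : ℕ} (a : ℂ) (f : X d m ⟶ X d n) :
    addString (a • f) = a • addString f := smul_tensorHom a f _

theorem addString_zero {m n : ℕ} : addString (0 : X d m ⟶ X d n) = 0 := zero_tensorHom _

theorem addString_sub {m n : ℕ} (f g : X d m ⟶ X d n) :
    addString (f - g) = addString f - addString g := by
  rw [sub_eq_add_neg, ← neg_one_smul ℂ g, addString_add, addString_smul, neg_one_smul,
    sub_eq_add_neg]

theorem tensorHom_id_zero {m n : ℕ} (f : X d m ⟶ X d n) : tensorHom f (𝟙 (X d 0)) = f := by
  induction f using diagram_induction with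
  | h0 => exact zero_tensorHom _
  | hadd f g hf hg => rw [add_tensorHom, hf, hg]
  | hD a D => rw [smul_tensorHom, id_eq, ofDiagram_tensor, Diagram.tensor_id_zero]

/-- Since `m + (j + 1)` is definitionally `m + j + 1`, strings can be added on the right one at a
time without an associator. -/
theorem tensorHom_id_succ {m n : ℕ} (f : X d m ⟶ X d n) (j : ℕ) :
    tensorHom f (𝟙 (X d (j + 1))) = addString (tensorHom f (𝟙 (X d j))) := by
  induction f using diagram_induction with
  | h0 => simp only [zero_tensorHom]; rw [addString_zero]
  | hadd f g hf hg => simp only [add_tensorHom, hf, hg]; rw [addString_add]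
  | hD a D =>
    simp only [smul_tensorHom, id_eq]
    rw [addString_smul, ofDiagram_tensor, ofDiagram_tensor, addString_ofDiagram,
      ← Diagram.tensor_id_tensor_id]
    rfl

theorem capLast_eq (k : ℕ) :
    capLast d k = tensorHom (Z := X d k) (Z' := X d 0) (𝟙 (X d k)) (ofDiagram d Diagram.cap) := by
  rw [id_eq, ofDiagram_tensor]
  rfl

theorem cupLast_eq (k : ℕ) :
    cupLast d k = tensorHom (Y := X d k) (Y' := X d 0) (𝟙 (X d k)) (ofDiagram d Diagram.cup) := by
  rw [id_eq, ofDiagram_tensor]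
  rfl

theorem addString_addString {m n : ℕ} (f : X d m ⟶ X d n) :
    addString (addString f) = tensorHom f (𝟙 (X d 2)) := by
  rw [tensorHom_id_succ f 1]
  rfl

/-- Caps on new strings slide past morphisms. -/
theorem addString_addString_capLast {m n : ℕ} (f : X d m ⟶ X d n) :
    addString (addString f) ≫ capLast d n = capLast d m ≫ f := by
  have h : capLast d m ≫ f = tensorHom (Z := X d m) (Z' := X d 0) (𝟙 (X d m))
      (ofDiagram d Diagram.cap) ≫ tensorHom f (𝟙 (X d 0)) := by
    rw [tensorHom_id_zero, capLast_eq]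
  rw [h, addString_addString, capLast_eq, tensorHom_comp, Category.id_comp, Category.comp_id]
  refine Eq.trans ?_ (tensorHom_comp (𝟙 (X d m)) f (ofDiagram d Diagram.cap) (𝟙 (X d 0))).symm
  rw [Category.id_comp]
  exact congrArg _ (Category.comp_id _).symm

theorem hLast_eq (k : ℕ) : hLast d k = capLast d k ≫ cupLast d k := by
  rw [hLast, capLast_eq, cupLast_eq]
  refine Eq.trans ?_ (tensorHom_comp _ _ _ _).symm
  rw [Category.comp_id]

theorem cupLast_capLast (k : ℕ) : cupLast d k ≫ capLast d k = d • 𝟙 (X d k) := by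
  rw [capLast_eq, cupLast_eq]
  refine (tensorHom_comp _ _ _ _).trans ?_
  rw [ofDiagram_comp, Diagram.cap_comp_cup.1, Diagram.cap_comp_cup.2, pow_one, tensorHom_smul,
    Category.comp_id]
  congr 1
  exact tensorHom_id_zero _

theorem addString_cupLast_capLast (k : ℕ) :
    addString (cupLast d k) ≫ capLast d (k + 1) = 𝟙 (X d (k + 1)) := by
  rw [cupLast, capLast, addString_ofDiagram]
  refine (ofDiagram_comp d _ _).trans ?_
  erw [(Diagram.zigzag k).1, (Diagram.zigzag k).2]
  rw [pow_zero, one_smul]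
  rfl

/-- The linear extension of turning diagrams upside down. -/
noncomputable def dagger {Y Z : TL d} : (Y ⟶ Z) →ₗ[ℂ] (Z ⟶ Y) :=
  Finsupp.lmapDomain ℂ ℂ Diagram.flip

theorem dagger_ofDiagram {m n : ℕ} (D : Diagram n m) :
    dagger (ofDiagram d D) = ofDiagram d D.flip :=
  Finsupp.mapDomain_single

theorem dagger_dagger {Y Z : TL d} (f : Y ⟶ Z) : dagger (dagger f) = f := by
  obtain ⟨m⟩ := Y
  obtain ⟨n⟩ := Z
  induction f using diagram_induction with
  | h0 => simp
  | hadd f g hf hg => rw [map_add, map_add, hf, hg]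
  | hD a D => rw [map_smul, map_smul, dagger_ofDiagram, dagger_ofDiagram, Diagram.flip_flip]

theorem dagger_id (n : ℕ) : dagger (𝟙 (X d n)) = 𝟙 (X d n) := by
  rw [id_eq, dagger_ofDiagram, Diagram.flip_id]

theorem dagger_comp {Y Z W : TL d} (f : Y ⟶ Z) (g : Z ⟶ W) :
    dagger (f ≫ g) = dagger g ≫ dagger f := by
  obtain ⟨m⟩ := Y
  obtain ⟨n⟩ := Z
  obtain ⟨p⟩ := W
  induction f using diagram_induction with
  | h0 => simp
  | hadd f₁ f₂ h₁ h₂ => simp [h₁, h₂]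
  | hD a D =>
  induction g using diagram_induction with
  | h0 => simp
  | hadd f₁ f₂ h₁ h₂ => simp only [Preadditive.comp_add, Preadditive.add_comp, map_add, h₁, h₂]
  | hD b E =>
  simp only [Linear.smul_comp, Linear.comp_smul, map_smul, ofDiagram_comp, dagger_ofDiagram,
    (Diagram.flip_comp E D).1, (Diagram.flip_comp E D).2]
  rw [smul_comm]

theorem dagger_addString {m n : ℕ} (f : X d m ⟶ X d n) :
    dagger (addString f) = addString (dagger f) := by
  induction f using diagram_induction with
  | h0 => simp [addString_zero]
  | hadd f g hf hg => rw [addString_add, map_add, map_add, hf, hg, addString_add]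
  | hD a D =>
    rw [addString_smul, map_smul, map_smul, addString_smul, addString_ofDiagram,
      dagger_ofDiagram, dagger_ofDiagram, addString_ofDiagram, Diagram.addString,
      Diagram.flip_tensor, Diagram.flip_id]
    rfl

theorem dagger_capLast (k : ℕ) : dagger (capLast d k) = cupLast d k := by
  rw [capLast, dagger_ofDiagram, Diagram.flip_capLast, cupLast]

theorem dagger_cupLast (k : ℕ) : dagger (cupLast d k) = capLast d k := by
  rw [← dagger_capLast, dagger_dagger]

theorem cupLast_addString_addString {m n : ℕ} (f : X d m ⟶ X d n) :
    cupLast d m ≫ addString (addString f) = f ≫ cupLast d n := by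
  have h := congrArg dagger (addString_addString_capLast (dagger f))
  rwa [dagger_comp, dagger_comp, dagger_addString, dagger_addString, dagger_dagger,
    dagger_capLast, dagger_capLast] at h

theorem cupLast_addString_capLast (k : ℕ) :
    cupLast d (k + 1) ≫ addString (capLast d k) = 𝟙 (X d (k + 1)) := by
  have h := congrArg dagger (addString_cupLast_capLast (d := d) k)
  rwa [dagger_comp, dagger_addString, dagger_capLast, dagger_cupLast, dagger_id] at h

/-- The Markov property of the trace. -/
theorem tr_markov {k : ℕ} (f : X d (k + 1) ⟶ X d (k + 1)) :
    tr (cupLast d k ≫ addString f ≫ capLast d k) = tr f := by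
  induction f using diagram_induction with
  | h0 => rw [addString_zero]; simp
  | hadd f g hf hg =>
    rw [addString_add, Preadditive.add_comp, Preadditive.comp_add, map_add, map_add, hf, hg]
  | hD a D =>
    have h := congrArg (fun k => d ^ k) (Diagram.markov D)
    simp only [pow_add] at h
    rw [addString_smul, Linear.smul_comp, Linear.comp_smul, map_smul, map_smul,
      addString_ofDiagram, ← Category.assoc, cupLast, capLast, ofDiagram_comp, Linear.smul_comp,
      ofDiagram_comp, map_smul, map_smul, tr_ofDiagram, tr_ofDiagram, ← h]
    rfl

theorem tr_id_zero : tr (𝟙 (X d 0)) = 1 := by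
  rw [id_eq, tr_ofDiagram]
  have h := Diagram.trace_mat (Diagram.id 0)
  rw [Diagram.mat_id, Matrix.trace_one] at h
  have : (Diagram.id 0).closureLoops = 0 := by simpa using h.symm
  change d ^ (Diagram.id 0).closureLoops = 1
  rw [this, pow_zero]

instance (Y Z : TL d) : FiniteDimensional ℂ (Y ⟶ Z) :=
  inferInstanceAs (FiniteDimensional ℂ (Diagram Z.strands Y.strands →₀ ℂ))

end TL

/-! ### Quantum integers at a root of unity -/

section qInt

variable {l : ℕ} {q : ℂ}

theorem ne_zero_of_isPrimitiveRoot_sq (hl : 2 ≤ l) (hq : IsPrimitiveRoot (q ^ 2) l) : q ≠ 0 := by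
  rintro rfl
  have := hq.pow_eq_one
  rw [← pow_mul, zero_pow (by omega)] at this
  exact zero_ne_one this

theorem pow_sub_inv_pow (hq0 : q ≠ 0) (k : ℕ) : q ^ k - q⁻¹ ^ k = ((q ^ 2) ^ k - 1) / q ^ k := by
  rw [inv_pow, ← pow_mul, mul_comm, pow_mul]
  have : q ^ k ≠ 0 := pow_ne_zero _ hq0
  field_simp

/-- Up to a power of `q`, `q ^ j - q⁻¹ ^ j` is `(q ^ 2) ^ j - 1`, whose vanishing is governed by
primitivity. The case `j = 1` is the denominator and uses `2 ≤ l`. -/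
theorem qInt_ne_zero (hl : 2 ≤ l) (hq : IsPrimitiveRoot (q ^ 2) l) {k : ℕ} (hk : 0 < k)
    (hkl : k < l) : qInt q k ≠ 0 := by
  have hq0 := ne_zero_of_isPrimitiveRoot_sq hl hq
  have h : ∀ j, 0 < j → j < l → q ^ j - q⁻¹ ^ j ≠ 0 := by
    intro j hj hjl
    rw [pow_sub_inv_pow hq0]
    exact div_ne_zero (sub_ne_zero.2 (hq.pow_ne_one_of_pos_of_lt hj.ne' hjl)) (pow_ne_zero _ hq0)
  have h1 := h 1 one_pos (by omega)
  rw [pow_one, pow_one] at h1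
  exact div_ne_zero (h k hk hkl) h1

theorem qInt_self (hl : 2 ≤ l) (hq : IsPrimitiveRoot (q ^ 2) l) : qInt q l = 0 := by
  rw [qInt, pow_sub_inv_pow (ne_zero_of_isPrimitiveRoot_sq hl hq), hq.pow_eq_one]
  simp

theorem qInt_one (h : q - q⁻¹ ≠ 0) : qInt q 1 = 1 := by
  rw [qInt, pow_one, pow_one, div_self h]

theorem mul_qInt (hq0 : q ≠ 0) (k : ℕ) :
    (q + q⁻¹) * qInt q (k + 1) = qInt q (k + 2) + qInt q k := by
  simp only [qInt, ← add_div, mul_div_assoc']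
  congr 1
  have : q * q⁻¹ = 1 := mul_inv_cancel₀ hq0
  linear_combination (q ^ k - q⁻¹ ^ k) * this

end qInt

open TL

/-! ### Wenzl's recursion -/

section JonesWenzl

variable {d q : ℂ}

theorem jonesWenzl_succ_succ (k : ℕ) :
    jonesWenzl d q (k + 2) = addString (jonesWenzl d q (k + 1)) -
      (qInt q (k + 1) / qInt q (k + 2)) • (addString (jonesWenzl d q (k + 1)) ≫
        capLast d k ≫ cupLast d k ≫ addString (jonesWenzl d q (k + 1))) := by
  rw [jonesWenzl]
  rw [hLast_eq, Category.assoc]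
  rfl

/-- The recursion is symmetric under reflection. Hence every one-sided identity for these elements
gives its mirror image by applying `dagger`. -/
theorem dagger_jonesWenzl (k : ℕ) : dagger (jonesWenzl d q k) = jonesWenzl d q k := by
  induction k using Nat.strong_induction_on with
  | _ k ih =>
  match k with
  | 0 => exact dagger_id 0
  | 1 => exact dagger_id 1
  | k + 2 =>
    simp only [jonesWenzl_succ_succ, map_sub, map_smul, dagger_comp, dagger_addString,
      dagger_capLast, dagger_cupLast, ih (k + 1) (by omega), Category.assoc]

/-- The Jones–Wenzl elements are idempotents, absorb their predecessors, and have the expected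
partial traces. -/
theorem jonesWenzl_properties (hq0 : q ≠ 0) (hd : d = q + q⁻¹) (k : ℕ)
    (h : ∀ j, 0 < j → j ≤ k + 1 → qInt q j ≠ 0) :
    jonesWenzl d q (k + 1) ≫ jonesWenzl d q (k + 1) = jonesWenzl d q (k + 1) ∧
    addString (jonesWenzl d q k) ≫ jonesWenzl d q (k + 1) = jonesWenzl d q (k + 1) ∧
    cupLast d k ≫ addString (jonesWenzl d q (k + 1)) ≫ capLast d k =
      (qInt q (k + 2) / qInt q (k + 1)) • jonesWenzl d q k := by
  induction k with
  | zero =>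
    have h1 : q - q⁻¹ ≠ 0 := fun e => h 1 one_pos le_rfl (by rw [qInt, e, div_zero])
    have h2 : qInt q 2 = d := by
      have := mul_qInt hq0 0
      rw [qInt_one h1, mul_one, ← hd, show qInt q 0 = 0 by simp [qInt], add_zero] at this
      exact this.symm
    refine ⟨Category.comp_id _, ?_, ?_⟩
    · change addString (𝟙 (X d 0)) ≫ 𝟙 (X d 1) = 𝟙 (X d 1)
      rw [Category.comp_id, addString_id]
    · change cupLast d 0 ≫ addString (𝟙 (X d 1)) ≫ capLast d 0 = _ • 𝟙 (X d 0)
      rw [addString_id, Category.id_comp, cupLast_capLast, zero_add, zero_add, qInt_one h1, h2,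
        div_one]
  | succ k ih =>
    obtain ⟨ia, ib, ic⟩ := ih fun j hj hj' => h j hj (by omega)
    have hk1 := h (k + 1) (by omega) (by omega)
    have hk2 := h (k + 2) (by omega) (by omega)
    set F := jonesWenzl d q (k + 1)
    set F' := jonesWenzl d q (k + 2) with hF'
    set μ : ℂ := qInt q (k + 1) / qInt q (k + 2) with hμ
    have ib' : F ≫ addString (jonesWenzl d q k) = F := by
      have := congrArg dagger ib
      rwa [dagger_comp, dagger_addString, dagger_jonesWenzl, dagger_jonesWenzl] at this
    have e : F' = addString F - μ • (addString F ≫ capLast d k ≫ cupLast d k ≫ addString F) :=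
      jonesWenzl_succ_succ k
    have gg : addString F ≫ addString F = addString F := by rw [← addString_comp, ia]
    have gg' : ∀ {Y : TL d} (u : X d (k + 2) ⟶ Y), addString F ≫ addString F ≫ u =
        addString F ≫ u := fun u => by rw [← Category.assoc, gg]
    -- By `ic` the correction term produces `f_k` times `[k+2]/[k+1]`, the inverse of `μ`. Sliding
    -- `f_k` through the cap and absorbing it into `F` makes the two terms equal.
    have hcap : F' ≫ capLast d k = 0 := by
      rw [e, Preadditive.sub_comp, Linear.smul_comp]
      simp only [Category.assoc]
      rw [ic, Linear.comp_smul, Linear.comp_smul, smul_smul,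
        ← addString_addString_capLast, ← Category.assoc (addString F), ← addString_comp, ib', hμ,
        div_mul_div_comm, mul_comm, div_self (mul_ne_zero hk2 hk1), one_smul, sub_self]
    have habs : addString F ≫ F' = F' := by
      rw [e, Preadditive.comp_sub, Linear.comp_smul, gg', gg]
    have hF'g : F' ≫ addString F = F' := by
      rw [e, Preadditive.sub_comp, Linear.smul_comp]
      simp only [Category.assoc, gg]
    refine ⟨?_, habs, ?_⟩
    -- Only the second factor is expanded: its correction term begins with `addString F` followed by
    -- the cap, and dies by `hF'g` and `hcap`.
    · have : F' ≫ F' = F' ≫ addString F - μ • ((F' ≫ addString F) ≫ capLast d k ≫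
          cupLast d k ≫ addString F) := by
        conv_lhs => rw [e]
        rw [Preadditive.comp_sub, Linear.comp_smul, Category.assoc, ← e]
      rw [this, hF'g, ← Category.assoc, hcap, Limits.zero_comp, smul_zero, sub_zero]
    -- The leading term closes to a free loop beside `F`. In the correction term two zigzags
    -- straighten, leaving `F ≫ F`. The resulting factor `d - μ` equals `[k+3]/[k+2]` by `mul_qInt`.
    · have h1 : cupLast d (k + 1) ≫ addString (addString F) ≫ capLast d (k + 1) = d • F := by
        rw [addString_addString_capLast, ← Category.assoc, cupLast_capLast, Linear.smul_comp,
          Category.id_comp]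
      have h2 : cupLast d (k + 1) ≫ addString (addString F ≫ capLast d k ≫ cupLast d k ≫
          addString F) ≫ capLast d (k + 1) = F := by
        simp only [addString_comp, Category.assoc]
        rw [addString_addString_capLast, ← Category.assoc (cupLast d (k + 1)),
          cupLast_addString_addString]
        simp only [Category.assoc]
        rw [← Category.assoc (addString (cupLast d k)), addString_cupLast_capLast,
          Category.id_comp, ← Category.assoc (cupLast d (k + 1)), cupLast_addString_capLast,
          Category.id_comp, ia]
      rw [e, addString_sub, addString_smul, Preadditive.sub_comp, Preadditive.comp_sub,
        Linear.smul_comp, Linear.comp_smul, h1, h2, ← sub_smul, hμ, hd]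
      congr 1
      have := mul_qInt hq0 (k + 1)
      rw [sub_eq_iff_eq_add, ← add_div, eq_div_iff hk2]
      exact this

end JonesWenzl

/-! ### Schur's lemma and traces at a root of unity -/

section Root

variable {d q : ℂ} {l : ℕ}

/-- The parameters of the Temperley–Lieb category at a root of unity. -/
structure IsRootParameter (d q : ℂ) (l : ℕ) : Prop where
  two_le : 2 ≤ l
  eq_add_inv : d = q + q⁻¹
  isPrimitiveRoot : IsPrimitiveRoot (q ^ 2) l

namespace IsRootParameter

theorem qInt_ne_zero (h : IsRootParameter d q l) {k : ℕ} (hk : 0 < k) (hkl : k < l) :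
    qInt q k ≠ 0 :=
  TemperleyLieb.qInt_ne_zero h.two_le h.isPrimitiveRoot hk hkl

theorem properties (h : IsRootParameter d q l) {k : ℕ} (hk : k + 1 < l) :
    jonesWenzl d q (k + 1) ≫ jonesWenzl d q (k + 1) = jonesWenzl d q (k + 1) ∧
    addString (jonesWenzl d q k) ≫ jonesWenzl d q (k + 1) = jonesWenzl d q (k + 1) ∧
    cupLast d k ≫ addString (jonesWenzl d q (k + 1)) ≫ capLast d k =
      (qInt q (k + 2) / qInt q (k + 1)) • jonesWenzl d q k :=
  jonesWenzl_properties (ne_zero_of_isPrimitiveRoot_sq h.two_le h.isPrimitiveRoot) h.eq_add_inv k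
    fun _ hj hjk => h.qInt_ne_zero hj (by omega)

theorem qInt_one (h : IsRootParameter d q l) : qInt q 1 = 1 :=
  TemperleyLieb.qInt_one fun e => h.qInt_ne_zero one_pos
    (by have := h.two_le; omega) (by rw [qInt, e, div_zero])

theorem idem (h : IsRootParameter d q l) {k : ℕ} (hk : k < l) :
    jonesWenzl d q k ≫ jonesWenzl d q k = jonesWenzl d q k := by
  cases k with
  | zero => exact Category.comp_id _
  | succ k => exact (h.properties hk).1

theorem addString_comp_succ (h : IsRootParameter d q l) {k : ℕ} (hk : k + 1 < l) :
    addString (jonesWenzl d q k) ≫ jonesWenzl d q (k + 1) = jonesWenzl d q (k + 1) :=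
  (h.properties hk).2.1

theorem succ_comp_addString (h : IsRootParameter d q l) {k : ℕ} (hk : k + 1 < l) :
    jonesWenzl d q (k + 1) ≫ addString (jonesWenzl d q k) = jonesWenzl d q (k + 1) := by
  have := congrArg dagger (h.addString_comp_succ hk)
  rwa [dagger_comp, dagger_addString, dagger_jonesWenzl, dagger_jonesWenzl] at this

theorem partialTrace (h : IsRootParameter d q l) {k : ℕ} (hk : k + 1 < l) :
    cupLast d k ≫ addString (jonesWenzl d q (k + 1)) ≫ capLast d k =
      (qInt q (k + 2) / qInt q (k + 1)) • jonesWenzl d q k :=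
  (h.properties hk).2.2

theorem comp_capLast (h : IsRootParameter d q l) {k : ℕ} (hk : k + 2 < l) :
    jonesWenzl d q (k + 2) ≫ capLast d k = 0 := by
  have hk1 := h.qInt_ne_zero (k := k + 1) (by omega) (by omega)
  have hk2 := h.qInt_ne_zero (k := k + 2) (by omega) (by omega)
  rw [jonesWenzl_succ_succ, Preadditive.sub_comp, Linear.smul_comp]
  simp only [Category.assoc]
  rw [h.partialTrace (by omega), Linear.comp_smul, Linear.comp_smul, smul_smul,
    ← addString_addString_capLast, ← Category.assoc (addString _), ← addString_comp,
    h.succ_comp_addString (by omega), div_mul_div_comm, mul_comm, div_self (mul_ne_zero hk2 hk1),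
    one_smul, sub_self]

/-- Absorption `f_{n+1} ≫ (f_n ⊗ 1) = f_{n+1}` lets strings to the right of the cap be removed one
by one, until the cap is the last one. -/
theorem comp_capAt (h : IsRootParameter d q l) (i j : ℕ) (hij : i + 2 + j < l) :
    jonesWenzl d q (i + 2 + j) ≫ ofDiagram d (Diagram.capAt i j) = 0 := by
  induction j with
  | zero =>
    have : Diagram.capAt i 0 = Diagram.capLast i := Diagram.tensor_id_zero _
    rw [this]
    exact h.comp_capLast hij
  | succ j ih =>
    have h1 : Diagram.capAt i (j + 1) = (Diagram.capAt i j).addString :=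
      (Diagram.tensor_id_tensor_id _ j).symm
    rw [h1]
    have h2 := congrArg (· ≫ ofDiagram d (Diagram.capAt i j).addString)
      (h.succ_comp_addString (k := i + 2 + j) hij)
    refine h2.symm.trans ?_
    rw [Category.assoc, ← addString_ofDiagram, ← addString_comp, ih (by omega), addString_zero,
      Limits.comp_zero]

theorem comp_ofDiagram_eq_zero (h : IsRootParameter d q l) {m n : ℕ} (hn : n < l)
    (D : Diagram m n) (hD : ∃ i j, D.arc (.inr i) = .inr j) :
    jonesWenzl d q n ≫ ofDiagram d D = 0 := by
  obtain ⟨i, j, rfl, E, h0, hE⟩ := D.eq_comp_capAt_of_arc hD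
  have hE' : E.comp (Diagram.capAt i j) = D := hE
  have := ofDiagram_comp d (Diagram.capAt i j) E
  rw [h0, hE', pow_zero, one_smul] at this
  rw [← this, ← Category.assoc]
  exact (congrArg (· ≫ ofDiagram d E) (h.comp_capAt i j hn)).trans Limits.zero_comp

theorem ofDiagram_comp_eq_zero (h : IsRootParameter d q l) {m n : ℕ} (hm : m < l)
    (D : Diagram m n) (hD : ∃ i j, D.flip.arc (.inr i) = .inr j) :
    ofDiagram d D ≫ jonesWenzl d q m = 0 := by
  have := congrArg dagger (h.comp_ofDiagram_eq_zero hm D.flip hD)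
  rwa [dagger_comp, dagger_jonesWenzl, dagger_ofDiagram, Diagram.flip_flip, map_zero] at this

/-- A diagram between different numbers of points must turn back at the bottom or at the top, where
`f_j` or `f_k` kills it. -/
theorem sandwich_ne (h : IsRootParameter d q l) {j k : ℕ} (hj : j < l) (hk : k < l) (hjk : j ≠ k)
    (f : X d j ⟶ X d k) : jonesWenzl d q j ≫ f ≫ jonesWenzl d q k = 0 := by
  induction f using diagram_induction with
  | h0 => simp
  | hadd f g hf hg => rw [Preadditive.add_comp, Preadditive.comp_add, hf, hg, add_zero]
  | hD a D =>
    rw [Linear.smul_comp, Linear.comp_smul]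
    by_cases h1 : ∃ i j, D.arc (.inr i) = .inr j
    · rw [← Category.assoc, h.comp_ofDiagram_eq_zero hj D h1, Limits.zero_comp, smul_zero]
    by_cases h2 : ∃ i j, D.flip.arc (.inr i) = .inr j
    · rw [h.ofDiagram_comp_eq_zero hk D h2, Limits.comp_zero, smul_zero]
    push Not at h1 h2
    exact absurd (D.eq_of_flip_arc h1 h2).1.symm hjk

/-- Schur's lemma before passing to the quotient: every diagram except the identity turns back and
is killed, so only the identity diagram contributes to the scalar. -/
theorem exists_sandwich_eq (h : IsRootParameter d q l) {k : ℕ} (hk : k < l)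
    (f : X d k ⟶ X d k) :
    ∃ c : ℂ, jonesWenzl d q k ≫ f ≫ jonesWenzl d q k = c • jonesWenzl d q k := by
  induction f using diagram_induction with
  | h0 => exact ⟨0, by simp⟩
  | hadd f g hf hg =>
    obtain ⟨a, hf⟩ := hf
    obtain ⟨b, hg⟩ := hg
    exact ⟨a + b, by rw [Preadditive.add_comp, Preadditive.comp_add, hf, hg, add_smul]⟩
  | hD a D =>
    rw [Linear.smul_comp, Linear.comp_smul]
    by_cases h1 : ∃ i j, D.arc (.inr i) = .inr j
    · exact ⟨0, by
        rw [← Category.assoc, h.comp_ofDiagram_eq_zero hk D h1, Limits.zero_comp, smul_zero,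
          zero_smul]⟩
    by_cases h2 : ∃ i j, D.flip.arc (.inr i) = .inr j
    · exact ⟨0, by rw [h.ofDiagram_comp_eq_zero hk D h2, Limits.comp_zero, smul_zero, zero_smul]⟩
    push Not at h1 h2
    have hD : D = Diagram.id k := eq_of_heq (D.eq_of_flip_arc h1 h2).2
    refine ⟨a, ?_⟩
    rw [hD]
    congr 1
    exact (congrArg _ (Category.id_comp _)).trans (h.idem hk)

/-- By the Markov property the trace of `f_{k+1}` is that of its partial trace, and the ratios
`[k+2]/[k+1]` telescope. -/
theorem tr_jonesWenzl (h : IsRootParameter d q l) {k : ℕ} (hk : k < l) :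
    tr (jonesWenzl d q k) = qInt q (k + 1) := by
  induction k with
  | zero =>
    rw [zero_add, h.qInt_one]
    exact tr_id_zero
  | succ k ih =>
    have hk1 := h.qInt_ne_zero (k := k + 1) (by omega) (by omega)
    rw [← tr_markov, h.partialTrace hk, map_smul, ih (by omega), smul_eq_mul,
      div_mul_cancel₀ _ hk1]

theorem tr_jonesWenzl_ne_zero (h : IsRootParameter d q l) {k : ℕ} (hk : k < l - 1) :
    tr (jonesWenzl d q k) ≠ 0 := by
  rw [h.tr_jonesWenzl (by omega)]
  exact h.qInt_ne_zero (by omega) (by omega)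

end IsRootParameter

end Root

/-! ### Factoring identities through Jones–Wenzl elements -/

section Ideal

variable {d q : ℂ} {l : ℕ}

namespace TL

/-- The span of the endomorphisms of `X^{⊗ n}` factoring through `X^{⊗ r}`. -/
noncomputable def through (d : ℂ) (n r : ℕ) : Submodule ℂ (X d n ⟶ X d n) :=
  Submodule.span ℂ {f | ∃ (a : X d n ⟶ X d r) (b : X d r ⟶ X d n), f = a ≫ b}

theorem addString_mem_through {n r : ℕ} {f : X d n ⟶ X d n} (hf : f ∈ through d n r) :
    addString f ∈ through d (n + 1) (r + 1) := by
  induction hf using Submodule.span_induction with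
  | mem f hf =>
    obtain ⟨a, b, rfl⟩ := hf
    exact Submodule.subset_span ⟨addString a, addString b, addString_comp a b⟩
  | zero => rw [addString_zero]; exact zero_mem _
  | add f g _ _ hf hg => rw [addString_add]; exact add_mem hf hg
  | smul a f _ hf => rw [addString_smul]; exact Submodule.smul_mem _ _ hf

theorem tensorHom_id_mem_through {n r : ℕ} {f : X d n ⟶ X d n} (hf : f ∈ through d n r) (j : ℕ) :
    tensorHom f (𝟙 (X d j)) ∈ through d (n + j) (r + j) := by
  induction j with
  | zero => rw [tensorHom_id_zero]; exact hf
  | succ j ih => rw [tensorHom_id_succ]; exact addString_mem_through ih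

/-- The coefficient `φ` of the identity diagram vanishes on every composite through fewer strings,
by `comp_ne_id`. -/
theorem id_notMem_through {n r : ℕ} (hr : r < n) : 𝟙 (X d n) ∉ through d n r := by
  intro hmem
  let φ : (X d n ⟶ X d n) →ₗ[ℂ] ℂ := Finsupp.lapply (Diagram.id n)
  have hφ : ∀ D : Diagram n n, D ≠ Diagram.id n → φ (ofDiagram d D) = 0 := fun D hD =>
    Finsupp.single_eq_of_ne' hD
  have h1 : through d n r ≤ LinearMap.ker φ := by
    refine Submodule.span_le.2 ?_
    rintro _ ⟨a, b, rfl⟩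
    rw [SetLike.mem_coe, LinearMap.mem_ker]
    induction a using diagram_induction with
    | h0 => simp
    | hadd a a' ha ha' => rw [Preadditive.add_comp, map_add, ha, ha', add_zero]
    | hD x D =>
    induction b using diagram_induction with
    | h0 => simp
    | hadd b b' hb hb' => rw [Preadditive.comp_add, map_add, hb, hb', add_zero]
    | hD y E =>
    rw [Linear.smul_comp, Linear.comp_smul, ofDiagram_comp, map_smul, map_smul, map_smul,
      hφ _ (Diagram.comp_ne_id hr E D), smul_zero, smul_zero, smul_zero]
  have h2 : φ (𝟙 (X d n)) = 0 := h1 hmem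
  have h3 : φ (𝟙 (X d n)) = 1 := Finsupp.single_eq_same
  exact one_ne_zero (h3.symm.trans h2)

end TL

/-- The span of the morphisms factoring through the Jones–Wenzl elements `f_k`, `k < r`. -/
noncomputable def jonesWenzlSpan (d q : ℂ) (r : ℕ) (Y Z : TL d) : Submodule ℂ (Y ⟶ Z) :=
  Submodule.span ℂ {f | ∃ k < r, ∃ (a : Y ⟶ X d k) (b : X d k ⟶ Z),
    f = a ≫ jonesWenzl d q k ≫ b}

theorem jonesWenzlSpan_mono {r s : ℕ} (h : r ≤ s) (Y Z : TL d) :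
    jonesWenzlSpan d q r Y Z ≤ jonesWenzlSpan d q s Y Z :=
  Submodule.span_mono fun _ ⟨k, hk, hf⟩ => ⟨k, hk.trans_le h, hf⟩

theorem comp_mem_jonesWenzlSpan {r : ℕ} {Y Y' Z Z' : TL d} (a : Y ⟶ Y') {f : Y' ⟶ Z'}
    (hf : f ∈ jonesWenzlSpan d q r Y' Z') (b : Z' ⟶ Z) :
    a ≫ f ≫ b ∈ jonesWenzlSpan d q r Y Z := by
  induction hf using Submodule.span_induction with
  | mem f hf =>
    obtain ⟨k, hk, a', b', rfl⟩ := hf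
    exact Submodule.subset_span ⟨k, hk, a ≫ a', b' ≫ b, by simp only [Category.assoc]⟩
  | zero => simp
  | add f g _ _ hf hg => rw [Preadditive.add_comp, Preadditive.comp_add]; exact add_mem hf hg
  | smul c f _ hf => rw [Linear.smul_comp, Linear.comp_smul]; exact Submodule.smul_mem _ _ hf

theorem through_le_jonesWenzlSpan {n r s : ℕ} (h : 𝟙 (X d r) ∈ jonesWenzlSpan d q s _ _) :
    through d n r ≤ jonesWenzlSpan d q s (X d n) (X d n) := by
  refine Submodule.span_le.2 ?_
  rintro _ ⟨a, b, rfl⟩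
  have := comp_mem_jonesWenzlSpan a h b
  rwa [Category.id_comp] at this

/-- Telescoping: `f_{k+1} ⊗ 1 - f_{k+2}` is the correction term of the recursion, which passes
through `k` strings between its cap and its cup. The coefficient enters only as a scalar, so no
quantum integer has to be nonzero. -/
theorem id_sub_jonesWenzl_mem_through (k : ℕ) :
    𝟙 (X d (k + 2)) - jonesWenzl d q (k + 2) ∈ through d (k + 2) k := by
  have h : ∀ k, addString (jonesWenzl d q (k + 1)) - jonesWenzl d q (k + 2) ∈
      through d (k + 2) k := fun k => by
    rw [jonesWenzl_succ_succ, sub_sub_cancel, ← Category.assoc (addString _)]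
    exact Submodule.smul_mem _ _ (Submodule.subset_span ⟨_, _, rfl⟩)
  induction k with
  | zero =>
    have h0 := h 0
    change addString (𝟙 (X d 1)) - _ ∈ _ at h0
    rwa [addString_id] at h0
  | succ k ih =>
    have := add_mem (addString_mem_through ih) (h (k + 1))
    rwa [addString_sub, addString_id, sub_add_sub_cancel] at this

/-- Write `1 = f_n + (1 - f_n)`; the second term factors through `n - 2` strings, where the claim
holds by induction. -/
theorem id_mem_jonesWenzlSpan (n : ℕ) : 𝟙 (X d n) ∈ jonesWenzlSpan d q (n + 1) _ _ := by
  induction n using Nat.strong_induction_on with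
  | _ n ih =>
  have hF : jonesWenzl d q n ∈ jonesWenzlSpan d q (n + 1) _ _ :=
    Submodule.subset_span ⟨n, by omega, 𝟙 _, 𝟙 _, by simp⟩
  match n with
  | 0 => exact hF
  | 1 => exact hF
  | n + 2 =>
    have h1 := jonesWenzlSpan_mono (by omega : n + 1 ≤ n + 2 + 1) _ _
      (through_le_jonesWenzlSpan (ih n (by omega)) (id_sub_jonesWenzl_mem_through (q := q) n))
    have := add_mem h1 hF
    rwa [sub_add_cancel] at this

theorem id_sub_jonesWenzl_mem_jonesWenzlSpan (n : ℕ) :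
    𝟙 (X d n) - jonesWenzl d q n ∈ jonesWenzlSpan d q n _ _ := by
  match n with
  | 0 => rw [jonesWenzl, sub_self]; exact zero_mem _
  | 1 => rw [jonesWenzl, sub_self]; exact zero_mem _
  | n + 2 =>
    exact jonesWenzlSpan_mono (by omega) _ _ (through_le_jonesWenzlSpan (id_mem_jonesWenzlSpan n)
      (id_sub_jonesWenzl_mem_through n))

/-- Monoidal ideals are stable under two-sided tensoring. To tensor on the right only, the left
factor is the empty diagram, and `0 + m` has to be transported to `m`. -/
theorem exists_eq_id_zero_tensorHom {m n : ℕ} (f : X d m ⟶ X d n) :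
    f = eqToHom (by simp) ≫ tensorHom (𝟙 (X d 0)) f ≫ eqToHom (by simp) := by
  have key : ∀ {m n m' n' : ℕ} (hm : m = m') (hn : n = n') (D : Diagram n m) (E : Diagram n' m'),
      HEq D E → ofDiagram d D = eqToHom (by rw [hm]) ≫ ofDiagram d E ≫ eqToHom (by rw [hn]) := by
    rintro m n _ _ rfl rfl D E h
    obtain rfl := eq_of_heq h
    simp
  induction f using diagram_induction with
  | h0 => simp [tensorHom_zero]
  | hadd f g hf hg =>
    rw [tensorHom_add, Preadditive.add_comp, Preadditive.comp_add, ← hf, ← hg]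
  | hD a D =>
    rw [tensorHom_smul, Linear.smul_comp, Linear.comp_smul, TL.id_eq, ofDiagram_tensor]
    congr 1
    exact key (Nat.zero_add _).symm (Nat.zero_add _).symm _ _ D.id_zero_tensor_heq

theorem TL.IsMonoidalIdeal.tensorHom_id_mem {J : ∀ Y Z : TL d, Submodule ℂ (Y ⟶ Z)}
    (hJ : IsMonoidalIdeal J) {m n : ℕ} {f : X d m ⟶ X d n} (hf : f ∈ J _ _) (j : ℕ) :
    tensorHom f (𝟙 (X d j)) ∈ J _ _ := by
  have h1 := hJ.comp_mem
    (tensorHom (eqToHom (by simp) : X d m ⟶ tensorObj (X d 0) (X d m)) (𝟙 (X d j))) _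
    (tensorHom (eqToHom (by simp) : tensorObj (X d 0) (X d n) ⟶ X d n) (𝟙 (X d j)))
    (hJ.tensor_mem (𝟙 (X d 0)) f (𝟙 (X d j)) hf)
  rw [tensorHom_comp, tensorHom_comp, ← exists_eq_id_zero_tensorHom f, Category.comp_id,
    Category.comp_id] at h1
  exact h1

/-! ### The trace kernel and the ideal generated by the last Jones–Wenzl element -/

namespace IsRootParameter

/-- By idempotence and cyclicity, `tr (f ≫ g) = tr (f ≫ g ≫ f)`. This is a multiple of `tr f_{l-1} =
[l] = 0`. -/
theorem jonesWenzl_mem_ker (h : IsRootParameter d q l) :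
    jonesWenzl d q (l - 1) ∈ ker (X d (l - 1)) (X d (l - 1)) := by
  have hl := h.two_le
  intro g
  have hi := h.idem (k := l - 1) (by omega)
  obtain ⟨c, hc⟩ := h.exists_sandwich_eq (k := l - 1) (by omega) g
  rw [← hi, Category.assoc, tr_comp_comm, Category.assoc, hc, map_smul,
    h.tr_jonesWenzl (by omega), Nat.sub_add_cancel (by omega),
    qInt_self h.two_le h.isPrimitiveRoot, smul_zero]

/-- For `j = k` the sandwich is `c • f_k` and still lies in the kernel. So its trace `c * [k+1]`
vanishes, and `[k+1] ≠ 0` forces `c = 0`. -/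
theorem sandwich_ker (h : IsRootParameter d q l) {j k : ℕ} (hj : j < l - 1) (hk : k < l - 1)
    {f : X d j ⟶ X d k} (hf : f ∈ ker _ _) : jonesWenzl d q j ≫ f ≫ jonesWenzl d q k = 0 := by
  by_cases hjk : j = k
  · subst hjk
    obtain ⟨c, hc⟩ := h.exists_sandwich_eq (k := j) (by omega) f
    have h1 : jonesWenzl d q j ≫ f ≫ jonesWenzl d q j ∈ ker _ _ := comp_ker _ (ker_comp hf _)
    have h2 := h1 (𝟙 _)
    rw [Category.comp_id, hc, map_smul, smul_eq_mul] at h2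
    rw [hc, (mul_eq_zero.1 h2).resolve_right (h.tr_jonesWenzl_ne_zero hj), zero_smul]
  · exact h.sandwich_ne (by omega) (by omega) hjk f

theorem jonesWenzlSpan_comp_ker_comp (h : IsRootParameter d q l) {Y Z : TL d} {f : Y ⟶ Z}
    (hf : f ∈ ker Y Z) {x : Y ⟶ Y} (hx : x ∈ jonesWenzlSpan d q (l - 1) Y Y) {y : Z ⟶ Z}
    (hy : y ∈ jonesWenzlSpan d q (l - 1) Z Z) : x ≫ f ≫ y = 0 := by
  induction hx using Submodule.span_induction with
  | zero => simp
  | add x x' _ _ hx hx' => rw [Preadditive.add_comp, hx, hx', add_zero]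
  | smul c x _ hx => rw [Linear.smul_comp, hx, smul_zero]
  | mem x hx =>
  induction hy using Submodule.span_induction with
  | zero => simp
  | add y y' _ _ hy hy' => rw [Preadditive.comp_add, Preadditive.comp_add, hy, hy', add_zero]
  | smul c y _ hy => rw [Linear.comp_smul, Linear.comp_smul, hy, smul_zero]
  | mem y hy =>
  obtain ⟨j, hj, a, b, rfl⟩ := hx
  obtain ⟨k, hk, a', b', rfl⟩ := hy
  have := h.sandwich_ker hj hk (ker_comp (comp_ker b hf) a')
  simp only [Category.assoc] at this ⊢
  have := congrArg (fun g => a ≫ g ≫ b') this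
  simpa only [Category.assoc, Limits.zero_comp, Limits.comp_zero] using this

theorem jonesWenzl_comp_jonesWenzlSpan (h : IsRootParameter d q l) {k r : ℕ} (hk : k < l)
    (hr : r ≤ k) {Z : TL d} {x : X d k ⟶ Z}
    (hx : x ∈ jonesWenzlSpan d q r (X d k) Z) : jonesWenzl d q k ≫ x = 0 := by
  induction hx using Submodule.span_induction with
  | zero => simp
  | add x x' _ _ hx hx' => rw [Preadditive.comp_add, hx, hx', add_zero]
  | smul c x _ hx => rw [Linear.comp_smul, hx, smul_zero]
  | mem x hx =>
  obtain ⟨j, hj, a, b, rfl⟩ := hx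
  have := congrArg (· ≫ b) (h.sandwich_ne hk (by omega : j < l) (by omega) a)
  simpa only [Category.assoc, Limits.zero_comp] using this

theorem jonesWenzlSpan_comp_jonesWenzl (h : IsRootParameter d q l) {k r : ℕ} (hk : k < l)
    (hr : r ≤ k) {Z : TL d} {x : Z ⟶ X d k}
    (hx : x ∈ jonesWenzlSpan d q r Z (X d k)) : x ≫ jonesWenzl d q k = 0 := by
  induction hx using Submodule.span_induction with
  | zero => simp
  | add x x' _ _ hx hx' => rw [Preadditive.add_comp, hx, hx', add_zero]
  | smul c x _ hx => rw [Linear.smul_comp, hx, smul_zero]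
  | mem x hx =>
  obtain ⟨j, hj, a, b, rfl⟩ := hx
  have := congrArg (a ≫ ·) (h.sandwich_ne (by omega : j < l) hk (by omega) b)
  simpa only [Category.assoc, Limits.comp_zero] using this

/-- Here the identity itself is a sum of morphisms through `f_j`, `j < l - 1`, and a kernel element
sandwiched between such sums is zero. -/
theorem ker_eq_bot (h : IsRootParameter d q l) {k : ℕ} (hk : k < l - 1) :
    ker (X d k) (X d k) = ⊥ := by
  refine (Submodule.eq_bot_iff _).2 fun f hf => ?_
  have hid := jonesWenzlSpan_mono (by omega : k + 1 ≤ l - 1) _ _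
    (id_mem_jonesWenzlSpan (d := d) (q := q) k)
  have := h.jonesWenzlSpan_comp_ker_comp hf hid hid
  rwa [Category.comp_id, Category.id_comp] at this

/-- Peirce decomposition with respect to `p = f_{l-1}`. The complement `1 - p` factors through
`f_j`, `j < l - 1`, so the corner of `f` at `1 - p` vanishes because `f` is in the kernel. The mixed
corners vanish by orthogonality, and the corner at `p` is a scalar by Schur's lemma. -/
theorem ker_eq_span (h : IsRootParameter d q l) :
    ker (X d (l - 1)) (X d (l - 1)) = Submodule.span ℂ {jonesWenzl d q (l - 1)} := by
  have hl := h.two_le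
  refine le_antisymm (fun f hf => ?_) ?_
  · obtain ⟨c, hc⟩ := h.exists_sandwich_eq (k := l - 1) (by omega) f
    have hx := id_sub_jonesWenzl_mem_jonesWenzlSpan (d := d) (q := q) (l - 1)
    have h1 := h.jonesWenzlSpan_comp_ker_comp hf hx hx
    have h2 := h.jonesWenzl_comp_jonesWenzlSpan (k := l - 1) (by omega) le_rfl
      (comp_mem_jonesWenzlSpan f hx (𝟙 _))
    have h3 := h.jonesWenzlSpan_comp_jonesWenzl (k := l - 1) (by omega) le_rfl
      (comp_mem_jonesWenzlSpan (𝟙 _) hx f)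
    simp only [Preadditive.sub_comp, Preadditive.comp_sub, Category.id_comp, Category.comp_id,
      Category.assoc] at h1 h2 h3
    rw [sub_eq_zero] at h2 h3
    rw [Submodule.mem_span_singleton]
    refine ⟨c, hc.symm.trans ?_⟩
    generalize jonesWenzl d q (l - 1) ≫ f ≫ jonesWenzl d q (l - 1) = g at h1 h2 h3
    rw [h2, h3, sub_self, sub_zero, sub_eq_zero] at h1
    exact h1.symm
  · rw [Submodule.span_singleton_le_iff_mem]
    exact h.jonesWenzl_mem_ker

/-- Otherwise the identity of `X^{⊗ (l-1)}` would factor through fewer strings. -/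
theorem jonesWenzl_ne_zero (h : IsRootParameter d q l) : jonesWenzl d q (l - 1) ≠ 0 := by
  have hl := h.two_le
  intro h0
  obtain ⟨m, hm⟩ : ∃ m, m = l - 1 := ⟨_, rfl⟩
  rw [← hm] at h0
  match m, hm with
  | 0, hm => omega
  | 1, hm =>
    have h1 : 𝟙 (X d 1) = 0 := h0
    exact id_notMem_through one_pos (h1 ▸ zero_mem (through d 1 0))
  | m + 2, hm =>
    have := id_sub_jonesWenzl_mem_through (d := d) (q := q) m
    rw [h0, sub_zero] at this
    exact id_notMem_through (by omega) this

/-- For `n = l - 1 + j`, split `1_n` as `f_{l-1} ⊗ 1_j` plus `(1 - f_{l-1}) ⊗ 1_j`. The first lies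
in `J`; the second factors through `n - 2` strings, where induction applies, or is zero if `l = 2`.
-/
theorem id_mem_sup (h : IsRootParameter d q l) {J : ∀ Y Z : TL d, Submodule ℂ (Y ⟶ Z)}
    (hJ : IsMonoidalIdeal J) (hf : jonesWenzl d q (l - 1) ∈ J _ _) (n : ℕ) :
    𝟙 (X d n) ∈ jonesWenzlSpan d q (l - 1) (X d n) (X d n) ⊔ J (X d n) (X d n) := by
  have hl := h.two_le
  induction n using Nat.strong_induction_on with
  | _ n ih =>
  by_cases hn : n < l - 1
  · exact Submodule.mem_sup_left (jonesWenzlSpan_mono (by omega) _ _ (id_mem_jonesWenzlSpan n))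
  · obtain ⟨j, rfl⟩ := Nat.exists_eq_add_of_le (not_lt.1 hn)
    have h1 : tensorHom (jonesWenzl d q (l - 1)) (𝟙 (X d j)) ∈
        jonesWenzlSpan d q (l - 1) (X d (l - 1 + j)) (X d (l - 1 + j)) ⊔ J _ _ :=
      Submodule.mem_sup_right (hJ.tensorHom_id_mem hf j)
    have h2 : tensorHom (𝟙 (X d (l - 1)) - jonesWenzl d q (l - 1)) (𝟙 (X d j)) ∈
        jonesWenzlSpan d q (l - 1) (X d (l - 1 + j)) (X d (l - 1 + j)) ⊔ J _ _ := by
      obtain ⟨m, hm⟩ : ∃ m, m = l - 1 := ⟨_, rfl⟩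
      rw [← hm]
      match m, hm with
      | 0, hm => omega
      | 1, hm => rw [jonesWenzl, sub_self, zero_tensorHom]; exact zero_mem _
      | m + 2, hm =>
        have h3 := tensorHom_id_mem_through (id_sub_jonesWenzl_mem_through (d := d) (q := q) m) j
        have h4 := ih (m + j) (by omega)
        rw [← hm] at h4
        refine (?_ : through d (m + 2 + j) (m + j) ≤ _) h3
        refine Submodule.span_le.2 ?_
        rintro _ ⟨a, b, rfl⟩
        obtain ⟨x, hx, y, hy, hxy⟩ := Submodule.mem_sup.1 h4
        have : a ≫ b = a ≫ x ≫ b + a ≫ y ≫ b := by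
          rw [← Preadditive.comp_add, ← Preadditive.add_comp, hxy, Category.id_comp]
        rw [this]
        exact add_mem (Submodule.mem_sup_left (comp_mem_jonesWenzlSpan a hx b))
          (Submodule.mem_sup_right (hJ.comp_mem a y b hy))
    have h3 := add_mem h2 h1
    rwa [← add_tensorHom, sub_add_cancel, id_tensorHom_id] at h3

theorem isMonoidalIdeal_ker : IsMonoidalIdeal (ker (d := d)) where
  comp_mem g _ h hf := comp_ker g (ker_comp hf h)
  tensor_mem g _ h hf := ker_tensor (tensor_ker g hf) h

theorem ker_eq_generatedIdeal (h : IsRootParameter d q l) (Y Z : TL d) :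
    ker Y Z = generatedIdeal (jonesWenzl d q (l - 1)) Y Z := by
  refine le_antisymm (fun f hf => ?_)
    (sInf_le ⟨ker, isMonoidalIdeal_ker, h.jonesWenzl_mem_ker, rfl⟩)
  refine Submodule.mem_sInf.2 ?_
  rintro _ ⟨J, hJ, hmem, rfl⟩
  obtain ⟨m⟩ := Y
  obtain ⟨n⟩ := Z
  obtain ⟨x, hx, y, hy, hxy⟩ := Submodule.mem_sup.1 (h.id_mem_sup hJ hmem m)
  obtain ⟨x', hx', y', hy', hxy'⟩ := Submodule.mem_sup.1 (h.id_mem_sup hJ hmem n)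
  -- With both identities split into a span part and a part in `J`, the term without a factor from
  -- `J` vanishes. The identities are inserted to match the three-fold form of `comp_mem`.
  have e : f = x ≫ f ≫ x' + 𝟙 _ ≫ y ≫ f ≫ x' + f ≫ y' ≫ 𝟙 _ := by
    rw [Category.id_comp, Category.comp_id, ← Preadditive.add_comp, hxy, Category.id_comp,
      ← Preadditive.comp_add, hxy', Category.comp_id]
  rw [e, h.jonesWenzlSpan_comp_ker_comp hf hx hx', zero_add]
  exact add_mem (hJ.comp_mem _ _ _ hy) (hJ.comp_mem _ _ _ hy')

end IsRootParameter

end Ideal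

/-! ### Abstract semisimplicity criterion -/

section SemisimpleSystem

variable {C : Type*} [Category C] [Preadditive C] {ι : Type*}

/-- A family of endomorphisms `p k` such that all morphisms factor additively through the `p k`,
the morphisms between the images of `p j` and `p k` vanish for `j ≠ k`, and the nonzero
endomorphisms of the image of `p k` are invertible. -/
structure SemisimpleSystem (Z : ι → C) (p : ∀ k, Z k ⟶ Z k) : Prop where
  eq_of_ne_zero : ∀ {j k : ι} (f : Z j ⟶ Z k), p j ≫ f ≫ p k ≠ 0 → j = k
  exists_inv : ∀ {k : ι} (f : Z k ⟶ Z k), p k ≫ f ≫ p k ≠ 0 → ∃ g : Z k ⟶ Z k,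
    (p k ≫ f ≫ p k) ≫ g = p k
  id_mem : ∀ Y : C, 𝟙 Y ∈ AddSubgroup.closure
    {f : Y ⟶ Y | ∃ (k : ι) (a : Y ⟶ Z k) (b : Z k ⟶ Y), f = a ≫ p k ≫ b}

/-- Conjugation by two morphisms. -/
def conjHom {Y Y' Z Z' : C} (a : Y ⟶ Y') (b : Z' ⟶ Z) : (Y' ⟶ Z') →+ (Y ⟶ Z) where
  toFun f := a ≫ f ≫ b
  map_zero' := by simp
  map_add' f g := by simp

namespace SemisimpleSystem

variable {Z : ι → C} {p : ∀ k, Z k ⟶ Z k}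

/-- Otherwise `f` would be annihilated by the additive group generated by the `a ≫ p k ≫ b`, which
contains the identity. -/
theorem exists_comp_ne_zero (h : SemisimpleSystem Z p) {Y W : C} (f : Y ⟶ W) (hf : f ≠ 0) :
    ∃ (k : ι) (a : Z k ⟶ Y), p k ≫ a ≫ f ≠ 0 := by
  by_contra! H
  have : AddSubgroup.closure {g : Y ⟶ Y | ∃ (k : ι) (a : Y ⟶ Z k) (b : Z k ⟶ Y),
      g = a ≫ p k ≫ b} ≤ (conjHom (𝟙 Y) f).ker := by
    rw [AddSubgroup.closure_le]
    rintro _ ⟨k, a, b, rfl⟩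
    change 𝟙 Y ≫ (a ≫ p k ≫ b) ≫ f = 0
    simp only [Category.assoc, H, Limits.comp_zero]
  have h1 : 𝟙 Y ≫ 𝟙 Y ≫ f = 0 := this (h.id_mem Y)
  rw [Category.id_comp, Category.id_comp] at h1
  exact hf h1

theorem exists_comp_ne_zero' (h : SemisimpleSystem Z p) {Y W : C} (f : Y ⟶ W) (hf : f ≠ 0) :
    ∃ (k : ι) (a : W ⟶ Z k), f ≫ a ≫ p k ≠ 0 := by
  by_contra! H
  have : AddSubgroup.closure {g : W ⟶ W | ∃ (k : ι) (a : W ⟶ Z k) (b : Z k ⟶ W),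
      g = a ≫ p k ≫ b} ≤ (conjHom f (𝟙 W)).ker := by
    rw [AddSubgroup.closure_le]
    rintro _ ⟨k, a, b, rfl⟩
    change f ≫ (a ≫ p k ≫ b) ≫ 𝟙 W = 0
    have := congrArg (· ≫ b) (H k a)
    simpa only [Category.comp_id, Category.assoc, Limits.zero_comp] using this
  have h1 : f ≫ 𝟙 W ≫ 𝟙 W = 0 := this (h.id_mem W)
  rw [Category.comp_id, Category.comp_id] at h1
  exact hf h1

/-- A nonzero morphism out of the image of `p k` has a retraction. -/
theorem exists_retraction (h : SemisimpleSystem Z p) {k : ι} {Y : C} (f : Z k ⟶ Y)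
    (hf : p k ≫ f ≠ 0) : ∃ g : Y ⟶ Z k, p k ≫ f ≫ g = p k := by
  obtain ⟨j, a, ha⟩ := h.exists_comp_ne_zero' _ hf
  have ha' : p k ≫ (f ≫ a) ≫ p j ≠ 0 := by simpa only [Category.assoc] using ha
  obtain rfl := h.eq_of_ne_zero _ ha'
  obtain ⟨g, hg⟩ := h.exists_inv _ ha'
  exact ⟨a ≫ p k ≫ g, by simpa only [Category.assoc] using hg⟩

/-- Multiplication in `End Y` reverses composition, so the left ideal consists of the `(a ≫ p k ≫ b)
≫ r`. If such an element is nonzero, so is `p k ≫ b ≫ r`, and a retraction of it recovers the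
generator. -/
theorem isAtom_span (h : SemisimpleSystem Z p) {Y : C} {k : ι} (a : Y ⟶ Z k) (b : Z k ⟶ Y)
    (hab : a ≫ p k ≫ b ≠ 0) :
    IsAtom (Submodule.span (End Y) {(a ≫ p k ≫ b : End Y)}) := by
  rw [isAtom_iff_le_of_ge]
  refine ⟨fun h0 => hab (Submodule.span_singleton_eq_bot.1 h0), fun N hN hle => ?_⟩
  obtain ⟨y, hyN, hy0⟩ := N.ne_bot_iff.1 hN
  obtain ⟨r, hr⟩ := Submodule.mem_span_singleton.1 (hle hyN)
  have hr' : (a ≫ p k ≫ b) ≫ (r : Y ⟶ Y) = y := hr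
  have hne : p k ≫ b ≫ (r : Y ⟶ Y) ≠ 0 := fun e => hy0 (by
    rw [← hr', Category.assoc, Category.assoc, e, Limits.comp_zero])
  obtain ⟨g, hg⟩ := h.exists_retraction _ hne
  rw [Submodule.span_singleton_le_iff_mem]
  have : (a ≫ p k ≫ b : Y ⟶ Y) = (y : Y ⟶ Y) ≫ g ≫ b := by
    have := congrArg (fun f => a ≫ f ≫ b) hg
    simp only [Category.assoc] at this
    rw [← hr', ← this]
    simp only [Category.assoc, this]
  rw [this]
  exact N.smul_mem (g ≫ b : End Y) hyN

/-- The endomorphism rings are semisimple. -/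
theorem isSemisimpleRing_end (h : SemisimpleSystem Z p) (Y : C) : IsSemisimpleRing (End Y) := by
  -- The identity is a sum of elements of minimal left ideals, so these ideals span the whole ring.
  refine IsSemisimpleModule.of_sSup_simples_eq_top ?_
  set S := sSup {m : Submodule (End Y) (End Y) | IsSimpleModule (End Y) m}
  have h1 : AddSubgroup.closure {f : Y ⟶ Y | ∃ (k : ι) (a : Y ⟶ Z k) (b : Z k ⟶ Y),
      f = a ≫ p k ≫ b} ≤ S.toAddSubgroup := by
    rw [AddSubgroup.closure_le]
    rintro _ ⟨k, a, b, rfl⟩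
    by_cases h0 : a ≫ p k ≫ b = 0
    · rw [h0]
      exact S.zero_mem
    · have hs := isSimpleModule_iff_isAtom.2 (h.isAtom_span a b h0)
      exact le_sSup (a := Submodule.span (End Y) {(a ≫ p k ≫ b : End Y)}) hs
        (Submodule.mem_span_singleton_self _)
  rw [eq_top_iff]
  intro r _
  have h2 : (1 : End Y) ∈ S := h1 (h.id_mem Y)
  have := S.smul_mem r h2
  rwa [smul_eq_mul, mul_one] at this

/-- Semisimple systems pass to the category of formal direct sums. -/
theorem mat (h : SemisimpleSystem Z p) :
    SemisimpleSystem (fun k => (Mat_.embedding C).obj (Z k))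
      (fun k => (Mat_.embedding C).map (p k)) where
  eq_of_ne_zero {j k} f hf := by
    obtain ⟨f, rfl⟩ := (Mat_.embedding C).map_surjective f
    refine h.eq_of_ne_zero f fun e => hf ?_
    rw [← Functor.map_comp, ← Functor.map_comp, e, Functor.map_zero]
  exists_inv {k} f hf := by
    obtain ⟨f, rfl⟩ := (Mat_.embedding C).map_surjective f
    obtain ⟨g, hg⟩ := h.exists_inv f fun e => hf (by
      rw [← Functor.map_comp, ← Functor.map_comp, e, Functor.map_zero])
    exact ⟨(Mat_.embedding C).map g, by simp only [← Functor.map_comp, hg]⟩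
  id_mem M := by
    classical
    set T := AddSubgroup.closure {f : M ⟶ M | ∃ (k : ι) (a : M ⟶ (Mat_.embedding C).obj (Z k))
      (b : (Mat_.embedding C).obj (Z k) ⟶ M), f = a ≫ (Mat_.embedding C).map (p k) ≫ b}
    -- Inserting the decomposition of `𝟙 W` handles everything factoring through a single object. `𝟙
    -- M` is a sum of such morphisms by the biproduct decomposition `h3`.
    have h1 : ∀ (W : C) (a : M ⟶ (Mat_.embedding C).obj W) (b : (Mat_.embedding C).obj W ⟶ M),
        a ≫ b ∈ T := by
      intro W a b
      have : AddSubgroup.closure {f : W ⟶ W | ∃ (k : ι) (a : W ⟶ Z k) (b : Z k ⟶ W),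
          f = a ≫ p k ≫ b} ≤ T.comap ((conjHom a b).comp (Mat_.embedding C).mapAddHom) := by
        rw [AddSubgroup.closure_le]
        rintro _ ⟨k, a', b', rfl⟩
        exact AddSubgroup.subset_closure ⟨k, a ≫ (Mat_.embedding C).map a',
          (Mat_.embedding C).map b' ≫ b, by simp [conjHom, Functor.mapAddHom]⟩
      have h2 : a ≫ (Mat_.embedding C).map (𝟙 W) ≫ b ∈ T := this (h.id_mem W)
      rwa [CategoryTheory.Functor.map_id, Category.id_comp] at h2
    have h3 : 𝟙 M = ∑ i, (M.isoBiproductEmbedding.hom ≫ Limits.biproduct.π _ i) ≫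
        Limits.biproduct.ι (fun i => (Mat_.embedding C).obj (M.X i)) i ≫
          M.isoBiproductEmbedding.inv := by
      rw [← M.isoBiproductEmbedding.hom_inv_id]
      conv_lhs => rw [← Category.id_comp M.isoBiproductEmbedding.inv, ← Limits.biproduct.total,
        Preadditive.sum_comp, Preadditive.comp_sum]
      simp only [Category.assoc]
    rw [h3]
    exact sum_mem fun i _ => h1 _ _ _

open Idempotents in
/-- Semisimple systems pass to the idempotent completion. -/
theorem karoubi {S : ι → Karoubi C} (h : SemisimpleSystem (fun k => (S k).X) (fun k => (S k).p)) :
    SemisimpleSystem S (fun k => 𝟙 (S k)) where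
  eq_of_ne_zero {j k} f hf := by
    refine h.eq_of_ne_zero f.f fun e => hf ?_
    ext
    simpa using e
  exists_inv {k} f hf := by
    obtain ⟨g, hg⟩ := h.exists_inv f.f fun e => hf (by ext; simpa using e)
    refine ⟨⟨(S k).p ≫ g ≫ (S k).p, by simp⟩, ?_⟩
    ext
    have := congrArg (· ≫ (S k).p) hg
    simpa using this
  id_mem Y := by
    -- Compression by `Y.p` turns a decomposition of the identity of `Y.X` into one of the identity
    -- of `Y`.
    let φ : (Y.X ⟶ Y.X) →+ (Y ⟶ Y) :=
      { toFun := fun f => ⟨Y.p ≫ f ≫ Y.p, by simp⟩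
        map_zero' := by ext; simp
        map_add' := fun f g => by ext; simp }
    set T := AddSubgroup.closure {f : Y ⟶ Y | ∃ (k : ι) (a : Y ⟶ S k) (b : S k ⟶ Y),
      f = a ≫ 𝟙 (S k) ≫ b}
    have : AddSubgroup.closure {f : Y.X ⟶ Y.X | ∃ (k : ι) (a : Y.X ⟶ (S k).X)
        (b : (S k).X ⟶ Y.X), f = a ≫ (S k).p ≫ b} ≤ T.comap φ := by
      rw [AddSubgroup.closure_le]
      rintro _ ⟨k, a, b, rfl⟩
      refine AddSubgroup.subset_closure ⟨k, ⟨Y.p ≫ a ≫ (S k).p, by simp⟩,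
        ⟨(S k).p ≫ b ≫ Y.p, by simp⟩, ?_⟩
      ext
      simp [φ]
    have h1 : φ (𝟙 _) ∈ T := this (h.id_mem Y.X)
    have h2 : φ (𝟙 _) = 𝟙 Y := by ext; simp [φ]
    rwa [h2] at h1

end SemisimpleSystem

/-- A family of pairwise non-isomorphic objects with `Hom (S j) (S k) = 0` for `j ≠ k`, whose
nonzero endomorphisms are invertible, through which all morphisms factor additively. -/
abbrev SemisimpleFamily (S : ι → C) : Prop := SemisimpleSystem S (fun k => 𝟙 (S k))

/-! ### Simple objects and direct sum decompositions -/

namespace SemisimpleFamily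

variable {S : ι → C}

theorem exists_retraction (h : SemisimpleFamily S) {k : ι} {Y : C} (f : S k ⟶ Y) (hf : f ≠ 0) :
    ∃ g : Y ⟶ S k, f ≫ g = 𝟙 (S k) := by
  obtain ⟨g, hg⟩ := SemisimpleSystem.exists_retraction h f (by rwa [Category.id_comp])
  exact ⟨g, by rwa [Category.id_comp] at hg⟩

/-- For a nonzero monomorphism `f` into `S k`, some `a` from a member of the family has `a ≫ f ≠ 0`.
That member must be `S k`, and `a ≫ f` is invertible, so `f` is a split epimorphism as well. -/
theorem simple (h : SemisimpleFamily S) (k : ι) (hk : 𝟙 (S k) ≠ 0) : Simple (S k) where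
  mono_isIso_iff_nonzero {Y} f _ := by
    constructor
    · intro hf h0
      apply hk
      exact (IsIso.inv_hom_id f).symm.trans ((congrArg (inv f ≫ ·) h0).trans Limits.comp_zero)
    · intro hf
      obtain ⟨j, a, ha⟩ := SemisimpleSystem.exists_comp_ne_zero h f hf
      rw [Category.id_comp] at ha
      obtain rfl := SemisimpleSystem.eq_of_ne_zero h (a ≫ f) (by simpa using ha)
      obtain ⟨g, hg⟩ := h.exists_retraction (a ≫ f) ha
      -- One-sided inverses are two-sided here: `v` is nonzero, so it has a retraction, which must
      -- equal `u`.
      have hsq : ∀ (u : S j ⟶ S j) (v : S j ⟶ S j), u ≫ v = 𝟙 _ → v ≫ u = 𝟙 _ := by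
        intro u v huv
        have hv : v ≠ 0 := by
          rintro rfl
          exact hk (by rw [← huv, Limits.comp_zero])
        obtain ⟨w, hw⟩ := h.exists_retraction v hv
        have : u = w := by
          rw [← Category.comp_id u, ← hw, ← Category.assoc, huv, Category.id_comp]
        rw [this, hw]
      have hsplit : (g ≫ a) ≫ f = 𝟙 (S j) := by
        rw [Category.assoc]
        exact hsq _ _ hg
      refine ⟨g ≫ a, ?_, hsplit⟩
      rw [← cancel_mono f, Category.assoc, hsplit, Category.comp_id, Category.id_comp]

theorem exists_iso_of_simple (h : SemisimpleFamily S) (Y : C) [Simple Y] :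
    ∃ k, Nonempty (Y ≅ S k) := by
  have hY : 𝟙 Y ≠ 0 := (Simple.mono_isIso_iff_nonzero (𝟙 Y)).1 inferInstance
  obtain ⟨k, a, ha⟩ := SemisimpleSystem.exists_comp_ne_zero h (𝟙 Y) hY
  rw [Category.id_comp, Category.comp_id] at ha
  obtain ⟨g, hg⟩ := h.exists_retraction a ha
  have : Mono a := mono_of_mono_fac hg
  have := isIso_of_mono_of_nonzero ha
  exact ⟨k, ⟨(asIso a).symm⟩⟩

/-- Induction on the number of terms in `𝟙 Y = ∑ a i ≫ b i`. A nonzero `b 0` has a retraction `g`,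
so `g ≫ b 0` is an idempotent splitting off a copy of `S (s 0)`. On the complement `W` the first
term disappears, since `b 0 ≫ e = 0`, and one term fewer remains. -/
theorem exists_isDirectSum [IsIdempotentComplete C] (h : SemisimpleFamily S) (Y : C) :
    ∃ (n : ℕ) (s : Fin n → ι), IsDirectSum Y fun i => S (s i) := by
  have key : ∀ (n : ℕ) (Y : C) (s : Fin n → ι) (a : ∀ i, Y ⟶ S (s i)) (b : ∀ i, S (s i) ⟶ Y),
      ∑ i, a i ≫ b i = 𝟙 Y → ∃ (n : ℕ) (s : Fin n → ι), IsDirectSum Y fun i => S (s i) := by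
    intro n
    induction n with
    | zero =>
      intro Y s a b hab
      exact ⟨0, s, b, a, fun j => j.elim0, fun j => j.elim0, hab⟩
    | succ n ih =>
      intro Y s a b hab
      rw [Fin.sum_univ_succ] at hab
      by_cases hb : b 0 = 0
      · rw [hb, Limits.comp_zero, zero_add] at hab
        exact ih Y _ _ _ hab
      obtain ⟨g, hg⟩ := h.exists_retraction (b 0) hb
      obtain ⟨W, i, e, hie, hei⟩ := IsIdempotentComplete.idempotents_split Y (𝟙 Y - g ≫ b 0)
        (Idempotents.idem_of_id_sub_idem _ (by
          rw [Category.assoc, ← Category.assoc (b 0), hg, Category.id_comp]))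
      have hbe : b 0 ≫ e = 0 := by
        have : b 0 ≫ (e ≫ i) ≫ e = 0 := by
          rw [hei, Preadditive.sub_comp, Category.id_comp, Preadditive.comp_sub, Category.assoc,
            ← Category.assoc (b 0), hg, Category.id_comp, sub_self]
        rwa [Category.assoc, hie, Category.comp_id] at this
      have hig : i ≫ g = 0 := by
        have : i ≫ (e ≫ i) ≫ g = 0 := by
          rw [hei, Preadditive.sub_comp, Category.id_comp, Preadditive.comp_sub, Category.assoc,
            hg, Category.comp_id, sub_self]
        rwa [Category.assoc, ← Category.assoc, hie, Category.id_comp] at this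
      obtain ⟨m, t, α, β, h1, h2, h3⟩ := ih W (fun j => s j.succ) (fun j => i ≫ a j.succ)
        (fun j => b j.succ ≫ e) (by
          have := congrArg (fun f => i ≫ f ≫ e) hab
          simp only [Preadditive.add_comp, Category.assoc, hbe,
            Limits.comp_zero, zero_add, Preadditive.sum_comp, Preadditive.comp_sum,
            Category.id_comp, hie] at this
          simpa only [Category.assoc] using this)
      refine ⟨m + 1, Fin.cons (s 0) t, Fin.cases (b 0) fun j => α j ≫ i,
        Fin.cases g fun j => e ≫ β j, ?_, ?_, ?_⟩
      · intro j
        induction j using Fin.cases with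
        | zero => exact hg
        | succ j =>
          change (α j ≫ i) ≫ e ≫ β j = 𝟙 (S (t j))
          rw [Category.assoc, ← Category.assoc i, hie, Category.id_comp, h1]
      · intro j k hjk
        induction j using Fin.cases with
        | zero =>
          induction k using Fin.cases with
          | zero => exact absurd rfl hjk
          | succ k =>
            change b 0 ≫ e ≫ β k = 0
            rw [← Category.assoc, hbe, Limits.zero_comp]
        | succ j =>
          induction k using Fin.cases with
          | zero =>
            change (α j ≫ i) ≫ g = 0
            rw [Category.assoc, hig, Limits.comp_zero]
          | succ k =>
            change (α j ≫ i) ≫ e ≫ β k = 0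
            rw [Category.assoc, ← Category.assoc i, hie, Category.id_comp,
              h2 j k fun e => hjk (by rw [e])]
      · rw [Fin.sum_univ_succ]
        change g ≫ b 0 + ∑ j, (e ≫ β j) ≫ α j ≫ i = 𝟙 Y
        have := congrArg (fun f => e ≫ f ≫ i) h3
        simp only [Preadditive.sum_comp, Preadditive.comp_sum, Category.id_comp, hei,
          Category.assoc] at this
        simp only [Category.assoc]
        rw [this, add_sub_cancel]
  suffices H : ∀ f ∈ AddSubgroup.closure
      {f : Y ⟶ Y | ∃ (k : ι) (a : Y ⟶ S k) (b : S k ⟶ Y), f = a ≫ 𝟙 (S k) ≫ b},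
      ∃ (n : ℕ) (s : Fin n → ι) (a : ∀ i, Y ⟶ S (s i)) (b : ∀ i, S (s i) ⟶ Y),
      ∑ i, a i ≫ b i = f by
    obtain ⟨n, s, a, b, hab⟩ := H _ (SemisimpleSystem.id_mem h Y)
    exact key n Y s a b hab
  intro f hf
  induction hf using AddSubgroup.closure_induction with
  | mem f hf =>
    obtain ⟨k, a, b, rfl⟩ := hf
    exact ⟨1, fun _ => k, fun _ => a, fun _ => b, by simp⟩
  | zero => exact ⟨0, Fin.elim0, fun i => i.elim0, fun i => i.elim0, by simp⟩
  | add f g _ _ hf hg =>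
    obtain ⟨m, s, a, b, rfl⟩ := hf
    obtain ⟨n, t, a', b', rfl⟩ := hg
    refine ⟨m + n, Fin.append s t,
      -- The labels from `Fin.append` agree with `s i` and `t i` only propositionally, hence the
      -- transports.
      Fin.addCases (fun i => a i ≫ eqToHom (by simp)) (fun i => a' i ≫ eqToHom (by simp)),
      Fin.addCases (fun i => eqToHom (by simp) ≫ b i) (fun i => eqToHom (by simp) ≫ b' i), ?_⟩
    simp [Fin.sum_univ_add]
  | neg f _ hf =>
    obtain ⟨m, s, a, b, rfl⟩ := hf
    exact ⟨m, s, a, fun i => - b i, by simp⟩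

end SemisimpleFamily
end SemisimpleSystem

/-! ### Splitting the tensor product with one more string -/

namespace IsRootParameter

variable {d q : ℂ} {l : ℕ}

theorem addString_idem (h : IsRootParameter d q l) {k : ℕ} (hk : k < l) :
    addString (jonesWenzl d q k) ≫ addString (jonesWenzl d q k) = addString (jonesWenzl d q k) := by
  rw [← addString_comp, h.idem hk]

theorem cupLast_comp (h : IsRootParameter d q l) {k : ℕ} (hk : k + 2 < l) :
    cupLast d k ≫ jonesWenzl d q (k + 2) = 0 := by
  have := congrArg dagger (h.comp_capLast hk)
  rwa [dagger_comp, dagger_capLast, dagger_jonesWenzl, map_zero] at this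

/-- `f_k` slides through the cap and is absorbed by `f_{k+1} ⊗ 1`. Hence the factor `f_k` in `proj ≫
incl` is redundant. -/
theorem addString_capLast_comp (h : IsRootParameter d q l) {k : ℕ} (hk : k + 1 < l) :
    addString (jonesWenzl d q (k + 1)) ≫ capLast d k ≫ jonesWenzl d q k =
      addString (jonesWenzl d q (k + 1)) ≫ capLast d k := by
  rw [← addString_addString_capLast, ← Category.assoc, ← addString_comp,
    h.succ_comp_addString hk]

/-- The inclusion of the image of `f_k` in that of `f_{k+1} ⊗ 1`. -/
noncomputable def incl (d q : ℂ) (k : ℕ) : X d k ⟶ X d (k + 2) :=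
  jonesWenzl d q k ≫ cupLast d k ≫ addString (jonesWenzl d q (k + 1))

/-- The projection from the image of `f_{k+1} ⊗ 1` to that of `f_k`. -/
noncomputable def proj (d q : ℂ) (k : ℕ) : X d (k + 2) ⟶ X d k :=
  -- The scalar is inverse to the partial trace factor, which normalises `incl ≫ proj` to `f_k`.
  (qInt q (k + 1) / qInt q (k + 2)) •
    (addString (jonesWenzl d q (k + 1)) ≫ capLast d k ≫ jonesWenzl d q k)

theorem incl_proj (h : IsRootParameter d q l) {k : ℕ} (hk : k + 2 < l) :
    incl d q k ≫ proj d q k = jonesWenzl d q k := by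
  have hk1 := h.qInt_ne_zero (k := k + 1) (by omega) (by omega)
  have hk2 := h.qInt_ne_zero (k := k + 2) (by omega) (by omega)
  have e : incl d q k ≫ proj d q k = (qInt q (k + 1) / qInt q (k + 2)) • (jonesWenzl d q k ≫
      (cupLast d k ≫ (addString (jonesWenzl d q (k + 1)) ≫ addString (jonesWenzl d q (k + 1))) ≫
        capLast d k) ≫ jonesWenzl d q k) := by
    simp only [incl, proj, Linear.comp_smul, Category.assoc]
  rw [e, h.addString_idem (by omega), h.partialTrace (by omega), Linear.smul_comp,
    Linear.comp_smul, h.idem (by omega), h.idem (by omega), smul_smul, div_mul_div_comm,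
    mul_comm, div_self (mul_ne_zero hk2 hk1), one_smul]

/-- The composite is precisely the correction term of Wenzl's recursion. -/
theorem proj_incl (h : IsRootParameter d q l) {k : ℕ} (hk : k + 2 < l) :
    proj d q k ≫ incl d q k =
      addString (jonesWenzl d q (k + 1)) - jonesWenzl d q (k + 2) := by
  have e : proj d q k ≫ incl d q k = (qInt q (k + 1) / qInt q (k + 2)) •
      ((addString (jonesWenzl d q (k + 1)) ≫ capLast d k ≫
        (jonesWenzl d q k ≫ jonesWenzl d q k)) ≫ cupLast d k ≫
          addString (jonesWenzl d q (k + 1))) := by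
    simp only [incl, proj, Linear.smul_comp, Category.assoc]
  rw [e, h.idem (by omega), h.addString_capLast_comp (by omega), jonesWenzl_succ_succ,
    sub_sub_cancel, Category.assoc]

theorem incl_comp (h : IsRootParameter d q l) {k : ℕ} (hk : k + 2 < l) :
    incl d q k ≫ jonesWenzl d q (k + 2) = 0 := by
  rw [incl, Category.assoc, Category.assoc, h.addString_comp_succ hk, h.cupLast_comp hk,
    Limits.comp_zero]

theorem comp_proj (h : IsRootParameter d q l) {k : ℕ} (hk : k + 2 < l) :
    jonesWenzl d q (k + 2) ≫ proj d q k = 0 := by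
  rw [proj, Linear.comp_smul, ← Category.assoc, h.succ_comp_addString hk, ← Category.assoc,
    h.comp_capLast hk, Limits.zero_comp, smul_zero]

theorem incl_comm (h : IsRootParameter d q l) {k : ℕ} (hk : k + 2 < l) :
    jonesWenzl d q k ≫ incl d q k ≫ addString (jonesWenzl d q (k + 1)) = incl d q k := by
  rw [incl, Category.assoc, Category.assoc, h.addString_idem (by omega), ← Category.assoc,
    h.idem (by omega)]

theorem proj_comm (h : IsRootParameter d q l) {k : ℕ} (hk : k + 2 < l) :
    addString (jonesWenzl d q (k + 1)) ≫ proj d q k ≫ jonesWenzl d q k = proj d q k := by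
  rw [proj, Linear.smul_comp, Linear.comp_smul, Category.assoc, Category.assoc,
    h.idem (by omega), ← Category.assoc, h.addString_idem (by omega)]

end IsRootParameter

/-! ### Semisimplicity of the reduced category -/

namespace ReducedTL

open Idempotents

variable {d q : ℂ} {l : ℕ}

theorem ofTL_surjective {Y Z : TL d} (f : (⟨Y⟩ : ReducedTL d) ⟶ ⟨Z⟩) : ∃ g : Y ⟶ Z, ofTL g = f :=
  Submodule.Quotient.mk_surjective _ f

theorem ofTL_eq_zero {Y Z : TL d} {f : Y ⟶ Z} : ofTL f = 0 ↔ f ∈ ker Y Z :=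
  Submodule.Quotient.mk_eq_zero _

theorem ofTL_zero {Y Z : TL d} : ofTL (0 : Y ⟶ Z) = 0 := rfl

theorem ofTL_add {Y Z : TL d} (f g : Y ⟶ Z) : ofTL (f + g) = ofTL f + ofTL g := rfl

theorem ofTL_sub {Y Z : TL d} (f g : Y ⟶ Z) : ofTL (f - g) = ofTL f - ofTL g := rfl

theorem ofTL_id (Y : TL d) : ofTL (𝟙 Y) = 𝟙 (⟨Y⟩ : ReducedTL d) := rfl

instance (Y Z : ReducedTL d) : FiniteDimensional ℂ (Y ⟶ Z) :=
  inferInstanceAs (FiniteDimensional ℂ ((Y.obj ⟶ Z.obj) ⧸ ker Y.obj Z.obj))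

/-- The object of the idempotent completion given by an idempotent of `TL d`. -/
noncomputable def image {n : ℕ} (p : X d n ⟶ X d n) (hp : p ≫ p = p) : Karoubi (ReducedTL d) where
  X := ⟨X d n⟩
  p := ofTL p
  idem := by rw [← ofTL_comp, hp]

/-- A morphism between images of idempotents. -/
noncomputable def imageHom {m n : ℕ} {p : X d m ⟶ X d m} {hp : p ≫ p = p} {p' : X d n ⟶ X d n}
    {hp' : p' ≫ p' = p'} (f : X d m ⟶ X d n) (hf : p ≫ f ≫ p' = f) : image p hp ⟶ image p' hp' where
  f := ofTL f
  comm := by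
    change ofTL p ≫ ofTL f ≫ ofTL p' = ofTL f
    rw [← ofTL_comp, ← ofTL_comp, hf]

theorem jonesWenzlObj_natCast (k : ℕ) (h : jonesWenzl d q k ≫ jonesWenzl d q k = jonesWenzl d q k) :
    jonesWenzlObj d q (k : ℤ) = image (jonesWenzl d q k) h := dif_pos h

theorem karoubiTensorObj_image {k : ℕ} (p : X d k ⟶ X d k) (hp : p ≫ p = p) :
    karoubiTensorObj (image p hp) (generator d) =
      image (addString p) (by rw [← addString_comp, hp]) := rfl

theorem jonesWenzlObj_neg_one_hom_eq_zero {Y : Karoubi (ReducedTL d)}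
    (f : Y ⟶ jonesWenzlObj d q (-1)) : f = 0 := by
  ext
  rw [← Karoubi.comp_p f]
  exact Limits.comp_zero

theorem semisimpleSystem (h : IsRootParameter d q l) :
    SemisimpleSystem (fun k : Fin (l - 1) => (⟨X d k⟩ : ReducedTL d))
      (fun k => ofTL (jonesWenzl d q k)) where
  eq_of_ne_zero {j k} f hf := by
    by_contra hjk
    obtain ⟨f, rfl⟩ := ofTL_surjective f
    refine hf ?_
    rw [← ofTL_comp, ← ofTL_comp, h.sandwich_ne (by omega) (by omega)
      (fun e => hjk (Fin.ext e)), ofTL_zero]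
  exists_inv {k} f hf := by
    obtain ⟨f, rfl⟩ := ofTL_surjective f
    obtain ⟨c, hc⟩ := h.exists_sandwich_eq (k := k) (by omega) f
    rw [← ofTL_comp, ← ofTL_comp, hc] at hf ⊢
    have hc0 : c ≠ 0 := by
      rintro rfl
      rw [zero_smul] at hf
      exact hf rfl
    refine ⟨ofTL (c⁻¹ • 𝟙 _), ?_⟩
    rw [← ofTL_comp, Linear.comp_smul, Category.comp_id, smul_smul, inv_mul_cancel₀ hc0, one_smul]
  id_mem Y := by
    obtain ⟨⟨n⟩⟩ := Y
    set T := AddSubgroup.closure {f : (⟨X d n⟩ : ReducedTL d) ⟶ ⟨X d n⟩ |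
      ∃ (k : Fin (l - 1)) (a : (⟨X d n⟩ : ReducedTL d) ⟶ ⟨X d k⟩) (b : (⟨X d k⟩ : ReducedTL d) ⟶
        ⟨X d n⟩), f = a ≫ ofTL (jonesWenzl d q k) ≫ b}
    -- `T` is only an additive closure, but a scalar can be absorbed into the factor `a`.
    have hsmul : ∀ (c : ℂ), ∀ f ∈ T, c • f ∈ T := by
      intro c f hf
      induction hf using AddSubgroup.closure_induction with
      | mem f hf =>
        obtain ⟨k, a, b, rfl⟩ := hf
        exact AddSubgroup.subset_closure ⟨k, c • a, b, by rw [Linear.smul_comp]⟩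
      | zero => rw [smul_zero]; exact zero_mem _
      | add f g _ _ hf hg => rw [smul_add]; exact add_mem hf hg
      | neg f _ hf => rw [smul_neg]; exact neg_mem hf
    have hspan : ∀ x ∈ jonesWenzlSpan d q (l - 1) (X d n) (X d n), ofTL x ∈ T := by
      intro x hx
      induction hx using Submodule.span_induction with
      | mem x hx =>
        obtain ⟨k, hk, a, b, rfl⟩ := hx
        exact AddSubgroup.subset_closure ⟨⟨k, hk⟩, ofTL a, ofTL b, rfl⟩
      | zero => exact zero_mem _
      | add x y _ _ hx hy => exact add_mem hx hy
      | smul c x _ hx => exact hsmul c _ hx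
    -- With the kernel itself as the ideal, the part `y` disappears in the quotient.
    obtain ⟨x, hx, y, hy, hxy⟩ := Submodule.mem_sup.1
      (h.id_mem_sup IsRootParameter.isMonoidalIdeal_ker h.jonesWenzl_mem_ker n)
    have : 𝟙 (⟨X d n⟩ : ReducedTL d) = ofTL x := by
      rw [← ofTL_id, ← hxy, ofTL_add, ofTL_eq_zero.2 hy, add_zero]
    change 𝟙 (⟨X d n⟩ : ReducedTL d) ∈ T
    rw [this]
    exact hspan x hx

theorem semisimpleFamily (h : IsRootParameter d q l) :
    SemisimpleFamily (fun k : Fin (l - 1) => jonesWenzlObj d q ((k : ℕ) : ℤ)) := by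
  have : (fun k : Fin (l - 1) => jonesWenzlObj d q ((k : ℕ) : ℤ)) =
      fun k : Fin (l - 1) => image (jonesWenzl d q k) (h.idem (by omega)) :=
    funext fun k => jonesWenzlObj_natCast _ _
  rw [this]
  exact SemisimpleSystem.karoubi (S := fun k : Fin (l - 1) =>
    image (jonesWenzl d q k) (h.idem (by omega))) (semisimpleSystem h)

theorem id_jonesWenzlObj_ne_zero (h : IsRootParameter d q l) {k : ℕ} (hk : k < l - 1) :
    𝟙 (jonesWenzlObj d q (k : ℤ)) ≠ 0 := by
  rw [jonesWenzlObj_natCast k (h.idem (by omega))]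
  intro h0
  have h1 : ofTL (jonesWenzl d q k) = 0 := congrArg Karoubi.Hom.f h0
  have h2 := ofTL_eq_zero.1 h1 (𝟙 _)
  rw [Category.comp_id] at h2
  exact h.tr_jonesWenzl_ne_zero hk h2

/-- The idempotent `p` is the underlying morphism of the identity of this object, so the conclusion
says that `f` is a scalar. -/
theorem exists_end_eq_smul (h : IsRootParameter d q l) {k : ℕ} (hk : k < l)
    (f : jonesWenzlObj d q (k : ℤ) ⟶ jonesWenzlObj d q (k : ℤ)) :
    ∃ c : ℂ, f.f = c • (jonesWenzlObj d q (k : ℤ)).p := by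
  revert f
  rw [jonesWenzlObj_natCast k (h.idem hk)]
  intro f
  obtain ⟨g, hg⟩ := ofTL_surjective f.f
  obtain ⟨c, hc⟩ := h.exists_sandwich_eq hk g
  refine ⟨c, ?_⟩
  rw [← f.comm, ← hg]
  exact congrArg ofTL hc

end ReducedTL

/-! ### Fusion rules -/

theorem isDirectSum_pair {C : Type*} [Category C] [Preadditive C] {Y A B : C} (a : A ⟶ Y)
    (b : B ⟶ Y) (a' : Y ⟶ A) (b' : Y ⟶ B) (haa : a ≫ a' = 𝟙 A) (hbb : b ≫ b' = 𝟙 B)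
    (hab : a ≫ b' = 0) (hba : b ≫ a' = 0) (h : a' ≫ a + b' ≫ b = 𝟙 Y) :
    IsDirectSum Y ![A, B] := by
  refine ⟨Fin.cases a (Fin.cases b fun j => j.elim0), Fin.cases a' (Fin.cases b' fun j => j.elim0),
    ?_, ?_, ?_⟩
  · intro j
    fin_cases j
    · exact haa
    · exact hbb
  · intro i j hij
    fin_cases i <;> fin_cases j
    · exact absurd rfl hij
    · exact hab
    · exact hba
    · exact absurd rfl hij
  · rw [Fin.sum_univ_two]
    exact h

namespace ReducedTL

open Idempotents

variable {d q : ℂ} {l : ℕ}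

/-- The first summand is zero by convention, and `f_0 ⊗ 1 = f_1 = 1_X`. -/
theorem isDirectSum_zero_tensor_generator (h : IsRootParameter d q l) :
    IsDirectSum (karoubiTensorObj (jonesWenzlObj d q (0 : ℕ)) (generator d))
      ![jonesWenzlObj d q (-1), jonesWenzlObj d q (1 : ℕ)] := by
  have hl := h.two_le
  rw [jonesWenzlObj_natCast 0 (h.idem (by omega)), jonesWenzlObj_natCast 1 (h.idem (by omega)),
    karoubiTensorObj_image]
  have e : addString (jonesWenzl d q 0) = jonesWenzl d q 1 := addString_id 0
  have hid : ∀ Y : TL d, 𝟙 Y ≫ 𝟙 Y ≫ 𝟙 Y = 𝟙 Y := fun Y => by simp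
  have h1 : addString (jonesWenzl d q 0) ≫ 𝟙 (X d 1) ≫ jonesWenzl d q 1 = 𝟙 (X d 1) := by
    rw [e]; exact hid _
  have h2 : jonesWenzl d q 1 ≫ 𝟙 (X d 1) ≫ addString (jonesWenzl d q 0) = 𝟙 (X d 1) := by
    rw [e]; exact hid _
  refine isDirectSum_pair 0 (imageHom (𝟙 (X d 1)) h2) 0 (imageHom (𝟙 (X d 1)) h1) ?_ ?_ ?_ ?_ ?_
  · exact (jonesWenzlObj_neg_one_hom_eq_zero _).trans (jonesWenzlObj_neg_one_hom_eq_zero _).symm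
  · ext
    exact congrArg ofTL (Category.comp_id (𝟙 (X d 1)))
  · exact Limits.zero_comp
  · exact Limits.comp_zero
  · rw [Limits.comp_zero]
    refine (zero_add (imageHom (𝟙 (X d 1)) h1 ≫ imageHom (𝟙 (X d 1)) h2)).trans ?_
    ext
    exact congrArg ofTL ((Category.comp_id (𝟙 (X d 1))).trans e.symm)

/-- The recursion splits `f_{k+1} ⊗ 1` into orthogonal idempotents: `f_{k+2}` and `proj ≫ incl`, the
latter equivalent to `f_k`. -/
theorem isDirectSum_succ_tensor_generator (h : IsRootParameter d q l) {k : ℕ} (hk : k + 2 < l) :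
    IsDirectSum (karoubiTensorObj (jonesWenzlObj d q (k + 1 : ℕ)) (generator d))
      ![jonesWenzlObj d q (k : ℕ), jonesWenzlObj d q (k + 2 : ℕ)] := by
  rw [jonesWenzlObj_natCast (k + 1) (h.idem (by omega)),
    jonesWenzlObj_natCast k (h.idem (by omega)), jonesWenzlObj_natCast (k + 2) (h.idem (by omega)), karoubiTensorObj_image]
  have h1 : jonesWenzl d q (k + 2) ≫ jonesWenzl d q (k + 2) ≫
      addString (jonesWenzl d q (k + 1)) = jonesWenzl d q (k + 2) := by
    rw [h.succ_comp_addString hk, h.idem hk]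
  have h2 : addString (jonesWenzl d q (k + 1)) ≫ jonesWenzl d q (k + 2) ≫
      jonesWenzl d q (k + 2) = jonesWenzl d q (k + 2) := by
    rw [h.idem hk, h.addString_comp_succ hk]
  refine isDirectSum_pair (imageHom (IsRootParameter.incl d q k) (h.incl_comm hk))
    (imageHom (jonesWenzl d q (k + 2)) h1)
    (imageHom (IsRootParameter.proj d q k) (h.proj_comm hk))
    (imageHom (jonesWenzl d q (k + 2)) h2) ?_ ?_ ?_ ?_ ?_
  · ext
    exact congrArg ofTL (h.incl_proj hk)
  · ext
    exact congrArg ofTL (h.idem hk)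
  · ext
    exact congrArg ofTL (h.incl_comp hk)
  · ext
    exact congrArg ofTL (h.comp_proj hk)
  · ext
    refine congrArg ofTL (?_ : IsRootParameter.proj d q k ≫ IsRootParameter.incl d q k +
      jonesWenzl d q (k + 2) ≫ jonesWenzl d q (k + 2) = addString (jonesWenzl d q (k + 1)))
    rw [h.proj_incl hk, h.idem hk, sub_add_cancel]

/-- The fusion rule for the last simple object. -/
theorem nonempty_tensor_generator_iso (h : IsRootParameter d q l) :
    Nonempty (karoubiTensorObj (jonesWenzlObj d q ((l : ℤ) - 2)) (generator d) ≅
      jonesWenzlObj d q ((l : ℤ) - 3)) := by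
  have hl := h.two_le
  obtain ⟨m, rfl⟩ := Nat.exists_eq_add_of_le' hl
  have hker := h.jonesWenzl_mem_ker
  match m, h, hker with
  -- For `l = 2` the left side is the image of `f_1 = 1_X`, which lies in the kernel, so both sides
  -- are zero objects.
  | 0, h, hker =>
    have e1 : (((0 + 2 : ℕ) : ℤ) - 2) = (0 : ℕ) := by norm_num
    have e2 : (((0 + 2 : ℕ) : ℤ) - 3) = -1 := by norm_num
    rw [e1, e2, jonesWenzlObj_natCast 0 (h.idem (by omega)), karoubiTensorObj_image]
    refine ⟨⟨0, 0, ?_, jonesWenzlObj_neg_one_hom_eq_zero _ |>.trans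
      (jonesWenzlObj_neg_one_hom_eq_zero _).symm⟩⟩
    ext
    refine Eq.trans ?_ ((congrArg ofTL (addString_id 0)).trans (ofTL_eq_zero.2 hker)).symm
    rw [Limits.comp_zero]
    rfl
  -- Here `l = m + 3`, and the class of `f_{m+2}` is zero, so `proj ≫ incl` becomes the identity of
  -- the tensor product.
  | m + 1, h, hker =>
    have e1 : (((m + 1 + 2 : ℕ) : ℤ) - 2) = (m + 1 : ℕ) := by push_cast; ring
    have e2 : (((m + 1 + 2 : ℕ) : ℤ) - 3) = (m : ℕ) := by push_cast; ring
    have hm : m + 2 < m + 1 + 2 := by omega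
    rw [e1, e2, jonesWenzlObj_natCast (m + 1) (h.idem (by omega)),
      jonesWenzlObj_natCast m (h.idem (by omega)), karoubiTensorObj_image]
    refine ⟨⟨imageHom (IsRootParameter.proj d q m) (h.proj_comm hm),
      imageHom (IsRootParameter.incl d q m) (h.incl_comm hm), ?_, ?_⟩⟩
    · ext
      refine (congrArg ofTL (h.proj_incl hm)).trans ?_
      have h0 : ofTL (jonesWenzl d q (m + 2)) = 0 := ofTL_eq_zero.2 hker
      rw [ofTL_sub, h0, sub_zero]
      rfl
    · ext
      exact congrArg ofTL (h.incl_proj hm)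

end ReducedTL
end TemperleyLieb

theorem mainTheorem4 (l : ℕ) (hl : 2 ≤ l) (d q : ℂ) (hd : d = q + q⁻¹)
    (hq : IsPrimitiveRoot (q ^ 2) l) :
    -- the elements `f_0, …, f_{l-1}` are idempotents
    (∀ k < l, jonesWenzl d q k ≫ jonesWenzl d q k =
      jonesWenzl d q k) ∧
    -- the trace kernel of `End (X^{⊗ k})` for `k ≤ l - 1`
    (∀ k < l - 1,
      TL.ker (X d k) (X d k) = ⊥) ∧
    jonesWenzl d q (l - 1) ≠ 0 ∧
    TL.ker (X d (l - 1)) (X d (l - 1)) =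
      Submodule.span ℂ {jonesWenzl d q (l - 1)} ∧
    -- the kernel is monoidally generated by `f_{l-1}`
    (∀ Y Z : TL d, TL.ker Y Z =
      TL.generatedIdeal (jonesWenzl d q (l - 1)) Y Z) ∧
    -- the reduced category is semisimple
    EssentiallySemisimple (ReducedTL d) ∧
    -- its simple objects
    (∀ k : ℕ, k ≤ l - 2 →
      Simple (ReducedTL.jonesWenzlObj d q k)) ∧
    (∀ k : ℕ, k ≤ l - 2 → ∀ f : ReducedTL.jonesWenzlObj d q k ⟶
      ReducedTL.jonesWenzlObj d q k,
      ∃ c : ℂ, f.f = c • (ReducedTL.jonesWenzlObj d q k).p) ∧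
    (∀ j k : ℕ, j ≤ l - 2 → k ≤ l - 2 → j ≠ k →
      ∀ f : ReducedTL.jonesWenzlObj d q j ⟶
        ReducedTL.jonesWenzlObj d q k, f = 0) ∧
    (∀ Y : Idempotents.Karoubi (ReducedTL d),
      Simple Y →
        ∃ k : ℕ, k ≤ l - 2 ∧ Nonempty (Y ≅ ReducedTL.jonesWenzlObj d q k)) ∧
    (∀ Y : Idempotents.Karoubi (ReducedTL d),
      ∃ (n : ℕ) (s : Fin n → ℕ), (∀ i, s i ≤ l - 2) ∧
        IsDirectSum Y
          fun i => ReducedTL.jonesWenzlObj d q (s i)) ∧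
    -- the fusion rules
    (∀ k : ℕ, k < l - 2 →
      IsDirectSum
        (ReducedTL.karoubiTensorObj
          (ReducedTL.jonesWenzlObj d q k) (ReducedTL.generator d))
        ![ReducedTL.jonesWenzlObj d q ((k : ℤ) - 1),
          ReducedTL.jonesWenzlObj d q ((k : ℤ) + 1)]) ∧
    Nonempty (ReducedTL.karoubiTensorObj
        (ReducedTL.jonesWenzlObj d q ((l : ℤ) - 2))
        (ReducedTL.generator d) ≅
      ReducedTL.jonesWenzlObj d q ((l : ℤ) - 3)) := by
  have h : IsRootParameter d q l := ⟨hl, hd, hq⟩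
  -- The family is indexed by `Fin (l - 1)`; since `2 ≤ l`, the bound `k ≤ l - 2` is the same as `k
  -- < l - 1`.
  have hS := ReducedTL.semisimpleFamily h
  refine ⟨fun k hk => h.idem hk, fun k hk => h.ker_eq_bot hk, h.jonesWenzl_ne_zero, h.ker_eq_span,
    h.ker_eq_generatedIdeal, ⟨fun Y Z => inferInstance,
      (ReducedTL.semisimpleSystem h).mat.isSemisimpleRing_end⟩,
    fun k hk => hS.simple ⟨k, by omega⟩ (ReducedTL.id_jonesWenzlObj_ne_zero h (by omega)),
    fun k hk f => ReducedTL.exists_end_eq_smul h (by omega) f, fun j k hj hk hjk f => ?_,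
    fun Y _ => ?_, fun Y => ?_, fun k hk => ?_, ReducedTL.nonempty_tensor_generator_iso h⟩
  · by_contra hf
    refine hjk (congrArg Fin.val (SemisimpleSystem.eq_of_ne_zero hS (j := ⟨j, by omega⟩)
      (k := ⟨k, by omega⟩) f ?_))
    rw [Category.comp_id, Category.id_comp]
    exact hf
  · obtain ⟨k, hk⟩ := hS.exists_iso_of_simple Y
    exact ⟨k, by omega, hk⟩
  · obtain ⟨n, s, hs⟩ := hS.exists_isDirectSum Y
    exact ⟨n, fun i => s i, fun i => by have := (s i).2; change (s i : ℕ) ≤ l - 2; omega, hs⟩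
  · cases k with
    | zero => exact ReducedTL.isDirectSum_zero_tensor_generator h
    | succ k =>
      have e : ((k + 1 : ℕ) : ℤ) - 1 = (k : ℕ) := by push_cast; ring
      rw [e]
      exact ReducedTL.isDirectSum_succ_tensor_generator h (by omega)
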